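/- There are a deterministic word-RAM program and constants $c,k\in\mathbb N$, $C>0$ with the following property. Let $n\ge 1$, let $X,Y$ be integer sequences of length $n$, let $0<\varepsilon\le n$ be real, and let $\varepsilon$ be passed to the program as a fraction $p/q$ of positive integers with $p/q\le\varepsilon\le 2p/q$ (for rational $\varepsilon$ one may take $p/q=\varepsilon$). Suppose that $n$, $p$, $q$ and the absolute values of all elements of $X$ and $Y$ are less than $2^b$. Then the program, given $n,p,q,X,Y$ on a machine with words of $c\cdot b$ bits (and a sign) and unit-cost operations (addition, subtraction, multiplication, integer division, comparison, indirect memory access), computes within $$C\, n^{3/2}\,\varepsilon^{-1/2}\,(\log(n+2))^{k}$$ steps a $(1+\varepsilon)$-approximation of the longest common increasing subsequence (LCIS) of $X$ and $Y$, that is, a strictly increasing sequence $Z$ that is a subsequence of both $X$ and $Y$ and satisfies $L\le(1+\varepsilon)\,|Z|$, where $L$ is the maximal length of a strictly increasing common subsequence of $X$ and $Y$. In short: a $(1+\varepsilon)$-approximation of the LCIS of two sequences of length $n$ can be computed in $O(n^{3/2}\varepsilon^{-1/2}\,\mathrm{polylog}(n))$ time. -/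

import Mathlib

/-! ### Common increasing subsequences -/

/-- `Z` is a strictly increasing sequence that is a subsequence of both `X` and `Y`. -/
def IsCommonIncSubseq (Z X Y : List ℤ) : Prop :=
  Z.Pairwise (· < ·) ∧ Z.Sublist X ∧ Z.Sublist Y

/-- The length of a longest common strictly increasing subsequence of `X` and `Y`. -/
noncomputable def lcis (X Y : List ℤ) : ℕ :=
  sSup {m : ℕ | ∃ Z : List ℤ, IsCommonIncSubseq Z X Y ∧ Z.length = m}

/-- The supremum in `lcis` is a maximum. -/
theorem lcis_isGreatest (X Y : List ℤ) :
    IsGreatest {m : ℕ | ∃ Z : List ℤ, IsCommonIncSubseq Z X Y ∧ Z.length = m} (lcis X Y) := by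
  have hne : {m : ℕ | ∃ Z : List ℤ, IsCommonIncSubseq Z X Y ∧ Z.length = m}.Nonempty :=
    ⟨0, [], ⟨List.Pairwise.nil, List.nil_sublist X, List.nil_sublist Y⟩, rfl⟩
  have hbd : BddAbove {m : ℕ | ∃ Z : List ℤ, IsCommonIncSubseq Z X Y ∧ Z.length = m} := by
    refine ⟨X.length, ?_⟩
    rintro m ⟨Z, hZ, rfl⟩
    exact hZ.2.1.length_le
  exact ⟨Nat.sSup_mem hne hbd, fun m hm => le_csSup hbd hm⟩

/-- `Z` is a `(1 + ε)`-approximation of the longest common increasing subsequence of `X` and `Y`: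
a feasible solution that is shorter than an optimal one by a factor of at most `1 + ε`. -/
def IsApproxLCIS (ε : ℝ) (X Y Z : List ℤ) : Prop :=
  IsCommonIncSubseq Z X Y ∧ (lcis X Y : ℝ) ≤ (1 + ε) * (Z.length : ℝ)

/-! ### The word RAM

A program is a finite list of instructions working on registers and on a random access memory.
Every register and every memory cell holds one machine word: with word size `w` this is an integer
of absolute value less than `2 ^ w`. Each instruction takes one unit of time. -/

namespace WordRAM

/-- Instructions; `d`, `a`, `b` are names of registers. -/
inductive Instr where
  /-- `d := z` -/
  | const (d : ℕ) (z : ℤ)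
  /-- `d := a` -/
  | move (d a : ℕ)
  /-- `d := a + b` -/
  | add (d a b : ℕ)
  /-- `d := a - b` -/
  | sub (d a b : ℕ)
  /-- `d := a * b` -/
  | mul (d a b : ℕ)
  /-- `d := a / b`, integer division (with value `0` if `b` holds `0`) -/
  | div (d a b : ℕ)
  /-- `d := memory[a]` -/
  | load (d a : ℕ)
  /-- `memory[a] := b` -/
  | store (a b : ℕ)
  /-- continue with instruction number `l` of the program if `a < b` -/
  | jumpLt (a b : ℕ) (l : ℕ)
  /-- stop -/
  | halt

/-- Programs; they are independent of the input and of the word size. -/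
abbrev Program := List Instr

/-- Configurations: program counter, registers and memory. -/
structure Config where
  pc : ℕ
  reg : ℕ → ℤ
  mem : ℕ → ℤ

/-- Write the value `v` to register `d` and go on to the next instruction; this fails if `v` does
not fit into a word of `w` bits and a sign. -/
def Config.assign (w : ℕ) (s : Config) (d : ℕ) (v : ℤ) : Option Config :=
  if |v| < 2 ^ w then some ⟨s.pc + 1, Function.update s.reg d v, s.mem⟩ else none

/-- One step of the machine with word size `w`. There is no next configuration if the
machine has halted or fails (overflow, negative address, or program counter out of range). -/
def step (w : ℕ) (P : Program) (s : Config) : Option Config :=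
  match P[s.pc]? with
  | none => none
  | some (.const d z) => s.assign w d z
  | some (.move d a) => s.assign w d (s.reg a)
  | some (.add d a b) => s.assign w d (s.reg a + s.reg b)
  | some (.sub d a b) => s.assign w d (s.reg a - s.reg b)
  | some (.mul d a b) => s.assign w d (s.reg a * s.reg b)
  | some (.div d a b) => s.assign w d (s.reg a / s.reg b)
  | some (.load d a) =>
      if 0 ≤ s.reg a then s.assign w d (s.mem (s.reg a).toNat) else none
  | some (.store a b) =>
      if 0 ≤ s.reg a then
        some ⟨s.pc + 1, s.reg, Function.update s.mem (s.reg a).toNat (s.reg b)⟩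
      else none
  | some (.jumpLt a b l) =>
      some ⟨if s.reg a < s.reg b then l else s.pc + 1, s.reg, s.mem⟩
  | some .halt => none

/-- The configuration after exactly `t` steps, if the machine gets that far. -/
def run (w : ℕ) (P : Program) : ℕ → Config → Option Config
  | 0, s => some s
  | t + 1, s => (step w P s).bind (run w P t)

/-- The machine with word size `w` and program `P`, started in `s`, halts regularly after exactly
`t` steps, in the configuration `s'`. -/
def HaltsAfter (w : ℕ) (P : Program) (s : Config) (t : ℕ) (s' : Config) : Prop :=
  run w P t s = some s' ∧ P[s'.pc]? = some .halt

end WordRAM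

/-- Input of the LCIS approximation problem: the common length of the two sequences and the numbers
`p`, `q` are in registers `0`, `1`, `2`, the memory holds `X` followed by `Y`, and all other
registers and cells are `0`. -/
def lcisInput (X Y : List ℤ) (p q : ℕ) : WordRAM.Config where
  pc := 0
  reg := fun i => if i = 0 then (X.length : ℤ) else if i = 1 then (p : ℤ)
    else if i = 2 then (q : ℤ) else 0
  mem := fun i => (X ++ Y).getD i 0

/-- The sequence `Z` is the output in the configuration `s`: register `0` holds its length, and
the memory starts with its elements. -/
def IsOutput (s : WordRAM.Config) (Z : List ℤ) : Prop :=
  s.reg 0 = (Z.length : ℤ) ∧ ∀ i (hi : i < Z.length), s.mem i = Z[i]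

/-! Let `r` be the least positive integer with `n * q ≤ r * r * p`. As `p / q` is `ε` up to a factor
of two and `ε ≤ n`, `r` is of order `√(n / ε)`, and `n / r ≤ r * ε`. Call a value light if it occurs
at most `r` times in `Y`, and heavy otherwise. Heavy values occupy disjoint blocks of more than `r`
entries in the sorted `Y`, so there are at most `n / r` of them (`length_mul_le_of_not_light`).

Two dynamic programs with about `n * r` steps of polylogarithmic cost suffice. Phase A (`wp_phaseA`)
treats lengths `t ≤ r`: for each element of `X` and each `t` it finds the chain of length `t - 1`
with smaller values that uses the shortest prefix of `Y`, and extends it by the earliest later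
occurrence of the element in `Y`. Phase B (`wp_phaseB`) goes through at most `r` occurrences in `Y`
of each element of `X` and extends the longest chain that precedes the pair in value and in
position. Its result is at least as long as every common increasing subsequence of light values; the
heavy values it meets can only help.

Let `L` be the optimum and `m` the length of the output. If `L ≤ r`, phase A attains it. Otherwise
the first `r` elements of an optimum give `m ≥ r`; the optimum has distinct elements, so removing
the heavy ones costs at most `n / r`. Hence `L ≤ m + n / r ≤ m + r * ε ≤ (1 + ε) * m`
(`lcis_le_of_light`, `lcis_le_of_mul_le`).

Sorting the keys `y j * n + j` puts the occurrences of a value into one block, in order of position.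
Binary search then finds the first occurrence from a given position on, and the start of the block
serves as the rank of the value, hence as its leaf in the search trees. A tree entry packs a
criterion and a node number into one integer, `criterion * (2 * n * r + 1) + node`. There are at
most `2 * n * r` nodes, so division recovers both parts, and the maximum of entries maximizes the
criterion. Nodes store a value and a predecessor, from which the output is read off.

For the machine model, the algorithm is written in a small language whose big-step semantics counts
instructions; `Exec.code_goes` shows that compiled code takes exactly that many steps. Overflow is
excluded by sizes: a number of size `k` is at most `M ^ k` with `M = 2 ^ b`. Most assignments pass a
static check of sizes, the others (such as counters) need a bound on the actual value. -/

namespace WordRAM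

/-! ### A structured language on top of the word RAM

Programs of the structured language have integer variables and integer arrays. They are compiled to
word RAM programs. Array `0` is the beginning of the memory, the arrays `1, …, 7` are interleaved
behind it. -/

/-- Arithmetic expressions. -/
inductive Expr where
  | const (z : ℤ)
  | var (x : ℕ)
  | add (e f : Expr)
  | sub (e f : Expr)
  | mul (e f : Expr)
  | div (e f : Expr)
  | arr (a : ℕ) (e : Expr)

/-- Commands; the guards of conditionals and loops are strict inequalities `e < f`. -/
inductive Cmd where
  | assign (x : ℕ) (e : Expr)
  | store (a : ℕ) (i e : Expr)
  | seq (c d : Cmd)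
  | ite (e f : Expr) (c d : Cmd)
  | loop (e f : Expr) (c : Cmd)
  | skip

prefix:max "♯" => Expr.var
prefix:max "♭" => Expr.const
infixl:65 " +. " => Expr.add
infixl:65 " -. " => Expr.sub
infixl:70 " *. " => Expr.mul
infixl:70 " /. " => Expr.div
infix:50 " ≔ " => Cmd.assign
infixr:40 " ;; " => Cmd.seq

/-- States: variables, arrays, and the number of steps made so far. -/
structure St where
  v : ℕ → ℤ
  a : ℕ → ℤ → ℤ
  time : ℕ

namespace St

/-- Let `k` steps pass. -/
def tick (s : St) (k : ℕ) : St := ⟨s.v, s.a, s.time + k⟩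

/-- Assign `z` to the variable `x` within `k` steps. -/
def set (s : St) (x : ℕ) (z : ℤ) (k : ℕ) : St := ⟨Function.update s.v x z, s.a, s.time + k⟩

/-- Assign `z` to entry `i` of array `a` within `k` steps. -/
def put (s : St) (a : ℕ) (i z : ℤ) (k : ℕ) : St :=
  ⟨s.v, Function.update s.a a (Function.update (s.a a) i z), s.time + k⟩

@[simp] theorem tick_v (s : St) (k : ℕ) : (s.tick k).v = s.v := rfl
@[simp] theorem tick_a (s : St) (k : ℕ) : (s.tick k).a = s.a := rfl
@[simp] theorem tick_time (s : St) (k : ℕ) : (s.tick k).time = s.time + k := rfl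
@[simp] theorem set_v (s : St) (x : ℕ) (z : ℤ) (k y : ℕ) :
    (s.set x z k).v y = if y = x then z else s.v y := by
  simp [set, Function.update_apply]
@[simp] theorem set_a (s : St) (x : ℕ) (z : ℤ) (k : ℕ) : (s.set x z k).a = s.a := rfl
@[simp] theorem set_time (s : St) (x : ℕ) (z : ℤ) (k : ℕ) : (s.set x z k).time = s.time + k := rfl
@[simp] theorem put_v (s : St) (a : ℕ) (i z : ℤ) (k : ℕ) : (s.put a i z k).v = s.v := rfl
@[simp] theorem put_a (s : St) (a : ℕ) (i z : ℤ) (k a' : ℕ) (i' : ℤ) :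
    (s.put a i z k).a a' i' = if a' = a then (if i' = i then z else s.a a i') else s.a a' i' := by
  by_cases h : a' = a
  · subst h; simp [put, Function.update_apply]
  · simp [put, h]
theorem put_a_ne (s : St) (a : ℕ) (i z : ℤ) (k : ℕ) {a' : ℕ} (h : a' ≠ a) :
    (s.put a i z k).a a' = s.a a' := by
  simp [put, Function.update_of_ne h]
@[simp] theorem put_time (s : St) (a : ℕ) (i z : ℤ) (k : ℕ) :
    (s.put a i z k).time = s.time + k := rfl

end St

/-! ### Values, costs and static size bounds of expressions -/

namespace Expr

/-- The value of an expression. -/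
def eval (s : St) : Expr → ℤ
  | const z => z
  | var x => s.v x
  | add e f => e.eval s + f.eval s
  | sub e f => e.eval s - f.eval s
  | mul e f => e.eval s * f.eval s
  | div e f => e.eval s / f.eval s
  | arr a e => s.a a (e.eval s)

/-- All array accesses are to admissible indices; `B` is the length of array `0`. -/
def ok (B : ℤ) (s : St) : Expr → Prop
  | const _ => True
  | var _ => True
  | add e f => e.ok B s ∧ f.ok B s
  | sub e f => e.ok B s ∧ f.ok B s
  | mul e f => e.ok B s ∧ f.ok B s
  | div e f => e.ok B s ∧ f.ok B s
  | arr a e => e.ok B s ∧ 0 ≤ e.eval s ∧ (a = 0 → e.eval s < B)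

/-- The number of instructions that evaluate an expression. -/
def cost : Expr → ℕ
  | const _ => 1
  | var _ => 1
  | add e f => e.cost + f.cost + 1
  | sub e f => e.cost + f.cost + 1
  | mul e f => e.cost + f.cost + 1
  | div e f => e.cost + f.cost + 1
  | arr a e => e.cost + (if a = 0 then 0 else 4) + 1

/-- The size of the value of an expression if variable `x` has size `σ x` and array `a` has entries
of size `τ a`; a number has size `k` if its absolute value is at most `M ^ k`. -/
def bnd (σ τ : ℕ → ℕ) : Expr → ℕ
  | const z => z.natAbs
  | var x => σ x
  | add e f => max (e.bnd σ τ) (f.bnd σ τ) + 1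
  | sub e f => max (e.bnd σ τ) (f.bnd σ τ) + 1
  | mul e f => e.bnd σ τ + f.bnd σ τ
  | div e _ => e.bnd σ τ
  | arr a _ => τ a

/-- Variables and arrays have admissible numbers, and all values occurring in the evaluation have
size at most `m`. -/
def wf (σ τ : ℕ → ℕ) (m : ℕ) : Expr → Bool
  | const z => z.natAbs ≤ m
  | var x => x < 100 && σ x ≤ m
  | add e f => e.wf σ τ m && f.wf σ τ m && max (e.bnd σ τ) (f.bnd σ τ) + 1 ≤ m
  | sub e f => e.wf σ τ m && f.wf σ τ m && max (e.bnd σ τ) (f.bnd σ τ) + 1 ≤ m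
  | mul e f => e.wf σ τ m && f.wf σ τ m && e.bnd σ τ + f.bnd σ τ ≤ m
  | div e f => e.wf σ τ m && f.wf σ τ m
  | arr a e => e.wf σ τ m && a < 8 && τ a ≤ m && e.bnd σ τ + 6 ≤ m

end Expr

/-- Replace the index in register `d` by the address of this entry of array `a`. -/
def addrCode (a d : ℕ) : List Instr :=
  if a = 0 then []
  else [.mul d d 103, .add d d 100, .const (d + 1) a, .add d d (d + 1)]

/-- Code that evaluates an expression into register `d`, using only higher registers. -/
def Expr.code : Expr → ℕ → List Instr
  | .const z, d => [.const d z]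
  | .var x, d => [.move d x]
  | .add e f, d => e.code d ++ f.code (d + 1) ++ [.add d d (d + 1)]
  | .sub e f, d => e.code d ++ f.code (d + 1) ++ [.sub d d (d + 1)]
  | .mul e f, d => e.code d ++ f.code (d + 1) ++ [.mul d d (d + 1)]
  | .div e f, d => e.code d ++ f.code (d + 1) ++ [.div d d (d + 1)]
  | .arr a e, d => e.code d ++ addrCode a d ++ [.load d d]

namespace Cmd

/-- The length of the code of a command. -/
def size : Cmd → ℕ
  | assign _ e => e.cost + 1
  | store a i e => i.cost + (if a = 0 then 0 else 4) + e.cost + 1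
  | seq c d => c.size + d.size
  | ite e f c d => e.cost + f.cost + 1 + d.size + 1 + c.size
  | loop e f c => e.cost + f.cost + 2 + c.size + 1
  | skip => 0

/-- Compilation; the argument is the position of the code within the program. -/
def code : Cmd → ℕ → List Instr
  | assign x e, _ => e.code 104 ++ [.move x 104]
  | store a i e, _ => i.code 104 ++ addrCode a 104 ++ e.code 105 ++ [.store 104 105]
  | seq c d, l => c.code l ++ d.code (l + c.size)
  | ite e f c d, l =>
      e.code 104 ++ f.code 105 ++
      [.jumpLt 104 105 (l + e.cost + f.cost + 1 + d.size + 1)] ++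
      d.code (l + e.cost + f.cost + 1) ++
      [.jumpLt 101 102 (l + e.cost + f.cost + 1 + d.size + 1 + c.size)] ++
      c.code (l + e.cost + f.cost + 1 + d.size + 1)
  | loop e f c, l =>
      e.code 104 ++ f.code 105 ++
      [.jumpLt 104 105 (l + e.cost + f.cost + 2)] ++
      [.jumpLt 101 102 (l + e.cost + f.cost + 2 + c.size + 1)] ++
      c.code (l + e.cost + f.cost + 2) ++
      [.jumpLt 101 102 l]
  | skip, _ => []

/-- All expressions of a command are well formed. -/
def wf (σ τ : ℕ → ℕ) (m : ℕ) : Cmd → Bool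
  | assign x e => x < 100 && e.wf σ τ m && σ x ≤ m
  | store a i e => a < 8 && i.wf σ τ m && e.wf σ τ m && i.bnd σ τ + 6 ≤ m
  | seq c d => c.wf σ τ m && d.wf σ τ m
  | ite e f c d => e.wf σ τ m && f.wf σ τ m && c.wf σ τ m && d.wf σ τ m
  | loop e f c => e.wf σ τ m && f.wf σ τ m && c.wf σ τ m
  | skip => true

end Cmd

/-! ### Big-step semantics with a clock, and total-correctness rules -/

section Semantics

variable (σ τ : ℕ → ℕ) (M B : ℤ)

/-- Big-step semantics. An assigned value has to have the size of the variable or array it is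
assigned to, unless this is clear from the sizes of the variables in the expression. -/
inductive Exec : Cmd → St → St → Prop
  | assign {x : ℕ} {e : Expr} {s : St} (ho : e.ok B s)
      (hb : e.bnd σ τ ≤ σ x ∨ |e.eval s| ≤ M ^ σ x) :
      Exec (.assign x e) s (s.set x (e.eval s) (e.cost + 1))
  | store {a : ℕ} {i e : Expr} {s : St} (hi : i.ok B s) (he : e.ok B s) (h0 : 0 ≤ i.eval s)
      (hB : a = 0 → i.eval s < B) (hb : e.bnd σ τ ≤ τ a ∨ |e.eval s| ≤ M ^ τ a) :
      Exec (.store a i e) s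
        (s.put a (i.eval s) (e.eval s) (i.cost + (if a = 0 then 0 else 4) + e.cost + 1))
  | seq {c d : Cmd} {s s₁ s₂ : St} (h₁ : Exec c s s₁) (h₂ : Exec d s₁ s₂) :
      Exec (.seq c d) s s₂
  | iteTrue {e f : Expr} {c d : Cmd} {s s' : St} (he : e.ok B s) (hf : f.ok B s)
      (hlt : e.eval s < f.eval s) (h : Exec c (s.tick (e.cost + f.cost + 1)) s') :
      Exec (.ite e f c d) s s'
  | iteFalse {e f : Expr} {c d : Cmd} {s s' : St} (he : e.ok B s) (hf : f.ok B s)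
      (hlt : ¬ e.eval s < f.eval s) (h : Exec d (s.tick (e.cost + f.cost + 2)) s') :
      Exec (.ite e f c d) s s'
  | loopTrue {e f : Expr} {c : Cmd} {s s₁ s' : St} (he : e.ok B s) (hf : f.ok B s)
      (hlt : e.eval s < f.eval s) (h : Exec c (s.tick (e.cost + f.cost + 2)) s₁)
      (h' : Exec (.loop e f c) s₁ s') :
      Exec (.loop e f c) s s'
  | loopFalse {e f : Expr} {c : Cmd} {s : St} (he : e.ok B s) (hf : f.ok B s)
      (hlt : ¬ e.eval s < f.eval s) :
      Exec (.loop e f c) s (s.tick (e.cost + f.cost + 2))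
  | skip {s : St} : Exec .skip s s

/-- The command terminates in a state with property `Q`. -/
def wp (c : Cmd) (Q : St → Prop) (s : St) : Prop := ∃ s', Exec σ τ M B c s s' ∧ Q s'

variable {σ τ M B}

theorem wp_seq {c d : Cmd} {Q : St → Prop} {s : St} :
    wp σ τ M B (c ;; d) Q s ↔ wp σ τ M B c (wp σ τ M B d Q) s := by
  constructor
  · rintro ⟨s', h, hQ⟩
    cases h with
    | seq h₁ h₂ => exact ⟨_, h₁, _, h₂, hQ⟩
  · rintro ⟨s₁, h₁, s₂, h₂, hQ⟩
    exact ⟨s₂, .seq h₁ h₂, hQ⟩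

theorem wp_skip {Q : St → Prop} {s : St} : wp σ τ M B .skip Q s ↔ Q s := by
  constructor
  · rintro ⟨s', h, hQ⟩
    cases h; exact hQ
  · exact fun h => ⟨s, .skip, h⟩

theorem wp_assign {x : ℕ} {e : Expr} {Q : St → Prop} {s : St} :
    wp σ τ M B (x ≔ e) Q s ↔
      e.ok B s ∧ (e.bnd σ τ ≤ σ x ∨ |e.eval s| ≤ M ^ σ x) ∧
        Q (s.set x (e.eval s) (e.cost + 1)) := by
  constructor
  · rintro ⟨s', h, hQ⟩
    cases h with
    | assign ho hb => exact ⟨ho, hb, hQ⟩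
  · exact fun ⟨ho, hb, hQ⟩ => ⟨_, .assign ho hb, hQ⟩

theorem wp_store {a : ℕ} {i e : Expr} {Q : St → Prop} {s : St} :
    wp σ τ M B (.store a i e) Q s ↔
      i.ok B s ∧ e.ok B s ∧ 0 ≤ i.eval s ∧ (a = 0 → i.eval s < B) ∧
        (e.bnd σ τ ≤ τ a ∨ |e.eval s| ≤ M ^ τ a) ∧
        Q (s.put a (i.eval s) (e.eval s) (i.cost + (if a = 0 then 0 else 4) + e.cost + 1)) := by
  constructor
  · rintro ⟨s', h, hQ⟩
    cases h with
    | store hi he h0 hB hb => exact ⟨hi, he, h0, hB, hb, hQ⟩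
  · exact fun ⟨hi, he, h0, hB, hb, hQ⟩ => ⟨_, .store hi he h0 hB hb, hQ⟩

theorem wp_ite {e f : Expr} {c d : Cmd} {Q : St → Prop} {s : St} :
    wp σ τ M B (.ite e f c d) Q s ↔
      e.ok B s ∧ f.ok B s ∧
        (e.eval s < f.eval s → wp σ τ M B c Q (s.tick (e.cost + f.cost + 1))) ∧
        (f.eval s ≤ e.eval s → wp σ τ M B d Q (s.tick (e.cost + f.cost + 2))) := by
  constructor
  · rintro ⟨s', h, hQ⟩
    cases h with
    | iteTrue he hf hlt h => exact ⟨he, hf, fun _ => ⟨s', h, hQ⟩, fun h' => absurd hlt h'.not_gt⟩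
    | iteFalse he hf hlt h => exact ⟨he, hf, fun h' => absurd h' hlt, fun _ => ⟨s', h, hQ⟩⟩
  · rintro ⟨he, hf, h₁, h₂⟩
    by_cases hlt : e.eval s < f.eval s
    · obtain ⟨s', h, hQ⟩ := h₁ hlt
      exact ⟨s', .iteTrue he hf hlt h, hQ⟩
    · obtain ⟨s', h, hQ⟩ := h₂ (not_lt.1 hlt)
      exact ⟨s', .iteFalse he hf hlt h, hQ⟩

/-- The rule for loops: `I k` is an invariant that holds when at most `k` iterations are left. -/
theorem wp_loop {e f : Expr} {c : Cmd} {Q : St → Prop} (I : ℕ → St → Prop)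
    (h : ∀ k s, I k s → e.ok B s ∧ f.ok B s ∧
      (e.eval s < f.eval s →
        ∃ k', k = k' + 1 ∧ wp σ τ M B c (I k') (s.tick (e.cost + f.cost + 2))) ∧
      (f.eval s ≤ e.eval s → Q (s.tick (e.cost + f.cost + 2))))
    (k : ℕ) {s : St} (hI : I k s) : wp σ τ M B (.loop e f c) Q s := by
  induction k generalizing s with
  | zero =>
    obtain ⟨he, hf, h₁, h₂⟩ := h 0 s hI
    by_cases hlt : e.eval s < f.eval s
    · obtain ⟨k', hk, -⟩ := h₁ hlt
      omega
    · exact ⟨_, .loopFalse he hf hlt, h₂ (not_lt.1 hlt)⟩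
  | succ k ih =>
    obtain ⟨he, hf, h₁, h₂⟩ := h _ s hI
    by_cases hlt : e.eval s < f.eval s
    · obtain ⟨k', hk, s₁, hs₁, hI₁⟩ := h₁ hlt
      obtain rfl : k = k' := by omega
      obtain ⟨s', hs', hQ⟩ := ih hI₁
      exact ⟨s', .loopTrue he hf hlt hs₁ hs', hQ⟩
    · exact ⟨_, .loopFalse he hf hlt, h₂ (not_lt.1 hlt)⟩

/-- All variables and array entries have their sizes. -/
structure WellTyped (σ τ : ℕ → ℕ) (M : ℤ) (s : St) : Prop where
  var : ∀ x, |s.v x| ≤ M ^ σ x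
  arr : ∀ a i, |s.a a i| ≤ M ^ τ a

/-- A sum of two numbers of size `k` has size `k + 1` because `2 ≤ M`; sizes add under products, and
quotients do not grow. A constant `z` has size `|z|` because `|z| ≤ 2 ^ |z|`. -/
theorem Expr.abs_eval_le {s : St} (hM : 2 ≤ M) (hs : WellTyped σ τ M s) (e : Expr) :
    |e.eval s| ≤ M ^ e.bnd σ τ := by
  have h1 : 1 ≤ M := by omega
  have hadd : ∀ (x y : ℤ) (k l : ℕ), |x| ≤ M ^ k → |y| ≤ M ^ l →
      |x| + |y| ≤ M ^ (max k l + 1) := by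
    intro x y k l hx hy
    have hk : M ^ k ≤ M ^ max k l := pow_le_pow_right₀ h1 (le_max_left _ _)
    have hl : M ^ l ≤ M ^ max k l := pow_le_pow_right₀ h1 (le_max_right _ _)
    have h0 : 0 < M ^ max k l := by positivity
    rw [pow_succ]
    nlinarith
  induction e with
  | const z =>
    calc |z| = (z.natAbs : ℤ) := Int.abs_eq_natAbs z
      _ ≤ ((2 ^ z.natAbs : ℕ) : ℤ) := by exact_mod_cast Nat.lt_two_pow_self.le
      _ ≤ M ^ z.natAbs := by push_cast; exact pow_le_pow_left₀ (by norm_num) hM _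
  | var x => exact hs.var x
  | add e f ihe ihf => exact (abs_add_le _ _).trans (hadd _ _ _ _ ihe ihf)
  | sub e f ihe ihf => exact (abs_sub _ _).trans (hadd _ _ _ _ ihe ihf)
  | mul e f ihe ihf =>
    simp only [eval, bnd, abs_mul, pow_add]
    exact mul_le_mul ihe ihf (abs_nonneg _) (by positivity)
  | div e f ihe ihf => exact (Int.abs_ediv_le_abs _ _).trans ihe
  | arr a e ih => exact hs.arr _ _

/-- Every write carries one of two certificates: the static size of the expression is small enough,
so that `Expr.abs_eval_le` applies, or the actual value is bounded. -/
theorem Exec.wellTyped (hM : 2 ≤ M) {c : Cmd} {s s' : St} (h : Exec σ τ M B c s s')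
    (hs : WellTyped σ τ M s) : WellTyped σ τ M s' := by
  have htick : ∀ {s : St} {k : ℕ}, WellTyped σ τ M s → WellTyped σ τ M (s.tick k) :=
    fun hs => ⟨hs.var, hs.arr⟩
  induction h with
  | @assign x e s ho hb =>
    refine ⟨fun y => ?_, hs.arr⟩
    rw [St.set_v]
    split_ifs with hy
    · subst hy
      exact hb.elim (fun h => (e.abs_eval_le hM hs).trans (pow_le_pow_right₀ (by omega) h)) id
    · exact hs.var y
  | @store a i e s hi he h0 hB hb =>
    refine ⟨hs.var, fun a' i' => ?_⟩
    rw [St.put_a]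
    split_ifs with ha hi
    · subst ha
      exact hb.elim (fun h => (e.abs_eval_le hM hs).trans (pow_le_pow_right₀ (by omega) h)) id
    · subst ha; exact hs.arr _ _
    · exact hs.arr _ _
  | seq _ _ ih₁ ih₂ => exact ih₂ (ih₁ hs)
  | iteTrue _ _ _ _ ih => exact ih (htick hs)
  | iteFalse _ _ _ _ ih => exact ih (htick hs)
  | loopTrue _ _ _ _ _ ih₁ ih₂ => exact ih₂ (ih₁ (htick hs))
  | loopFalse _ _ _ => exact htick hs
  | skip => exact hs

end Semantics

/-! ### Correctness of the compilation -/

theorem addrCode_length (a d : ℕ) : (addrCode a d).length = if a = 0 then 0 else 4 := by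
  unfold addrCode; split_ifs <;> rfl

theorem Expr.code_length (e : Expr) (d : ℕ) : (e.code d).length = e.cost := by
  induction e generalizing d with
  | const z => rfl
  | var x => rfl
  | arr a e ih => simp [code, cost, ih, addrCode_length]; omega
  | _ e f ihe ihf => simp [code, cost, ihe, ihf]; omega

theorem Cmd.code_length (c : Cmd) (l : ℕ) : (c.code l).length = c.size := by
  induction c generalizing l with
  | assign x e => simp [code, size, Expr.code_length]
  | store a i e => simp [code, size, Expr.code_length, addrCode_length]; omega
  | seq c d ihc ihd => simp [code, size, ihc, ihd]
  | ite e f c d ihc ihd => simp [code, size, Expr.code_length, ihc, ihd]; omega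
  | loop e f c ih => simp [code, size, Expr.code_length, ih]; omega
  | skip => rfl

/-- The list `L` stands at position `l` of the program. -/
def CodeAt (P : Program) (l : ℕ) (L : List Instr) : Prop := ∀ k, k < L.length → P[l + k]? = L[k]?

theorem codeAt_append {P : Program} {l : ℕ} {L L' : List Instr} :
    CodeAt P l (L ++ L') ↔ CodeAt P l L ∧ CodeAt P (l + L.length) L' := by
  constructor
  · refine fun h => ⟨fun k hk => ?_, fun k hk => ?_⟩
    · rw [h k (by simp; omega), List.getElem?_append_left hk]
    · have := h (L.length + k) (by simp; omega)
      rw [List.getElem?_append_right (by omega)] at this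
      rw [add_assoc, this]
      congr 1; omega
  · rintro ⟨h₁, h₂⟩ k hk
    rcases lt_or_ge k L.length with h | h
    · rw [h₁ k h, List.getElem?_append_left h]
    · have := h₂ (k - L.length) (by simp at hk; omega)
      rw [List.getElem?_append_right h, ← this]
      congr 1; omega

theorem CodeAt.get {P : Program} {l : ℕ} {i : Instr} {L : List Instr} (h : CodeAt P l (i :: L)) :
    P[l]? = some i := by
  simpa using h 0 (by simp)

theorem codeAt_cons {P : Program} {l : ℕ} {i : Instr} {L : List Instr} :
    CodeAt P l (i :: L) ↔ P[l]? = some i ∧ CodeAt P (l + 1) L := by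
  constructor
  · refine fun h => ⟨h.get, fun k hk => ?_⟩
    have := h (k + 1) (by simpa using hk)
    rw [add_assoc, add_comm 1 k, this]; rfl
  · rintro ⟨h₁, h₂⟩ (_ | k) hk
    · simpa using h₁
    · have := h₂ k (by simpa using hk)
      rw [add_assoc, add_comm 1 k] at this
      rw [this]; rfl

theorem run_trans {w : ℕ} {P : Program} {t t' : ℕ} {s s₁ s₂ : Config}
    (h : run w P t s = some s₁) (h' : run w P t' s₁ = some s₂) :
    run w P (t + t') s = some s₂ := by
  induction t generalizing s with
  | zero =>
    obtain rfl : s = s₁ := by simpa [run] using h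
    simpa using h'
  | succ t ih =>
    rw [show t + 1 + t' = (t + t') + 1 by omega, run]
    rw [run, Option.bind_eq_some_iff] at h
    obtain ⟨s₃, h₃, h₄⟩ := h
    rw [h₃]
    exact ih h₄

theorem run_one {w : ℕ} {P : Program} {s s₁ : Config} (h : step w P s = some s₁) :
    run w P 1 s = some s₁ := by
  simp [run, h]

/-- The machine goes from `s` to a configuration with property `Q` within exactly `t` steps. -/
def Goes (w : ℕ) (P : Program) (t : ℕ) (s : Config) (Q : Config → Prop) : Prop :=
  ∃ s', run w P t s = some s' ∧ Q s'

theorem Goes.bind {w : ℕ} {P : Program} {t t' : ℕ} {s : Config} {Q R : Config → Prop}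
    (h : Goes w P t s Q) (h' : ∀ s', Q s' → Goes w P t' s' R) : Goes w P (t + t') s R := by
  obtain ⟨s₁, h₁, hQ⟩ := h
  obtain ⟨s₂, h₂, hR⟩ := h' s₁ hQ
  exact ⟨s₂, run_trans h₁ h₂, hR⟩

theorem Goes.of_step {w : ℕ} {P : Program} {s s' : Config} {Q : Config → Prop}
    (h : step w P s = some s') (hQ : Q s') : Goes w P 1 s Q :=
  ⟨s', run_one h, hQ⟩

theorem step_assign {w : ℕ} {s : Config} {d : ℕ} {z : ℤ} (hz : |z| < 2 ^ w) :
    s.assign w d z = some ⟨s.pc + 1, Function.update s.reg d z, s.mem⟩ := by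
  simp [Config.assign, hz]

/-- The memory address of entry `i` of array `a`. -/
def addr (B a i : ℕ) : ℕ := if a = 0 then i else B + 8 * i + a

/-- The machine configuration `m` represents the state `s`. -/
structure Repr (B : ℕ) (s : St) (m : Config) : Prop where
  var : ∀ x, x < 100 → m.reg x = s.v x
  base : m.reg 100 = B
  zero : m.reg 101 = 0
  one : m.reg 102 = 1
  eight : m.reg 103 = 8
  mem : ∀ a i : ℕ, a < 8 → (a = 0 → i < B) → m.mem (addr B a i) = s.a a i

/-- Registers from `104` on are scratch space for the evaluation of expressions and do not belong to
the represented state. -/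
theorem Repr.of_eq {B : ℕ} {s : St} {m m' : Config} (h : Repr B s m)
    (hr : ∀ r, r < 104 → m'.reg r = m.reg r) (hm : m'.mem = m.mem) : Repr B s m' where
  var x hx := (hr x (by omega)).trans (h.var x hx)
  base := (hr 100 (by omega)).trans h.base
  zero := (hr 101 (by omega)).trans h.zero
  one := (hr 102 (by omega)).trans h.one
  eight := (hr 103 (by omega)).trans h.eight
  mem a i ha hi := by rw [hm]; exact h.mem a i ha hi

/-- Addresses of the arrays `1, …, 7` lie beyond `B`, and their offset from `B` has residue `a`
modulo `8`, which determines the array and then the index. -/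
theorem addr_inj {B a i a' i' : ℕ} (ha : a < 8) (hi : a = 0 → i < B) (ha' : a' < 8)
    (hi' : a' = 0 → i' < B) (h : addr B a i = addr B a' i') : a = a' ∧ i = i' := by
  unfold addr at h
  split_ifs at h <;> omega

end WordRAM

namespace WordRAM

section Compile

variable {σ τ : ℕ → ℕ} {M : ℤ} {B m w : ℕ} {P : Program}

/-- The largest intermediate value is `8 * i + B + a`, a sum of three terms of at most `M ^ (k +
3)`, hence at most `M ^ (k + 5)`. This is why an index of size `k` requires `k + 6 ≤ m`, with one
exponent to spare. -/
theorem addrCode_goes (hM : 2 ≤ M) (hB : (B : ℤ) ≤ M ^ 2) (hw : ∀ z : ℤ, |z| ≤ M ^ m → |z| < 2 ^ w)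
    {s : St} {c : Config} (hR : Repr B s c) {a d k : ℕ} {i : ℤ} (hd : 104 ≤ d) (ha : a < 8)
    (hi : c.reg d = i) (h0 : 0 ≤ i) (hk : |i| ≤ M ^ k) (hkm : k + 6 ≤ m)
    (hP : CodeAt P c.pc (addrCode a d)) :
    Goes w P (if a = 0 then 0 else 4) c fun c' =>
      c'.pc = c.pc + (if a = 0 then 0 else 4) ∧ c'.mem = c.mem ∧
      (∀ r, r < d → c'.reg r = c.reg r) ∧ c'.reg d = addr B a i.toNat := by
  unfold addrCode at hP
  unfold addr
  split_ifs at hP ⊢ with h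
  · exact ⟨c, rfl, rfl, rfl, fun _ _ => rfl, by simp [hi, h0]⟩
  · simp only [codeAt_cons] at hP
    obtain ⟨p1, p2, p3, p4, -⟩ := hP
    have h1 : 1 ≤ M := by omega
    have hbig : ∀ z : ℤ, |z| ≤ M ^ (k + 5) → |z| < 2 ^ w := fun z hz =>
      hw z (hz.trans (pow_le_pow_right₀ h1 (by omega)))
    have e1 : (1 : ℤ) ≤ M ^ k := one_le_pow₀ h1
    have e2 : (4 : ℤ) ≤ M ^ 2 := by nlinarith
    have e3 : (8 : ℤ) ≤ M ^ 3 := by nlinarith [pow_succ M 2]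
    have e5 : M ^ (k + 5) = M ^ k * M ^ 3 * M ^ 2 := by ring
    have e4 : M ^ 2 ≤ M ^ 3 := pow_le_pow_right₀ h1 (by omega)
    have hki : i ≤ M ^ k := (le_abs_self i).trans hk
    have f1 : i * 8 ≤ M ^ k * M ^ 3 := by nlinarith
    have f2 : M ^ 3 ≤ M ^ k * M ^ 3 := by nlinarith
    have f3 : 4 * (M ^ k * M ^ 3) ≤ M ^ (k + 5) := by rw [e5]; nlinarith
    have ha' : (a : ℤ) ≤ 7 := by exact_mod_cast Nat.le_of_lt_succ ha
    have b1 : |i * 8| < 2 ^ w := hbig _ (by rw [abs_of_nonneg (by omega)]; omega)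
    have b2 : |i * 8 + B| < 2 ^ w := hbig _ (by rw [abs_of_nonneg (by omega)]; omega)
    have b3 : |(a : ℤ)| < 2 ^ w := hbig _ (by rw [abs_of_nonneg (by omega)]; omega)
    have b4 : |i * 8 + B + a| < 2 ^ w := hbig _ (by rw [abs_of_nonneg (by omega)]; omega)
    have s1 : step w P c = some ⟨c.pc + 1, Function.update c.reg d (i * 8), c.mem⟩ := by
      simp only [step, p1, hi, hR.eight]; exact step_assign b1
    refine Goes.bind (t := 1) (t' := 3) (.of_step s1 rfl) ?_
    rintro _ rfl
    have s2 : step w P ⟨c.pc + 1, Function.update c.reg d (i * 8), c.mem⟩ =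
        some ⟨c.pc + 2, Function.update c.reg d (i * 8 + B), c.mem⟩ := by
      have hne : (100 : ℕ) ≠ d := by omega
      simp [step, p2, hR.base, Function.update_of_ne hne, step_assign b2]
    refine Goes.bind (t := 1) (t' := 2) (.of_step s2 rfl) ?_
    rintro _ rfl
    have s3 : step w P ⟨c.pc + 2, Function.update c.reg d (i * 8 + B), c.mem⟩ =
        some ⟨c.pc + 3, Function.update (Function.update c.reg d (i * 8 + B)) (d + 1) a, c.mem⟩ := by
      simp [step, p3, step_assign b3]
    refine Goes.bind (t := 1) (t' := 1) (.of_step s3 rfl) ?_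
    rintro _ rfl
    have s4 : step w P ⟨c.pc + 3, Function.update (Function.update c.reg d (i * 8 + B)) (d + 1) a,
          c.mem⟩ =
        some ⟨c.pc + 4, Function.update (Function.update (Function.update c.reg d (i * 8 + B))
          (d + 1) a) d (i * 8 + B + a), c.mem⟩ := by
      simp [step, p4, step_assign b4]
    refine .of_step s4 ⟨rfl, rfl, fun r hr => ?_, ?_⟩
    · simp [show r ≠ d by omega, show r ≠ d + 1 by omega]
    · simp; omega

/-- Registers act as an evaluation stack: code with target `d` leaves all registers below `d` alone,
so the first operand survives in `d` while the second one is computed in `d + 1`. -/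
theorem Expr.code_goes (hM : 2 ≤ M) (hB : (B : ℤ) ≤ M ^ 2)
    (hw : ∀ z : ℤ, |z| ≤ M ^ m → |z| < 2 ^ w) {s : St} (hs : WellTyped σ τ M s) (e : Expr)
    {c : Config} (hR : Repr B s c) {d : ℕ} (hd : 104 ≤ d) (he : e.wf σ τ m) (ho : e.ok B s)
    (hP : CodeAt P c.pc (e.code d)) :
    Goes w P e.cost c fun c' =>
      c'.pc = c.pc + e.cost ∧ c'.mem = c.mem ∧ (∀ r, r < d → c'.reg r = c.reg r) ∧
      c'.reg d = e.eval s := by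
  have h1 : 1 ≤ M := by omega
  have hfit : ∀ e : Expr, e.bnd σ τ ≤ m → |e.eval s| < 2 ^ w := fun e hem =>
    hw _ ((e.abs_eval_le hM hs).trans (pow_le_pow_right₀ h1 hem))
  -- The four binary operations differ only in the last instruction, so its effect is taken as a
  -- hypothesis and the evaluation of the operands is treated once.
  have hbin : ∀ (e f g : Expr) (i : Instr) (c : Config) (d : ℕ), 104 ≤ d → Repr B s c →
      (∀ {c : Config}, Repr B s c → ∀ {d : ℕ}, 104 ≤ d → CodeAt P c.pc (e.code d) →
        Goes w P e.cost c fun c' => c'.pc = c.pc + e.cost ∧ c'.mem = c.mem ∧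
          (∀ r, r < d → c'.reg r = c.reg r) ∧ c'.reg d = e.eval s) →
      (∀ {c : Config}, Repr B s c → ∀ {d : ℕ}, 104 ≤ d → CodeAt P c.pc (f.code d) →
        Goes w P f.cost c fun c' => c'.pc = c.pc + f.cost ∧ c'.mem = c.mem ∧
          (∀ r, r < d → c'.reg r = c.reg r) ∧ c'.reg d = f.eval s) →
      (∀ c' : Config, c'.reg d = e.eval s → c'.reg (d + 1) = f.eval s → P[c'.pc]? = some i →
        step w P c' = some ⟨c'.pc + 1, Function.update c'.reg d (g.eval s), c'.mem⟩) →
      CodeAt P c.pc (e.code d ++ f.code (d + 1) ++ [i]) →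
      Goes w P (e.cost + f.cost + 1) c fun c' =>
        c'.pc = c.pc + (e.cost + f.cost + 1) ∧ c'.mem = c.mem ∧
        (∀ r, r < d → c'.reg r = c.reg r) ∧ c'.reg d = g.eval s := by
    intro e f g i c d hd hR ihe ihf hstep hP
    rw [codeAt_append, codeAt_append, Expr.code_length, List.length_append, Expr.code_length,
      Expr.code_length] at hP
    obtain ⟨⟨p1, p2⟩, p3⟩ := hP
    refine ((ihe hR hd p1).bind ?_).bind (t' := 1)
      (Q := fun c' => c'.pc = c.pc + (e.cost + f.cost) ∧ c'.mem = c.mem ∧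
        (∀ r, r < d → c'.reg r = c.reg r) ∧ c'.reg d = e.eval s ∧ c'.reg (d + 1) = f.eval s) ?_
    · rintro c₁ ⟨q1, q2, q3, q4⟩
      have hR₁ : Repr B s c₁ := hR.of_eq (fun r hr => q3 r (by omega)) q2
      obtain ⟨c₂, hc₂, r1, r2, r3, r4⟩ := ihf hR₁ (d := d + 1) (by omega) (by rwa [q1])
      exact ⟨c₂, hc₂, by omega, r2.trans q2, fun r hr => (r3 r (by omega)).trans (q3 r hr),
        (r3 d (by omega)).trans q4, r4⟩
    · rintro c₁ ⟨q1, q2, q3, q4, q5⟩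
      refine .of_step (hstep c₁ q4 q5 (by rw [q1]; exact p3.get)) ⟨?_, q2, fun r hr => ?_, ?_⟩
      · simp; omega
      · simp [show r ≠ d by omega, q3 r hr]
      · simp
  induction e generalizing c d with
  | const z =>
    have p := hP.get
    have hz : |z| < 2 ^ w := hfit (.const z) (by simpa [wf, bnd] using he)
    refine .of_step (s' := ⟨c.pc + 1, Function.update c.reg d z, c.mem⟩) (by simp only [step, p]; exact step_assign hz) ⟨rfl, rfl, fun r hr => ?_, ?_⟩
    · simp [show r ≠ d by omega]
    · simp [eval]
  | var x =>
    have p := hP.get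
    simp only [wf, Bool.and_eq_true, decide_eq_true_eq] at he
    have hz : |s.v x| < 2 ^ w := hfit (.var x) he.2
    have hx := hR.var x he.1
    refine .of_step (s' := ⟨c.pc + 1, Function.update c.reg d (s.v x), c.mem⟩)
      (by simp only [step, p, hx]; exact step_assign hz)
      ⟨rfl, rfl, fun r hr => ?_, ?_⟩
    · simp [show r ≠ d by omega]
    · simp [eval]
  | arr a e ih =>
    simp only [wf, Bool.and_eq_true, decide_eq_true_eq] at he
    obtain ⟨⟨⟨he1, he2⟩, he3⟩, he4⟩ := he
    obtain ⟨ho1, ho2, ho3⟩ := ho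
    rw [code, codeAt_append, codeAt_append, Expr.code_length, List.length_append, Expr.code_length,
      addrCode_length] at hP
    obtain ⟨⟨p1, p2⟩, p3⟩ := hP
    refine ((ih hR hd he1 ho1 p1).bind ?_).bind (t' := 1)
      (Q := fun c' => c'.pc = c.pc + (e.cost + (if a = 0 then 0 else 4)) ∧ c'.mem = c.mem ∧
        (∀ r, r < d → c'.reg r = c.reg r) ∧ c'.reg d = addr B a (e.eval s).toNat) ?_
    · rintro c₁ ⟨q1, q2, q3, q4⟩
      have hR₁ : Repr B s c₁ := hR.of_eq (fun r hr => q3 r (by omega)) q2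
      obtain ⟨c₂, hc₂, r1, r2, r3, r4⟩ := addrCode_goes hM hB hw hR₁ hd he2 q4 ho2
        (e.abs_eval_le hM hs) he4 (by rwa [q1])
      exact ⟨c₂, hc₂, by omega, r2.trans q2, fun r hr => (r3 r (by omega)).trans (q3 r hr), r4⟩
    · rintro c₁ ⟨q1, q2, q3, q4⟩
      have p := p3.get
      rw [← q1] at p
      have hmem := hR.mem a (e.eval s).toNat he2 (fun h => by have := ho3 h; omega)
      rw [Int.toNat_of_nonneg ho2] at hmem
      have hz : |s.a a (e.eval s)| < 2 ^ w := hfit (.arr a e) he3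
      refine .of_step (s' := ⟨c₁.pc + 1, Function.update c₁.reg d (s.a a (e.eval s)), c₁.mem⟩)
        ?_ ⟨?_, q2, fun r hr => ?_, ?_⟩
      · simp only [step, p, q4]
        rw [if_pos (by omega), Int.toNat_natCast, q2, hmem, step_assign hz, q2]
      · simp [cost]; omega
      · simp [show r ≠ d by omega, q3 r hr]
      · simp [eval]
  | add e f ihe ihf =>
    simp only [wf, Bool.and_eq_true, decide_eq_true_eq] at he
    refine hbin e f (e +. f) _ c d hd hR (fun hR _ hd => ihe hR hd he.1.1 ho.1)
      (fun hR _ hd => ihf hR hd he.1.2 ho.2) (fun c' q1 q2 p => ?_) hP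
    simp only [step, p, q1, q2]; exact step_assign (hfit (e +. f) he.2)
  | sub e f ihe ihf =>
    simp only [wf, Bool.and_eq_true, decide_eq_true_eq] at he
    refine hbin e f (e -. f) _ c d hd hR (fun hR _ hd => ihe hR hd he.1.1 ho.1)
      (fun hR _ hd => ihf hR hd he.1.2 ho.2) (fun c' q1 q2 p => ?_) hP
    simp only [step, p, q1, q2]; exact step_assign (hfit (e -. f) he.2)
  | mul e f ihe ihf =>
    simp only [wf, Bool.and_eq_true, decide_eq_true_eq] at he
    refine hbin e f (e *. f) _ c d hd hR (fun hR _ hd => ihe hR hd he.1.1 ho.1)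
      (fun hR _ hd => ihf hR hd he.1.2 ho.2) (fun c' q1 q2 p => ?_) hP
    simp only [step, p, q1, q2]; exact step_assign (hfit (e *. f) he.2)
  | div e f ihe ihf =>
    simp only [wf, Bool.and_eq_true] at he
    refine hbin e f (e /. f) _ c d hd hR (fun hR _ hd => ihe hR hd he.1 ho.1)
      (fun hR _ hd => ihf hR hd he.2 ho.2) (fun c' q1 q2 p => ?_) hP
    simp only [step, p, q1, q2]
    refine step_assign ?_
    -- A quotient is no larger than its numerator, so the check for `div` records no size of its
    -- own. What is needed is that a well-formed numerator has size at most `m`.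
    have hb : ∀ e : Expr, e.wf σ τ m → e.bnd σ τ ≤ m := by
      intro e he
      induction e with
      | const z => simpa [wf, bnd] using he
      | var x => simp only [wf, Bool.and_eq_true, decide_eq_true_eq] at he; exact he.2
      | div e f ihe ihf => simp only [wf, Bool.and_eq_true] at he; exact ihe he.1
      | arr a e =>
        simp only [wf, Bool.and_eq_true, decide_eq_true_eq] at he; exact he.1.2
      | _ e f => simp only [wf, Bool.and_eq_true, decide_eq_true_eq] at he; exact he.2
    exact hfit (e /. f) (hb e he.1)

/-- Evaluation of the two sides of a guard. -/
theorem guard_goes (hM : 2 ≤ M) (hB : (B : ℤ) ≤ M ^ 2)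
    (hw : ∀ z : ℤ, |z| ≤ M ^ m → |z| < 2 ^ w) {s : St} (hs : WellTyped σ τ M s) (e f : Expr)
    {c : Config} (hR : Repr B s c) (he : e.wf σ τ m) (hf : f.wf σ τ m) (hoe : e.ok B s)
    (hof : f.ok B s) (hPe : CodeAt P c.pc (e.code 104))
    (hPf : CodeAt P (c.pc + e.cost) (f.code 105)) :
    Goes w P (e.cost + f.cost) c fun c' =>
      c'.pc = c.pc + (e.cost + f.cost) ∧ Repr B s c' ∧ c'.reg 104 = e.eval s ∧
      c'.reg 105 = f.eval s := by
  refine (Expr.code_goes hM hB hw hs e hR le_rfl he hoe hPe).bind ?_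
  rintro c₁ ⟨q1, q2, q3, q4⟩
  have hR₁ : Repr B s c₁ := hR.of_eq q3 q2
  obtain ⟨c₂, hc₂, r1, r2, r3, r4⟩ :=
    Expr.code_goes hM hB hw hs f hR₁ (d := 105) (by omega) hf hof (by rwa [q1])
  exact ⟨c₂, hc₂, by omega, hR₁.of_eq (fun r hr => r3 r (by omega)) r2,
    (r3 104 (by omega)).trans q4, r4⟩

theorem Repr.tick {s : St} {c : Config} (h : Repr B s c) (k l : ℕ) :
    Repr B (s.tick k) ⟨l, c.reg, c.mem⟩ :=
  ⟨h.var, h.base, h.zero, h.one, h.eight, h.mem⟩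

/-- The constants `0` and `1` in registers `101` and `102` turn the only jump instruction into an
unconditional one. -/
theorem Repr.jump {s : St} {c : Config} (h : Repr B s c) {l : ℕ}
    (hP : P[c.pc]? = some (.jumpLt 101 102 l)) :
    step w P c = some ⟨l, c.reg, c.mem⟩ := by
  simp [step, hP, h.zero, h.one]

/-- The compiled command simulates the command within the same number of steps. -/
theorem Exec.code_goes (hM : 2 ≤ M) (hB : (B : ℤ) ≤ M ^ 2)
    (hw : ∀ z : ℤ, |z| ≤ M ^ m → |z| < 2 ^ w) {C : Cmd} {s s' : St}
    (h : Exec σ τ M B C s s') (hs : WellTyped σ τ M s) (hC : C.wf σ τ m) {c : Config}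
    (hR : Repr B s c) (hP : CodeAt P c.pc (C.code c.pc)) :
    ∃ t, s'.time = s.time + t ∧
      Goes w P t c fun c' => c'.pc = c.pc + C.size ∧ Repr B s' c' := by
  have hW : ∀ {s s' : St} {C : Cmd}, Exec σ τ M B C s s' → WellTyped σ τ M s →
    WellTyped σ τ M s' := fun h hs => h.wellTyped hM hs
  have htick : ∀ {s : St} {k : ℕ}, WellTyped σ τ M s → WellTyped σ τ M (s.tick k) :=
    fun hs => ⟨hs.var, hs.arr⟩
  induction h generalizing c with
  | @assign x e s ho hb =>
    simp only [Cmd.wf, Bool.and_eq_true, decide_eq_true_eq] at hC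
    rw [Cmd.code, codeAt_append, Expr.code_length] at hP
    obtain ⟨p1, p2⟩ := hP
    refine ⟨e.cost + 1, rfl,
      (Expr.code_goes hM hB hw hs e hR le_rfl hC.1.2 ho p1).bind ?_⟩
    rintro c₁ ⟨q1, q2, q3, q4⟩
    have hR₁ : Repr B s c₁ := hR.of_eq q3 q2
    have hz : |e.eval s| < 2 ^ w := by
      have hx : |e.eval s| ≤ M ^ σ x :=
        hb.elim (fun h => (e.abs_eval_le hM hs).trans (pow_le_pow_right₀ (by omega) h)) id
      exact hw _ (hx.trans (pow_le_pow_right₀ (by omega) hC.2))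
    have p := p2.get
    rw [← q1] at p
    have hx := hC.1.1
    refine .of_step (by simp only [step, p, q4]; exact step_assign hz) ⟨?_, ?_⟩
    · simp [Cmd.size]; omega
    · refine ⟨fun y hy => ?_, ?_, ?_, ?_, ?_, hR₁.mem⟩
      · simp only [Function.update_apply, St.set_v, hR₁.var y hy]
      · simp [show 100 ≠ x by omega, hR₁.base]
      · simp [show 101 ≠ x by omega, hR₁.zero]
      · simp [show 102 ≠ x by omega, hR₁.one]
      · simp [show 103 ≠ x by omega, hR₁.eight]
  | @store a i e s hi he h0 hBi hb =>
    simp only [Cmd.wf, Bool.and_eq_true, decide_eq_true_eq] at hC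
    obtain ⟨⟨⟨ha, hwi⟩, hwe⟩, him⟩ := hC
    rw [Cmd.code, codeAt_append, codeAt_append, codeAt_append] at hP
    simp only [List.length_append, Expr.code_length, addrCode_length] at hP
    obtain ⟨⟨⟨p1, p2⟩, p3⟩, p4⟩ := hP
    refine ⟨i.cost + (if a = 0 then 0 else 4) + e.cost + 1, rfl, ?_⟩
    refine (((Expr.code_goes hM hB hw hs i hR le_rfl hwi hi p1).bind
      (t' := if a = 0 then 0 else 4)
      (R := fun c' => c'.pc = c.pc + (i.cost + (if a = 0 then 0 else 4)) ∧ Repr B s c' ∧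
        c'.reg 104 = addr B a (i.eval s).toNat) ?_).bind (t' := e.cost)
      (R := fun c' => c'.pc = c.pc + (i.cost + (if a = 0 then 0 else 4) + e.cost) ∧ Repr B s c' ∧
        c'.reg 104 = addr B a (i.eval s).toNat ∧ c'.reg 105 = e.eval s) ?_).bind ?_
    · rintro c₁ ⟨q1, q2, q3, q4⟩
      have hR₁ : Repr B s c₁ := hR.of_eq q3 q2
      obtain ⟨c₂, hc₂, r1, r2, r3, r4⟩ := addrCode_goes hM hB hw hR₁ le_rfl ha q4 h0
        (i.abs_eval_le hM hs) him (by rwa [q1])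
      exact ⟨c₂, hc₂, by omega, hR₁.of_eq r3 r2, r4⟩
    · rintro c₁ ⟨q1, hR₁, q4⟩
      obtain ⟨c₂, hc₂, r1, r2, r3, r4⟩ := Expr.code_goes hM hB hw hs e hR₁ (d := 105) (by omega) hwe he
        (by rwa [q1])
      exact ⟨c₂, hc₂, by omega, hR₁.of_eq (fun r hr => r3 r (by omega)) r2,
        (r3 104 (by omega)).trans q4, r4⟩
    · rintro c₁ ⟨q1, hR₁, q4, q5⟩
      have p := p4.get
      rw [← add_assoc, ← add_assoc] at q1
      simp only [← add_assoc] at p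
      rw [← q1] at p
      refine .of_step (s' := ⟨c₁.pc + 1, c₁.reg,
        Function.update c₁.mem (addr B a (i.eval s).toNat) (e.eval s)⟩) ?_ ⟨?_, ?_⟩
      · simp only [step, p, q4, q5]
        rw [if_pos (by omega), Int.toNat_natCast]
      · simp [Cmd.size]; omega
      · refine ⟨hR₁.var, hR₁.base, hR₁.zero, hR₁.one, hR₁.eight, fun a' i' ha' hi' => ?_⟩
        simp only [St.put_a, Function.update_apply]
        by_cases haa : a' = a
        · subst haa
          by_cases hii : (i' : ℤ) = i.eval s
          · rw [if_pos rfl, if_pos hii, if_pos]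
            rw [← hii, Int.toNat_natCast]
          · rw [if_pos rfl, if_neg hii, if_neg, hR₁.mem _ _ ha' hi']
            intro h
            have := (addr_inj ha' hi' ha (fun h => by have := hBi h; omega) h).2
            omega
        · rw [if_neg haa, if_neg, hR₁.mem _ _ ha' hi']
          intro h
          exact haa (addr_inj ha' hi' ha (fun h => by have := hBi h; omega) h).1
  | @seq C D s s₁ s₂ h₁ h₂ ih₁ ih₂ =>
    simp only [Cmd.wf, Bool.and_eq_true] at hC
    rw [Cmd.code, codeAt_append, Cmd.code_length] at hP
    obtain ⟨t₁, e₁, g₁⟩ := ih₁ hs hC.1 hR hP.1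
    obtain ⟨c₁, hc₁, q1, hR₁⟩ := g₁
    obtain ⟨t₂, e₂, g₂⟩ := ih₂ (hW h₁ hs) hC.2 hR₁ (by rw [q1]; exact hP.2)
    obtain ⟨c₂, hc₂, q2, hR₂⟩ := g₂
    refine ⟨t₁ + t₂, by omega, c₂, run_trans hc₁ hc₂, ?_, hR₂⟩
    simp [Cmd.size]; omega
  | @iteTrue e f C D s s' he hf hlt h ih =>
    simp only [Cmd.wf, Bool.and_eq_true] at hC
    obtain ⟨⟨⟨we, wf⟩, wC⟩, wD⟩ := hC
    simp only [Cmd.code, codeAt_append, List.length_append, Expr.code_length, Cmd.code_length,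
      List.length_singleton, ← add_assoc] at hP
    obtain ⟨⟨⟨⟨⟨p1, p2⟩, p3⟩, p4⟩, p5⟩, p6⟩ := hP
    obtain ⟨c₁, hc₁, q1, hR₁, q2, q3⟩ := guard_goes hM hB hw hs e f hR we wf he hf p1 p2
    have p := p3.get
    rw [show c.pc + e.cost + f.cost = c₁.pc by omega] at p
    have hstep : step w P c₁ =
        some ⟨c.pc + e.cost + f.cost + 1 + D.size + 1, c₁.reg, c₁.mem⟩ := by
      simp only [step, p, q2, q3, if_pos hlt]
      congr 2; omega
    obtain ⟨t, e₂, c₂, hc₂, r1, hR₂⟩ := ih (htick hs) wC (hR₁.tick _ _) p6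
    refine ⟨e.cost + f.cost + 1 + t, ?_, c₂, run_trans (run_trans hc₁ (run_one hstep)) hc₂, ?_, hR₂⟩
    · rw [e₂, St.tick_time]; omega
    · rw [r1]; simp [Cmd.size]; omega
  | @iteFalse e f C D s s' he hf hlt h ih =>
    simp only [Cmd.wf, Bool.and_eq_true] at hC
    obtain ⟨⟨⟨we, wf⟩, wC⟩, wD⟩ := hC
    simp only [Cmd.code, codeAt_append, List.length_append, Expr.code_length, Cmd.code_length,
      List.length_singleton, ← add_assoc] at hP
    obtain ⟨⟨⟨⟨⟨p1, p2⟩, p3⟩, p4⟩, p5⟩, p6⟩ := hP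
    obtain ⟨c₁, hc₁, q1, hR₁, q2, q3⟩ := guard_goes hM hB hw hs e f hR we wf he hf p1 p2
    have p := p3.get
    rw [show c.pc + e.cost + f.cost = c₁.pc by omega] at p
    have hstep : step w P c₁ = some ⟨c.pc + e.cost + f.cost + 1, c₁.reg, c₁.mem⟩ := by
      simp only [step, p, q2, q3, if_neg hlt]
      rw [q1]; simp [add_assoc]
    obtain ⟨t, e₂, c₂, hc₂, r1, hR₂⟩ := ih (htick hs) wD (hR₁.tick _ _) p4
    change c₂.pc = c.pc + e.cost + f.cost + 1 + D.size at r1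
    have p' := p5.get
    rw [← r1] at p'
    refine ⟨e.cost + f.cost + 1 + t + 1, ?_, _,
      run_trans (run_trans (run_trans hc₁ (run_one hstep)) hc₂) (run_one (hR₂.jump p')), ?_,
      hR₂.tick 0 _⟩
    · rw [e₂, St.tick_time]; omega
    · simp only [Cmd.size]; omega
  | @loopTrue e f C s s₁ s' he hf hlt h h' ih ih' =>
    have hC' := hC
    have hP' := hP
    simp only [Cmd.wf, Bool.and_eq_true] at hC
    obtain ⟨⟨we, wf⟩, wC⟩ := hC
    simp only [Cmd.code, codeAt_append, List.length_append, Expr.code_length, Cmd.code_length,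
      List.length_singleton, ← add_assoc] at hP
    obtain ⟨⟨⟨⟨⟨p1, p2⟩, p3⟩, p4⟩, p5⟩, p6⟩ := hP
    obtain ⟨c₁, hc₁, q1, hR₁, q2, q3⟩ := guard_goes hM hB hw hs e f hR we wf he hf p1 p2
    have p := p3.get
    rw [show c.pc + e.cost + f.cost = c₁.pc by omega] at p
    have hstep : step w P c₁ = some ⟨c.pc + e.cost + f.cost + 2, c₁.reg, c₁.mem⟩ := by
      simp only [step, p, q2, q3, if_pos hlt]
      congr 2; omega
    obtain ⟨t, e₂, c₂, hc₂, r1, hR₂⟩ := ih (htick hs) wC (hR₁.tick _ _) p5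
    have p' := p6.get
    rw [show c.pc + e.cost + f.cost + 1 + 1 + C.size = c₂.pc from r1.symm] at p'
    -- The backward jump leads to the loop head in an equivalent configuration; its step is already
    -- contained in the `+ 2` charged for the guard.
    obtain ⟨t', e₃, c₃, hc₃, r3, hR₃⟩ := ih' (hW h (htick hs)) hC' (hR₂.tick 0 c.pc) hP'
    refine ⟨e.cost + f.cost + 1 + t + 1 + t', ?_, _,
      run_trans (run_trans (run_trans (run_trans hc₁ (run_one hstep)) hc₂)
        (run_one (hR₂.jump p'))) hc₃, r3, hR₃⟩
    rw [e₃, e₂, St.tick_time]; omega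
  | @loopFalse e f C s he hf hlt =>
    simp only [Cmd.wf, Bool.and_eq_true] at hC
    obtain ⟨⟨we, wf⟩, wC⟩ := hC
    simp only [Cmd.code, codeAt_append, List.length_append, Expr.code_length, Cmd.code_length,
      List.length_singleton, ← add_assoc] at hP
    obtain ⟨⟨⟨⟨⟨p1, p2⟩, p3⟩, p4⟩, p5⟩, p6⟩ := hP
    obtain ⟨c₁, hc₁, q1, hR₁, q2, q3⟩ := guard_goes hM hB hw hs e f hR we wf he hf p1 p2
    have p := p3.get
    rw [show c.pc + e.cost + f.cost = c₁.pc by omega] at p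
    have hstep : step w P c₁ = some ⟨c.pc + e.cost + f.cost + 1, c₁.reg, c₁.mem⟩ := by
      simp only [step, p, q2, q3, if_neg hlt]
      rw [q1]; simp [add_assoc]
    have hR₂ := hR₁.tick 0 (c.pc + e.cost + f.cost + 1)
    refine ⟨e.cost + f.cost + 1 + 1, rfl, _,
      run_trans (run_trans hc₁ (run_one hstep)) (run_one (hR₂.jump p4.get)), ?_, ?_⟩
    · simp [Cmd.size]; omega
    · exact hR₂.tick _ _
  | skip => exact ⟨0, rfl, c, rfl, rfl, hR⟩

/-- The program that runs a command. -/
def Cmd.program (C : Cmd) : Program :=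
  [.add 100 0 0, .const 102 1, .const 103 8] ++ C.code 3 ++ [.halt]

/-- The three steps added to the clock set up the constant registers. Register `0` initially holds
the common length of the inputs, so doubling it gives the length `B` of array `0`. Register `101` is
zero from the start. -/
theorem Cmd.program_haltsAfter {σ τ : ℕ → ℕ} {M : ℤ} {B m w : ℕ} (hM : 2 ≤ M)
    (hB : (B : ℤ) ≤ M ^ 2) (hm : 5 ≤ m) (hw : ∀ z : ℤ, |z| ≤ M ^ m → |z| < 2 ^ w) {C : Cmd}
    {s s' : St} (h : Exec σ τ M B C s s') (hs : WellTyped σ τ M s) (hC : C.wf σ τ m)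
    (h0 : s.time = 0) {c : Config} (hc : c.pc = 0) (hv : ∀ x, x < 100 → c.reg x = s.v x)
    (hz : c.reg 101 = 0) (hc0 : c.reg 0 + c.reg 0 = B)
    (hmem : ∀ a i : ℕ, a < 8 → (a = 0 → i < B) → c.mem (addr B a i) = s.a a i) :
    ∃ c', HaltsAfter w C.program c (s'.time + 3) c' ∧ Repr B s' c' := by
  have h1 : 1 ≤ M := by omega
  have hbig : ∀ {z : ℤ}, |z| ≤ M ^ 5 → |z| < 2 ^ w := fun hz =>
    hw _ (hz.trans (pow_le_pow_right₀ h1 hm))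
  have e3 : (8 : ℤ) ≤ M ^ 3 := by
    calc (8 : ℤ) = 2 ^ 3 := by norm_num
      _ ≤ M ^ 3 := pow_le_pow_left₀ (by norm_num) hM 3
  have e4 : M ^ 3 ≤ M ^ 5 := pow_le_pow_right₀ h1 (by norm_num)
  have e5 : M ^ 2 ≤ M ^ 5 := pow_le_pow_right₀ h1 (by norm_num)
  have hP : CodeAt C.program 0
      ([.add 100 0 0, .const 102 1, .const 103 8] ++ C.code 3 ++ [.halt]) := by
    intro k hk; rw [zero_add]; rfl
  rw [codeAt_append, codeAt_append] at hP
  obtain ⟨⟨hP1, hP2⟩, hP3⟩ := hP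
  simp only [codeAt_cons] at hP1
  obtain ⟨p1, p2, p3, -⟩ := hP1
  replace p1 : C.program[c.pc]? = some (.add 100 0 0) := by rw [hc]; exact p1
  have s1 : step w C.program c = some ⟨1, Function.update c.reg 100 B, c.mem⟩ := by
    simp only [step, p1, hc0]
    rw [step_assign (hbig (by rw [abs_of_nonneg (by positivity)]; omega)), hc]
  have s2 : step w C.program ⟨1, Function.update c.reg 100 B, c.mem⟩ =
      some ⟨2, Function.update (Function.update c.reg 100 B) 102 1, c.mem⟩ := by
    simp only [step, p2]
    rw [step_assign (hbig (by rw [abs_of_nonneg (by positivity)]; omega))]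
  have s3 : step w C.program ⟨2, Function.update (Function.update c.reg 100 B) 102 1, c.mem⟩ =
      some ⟨3, Function.update (Function.update (Function.update c.reg 100 B) 102 1) 103 8,
        c.mem⟩ := by
    simp only [step, p3]
    rw [step_assign (hbig (by rw [abs_of_nonneg (by positivity)]; omega))]
  have hR : Repr B s ⟨3, Function.update (Function.update (Function.update c.reg 100 B) 102 1) 103 8,
      c.mem⟩ := by
    refine ⟨fun x hx => ?_, ?_, ?_, ?_, ?_, hmem⟩
    · simp [show x ≠ 100 by omega, show x ≠ 102 by omega,
        show x ≠ 103 by omega, hv x hx]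
    · simp
    · simp [hz]
    · simp
    · simp
  obtain ⟨t, ht, c', hc', q1, hR'⟩ := h.code_goes hM hB hw hs hC hR hP2
  refine ⟨c', ⟨?_, ?_⟩, hR'⟩
  · have := run_trans (run_trans (run_trans (run_one s1) (run_one s2)) (run_one s3)) hc'
    rw [show s'.time + 3 = 1 + 1 + 1 + t by omega]
    exact this
  · have := hP3.get
    rw [q1, ← this]
    simp only [List.length_append, Cmd.code_length, List.length_cons, List.length_nil]
    congr 1; omega

end Compile

end WordRAM

/-! ### Memory layout of the algorithm -/

namespace WordRAM

/-- Sizes of the variables. -/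
def varSize (x : ℕ) : ℕ :=
  [1, 1, 1, 3, 2, 3, 6, 6, 15, 21,
   1, 1, 5, 3, 14, 12, 15, 6, 1, 5,
   0, 0, 0, 0, 0, 0, 0, 0, 0, 0,
   5, 8, 14, 0, 0, 0, 0, 0, 0, 0,
   16, 1, 1, 1, 8, 8, 14, 14, 4, 0].getD x 0

/-- Sizes of the array entries. -/
def arrSize (a : ℕ) : ℕ := [1, 5, 4, 14, 14, 1, 21].getD a 0

/-! ### Binary search -/

/-- `r` is the first index below `n` at which `S` is at least `z` (and `n` if there is none). -/
structure IsLB (n : ℕ) (S : ℕ → ℤ) (z : ℤ) (r : ℕ) : Prop where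
  le : r ≤ n
  lt : ∀ k, k < r → S k < z
  ge : ∀ k, r ≤ k → k < n → z ≤ S k

/-- Binary search for the value of variable `40` in array `1`; the result is in variable `41`. -/
def lowerBound : Cmd :=
  41 ≔ ♭0 ;; 42 ≔ ♯0 ;;
  .loop ♯41 ♯42
    (43 ≔ (♯41 +. ♯42) /. ♭2 ;;
     .ite (.arr 1 ♯43) ♯40 (41 ≔ ♯43 +. ♭1) (42 ≔ ♯43))

variable {M B : ℤ}

/-- With `k` iterations left the interval satisfies `hi - lo < 2 ^ k`; everything left of `lo` is
below `z`, and everything from `hi` on is at least `z`. -/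
theorem wp_lowerBound {n H : ℕ} {S : ℕ → ℤ} {z : ℤ} {Q : St → Prop} {s : St}
    (hn : s.v 0 = n) (hz : s.v 40 = z) (hS : ∀ k : ℕ, k < n → s.a 1 k = S k)
    (hmono : ∀ k l, k < l → l < n → S k < S l) (hH : n < 2 ^ H) (hnM : (n : ℤ) ≤ M)
    (hQ : ∀ (s' : St) (r : ℕ), (∀ x, x < 40 → s'.v x = s.v x) → s'.a = s.a →
      s'.time ≤ s.time + 30 * (H + 1) → s'.v 41 = r → IsLB n S z r → Q s') :
    wp varSize arrSize M B lowerBound Q s := by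
  have hmono' : ∀ k l, k ≤ l → l < n → S k ≤ S l := by
    intro k l hkl hl
    rcases hkl.eq_or_lt with rfl | h
    · exact le_rfl
    · exact (hmono k l h hl).le
  unfold lowerBound
  simp +decide only [wp_seq, wp_assign, Expr.ok, Expr.eval, Expr.cost, true_and, true_or]
  refine wp_loop (fun k s' => (∀ x, x < 41 → s'.v x = s.v x) ∧ s'.a = s.a ∧
    s'.time + 30 * k ≤ s.time + 30 * H + 10 ∧ ∃ lo hi : ℕ, s'.v 41 = lo ∧ s'.v 42 = hi ∧
      lo ≤ hi ∧ hi ≤ n ∧ hi - lo < 2 ^ k ∧ (∀ j, j < lo → S j < z) ∧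
      (∀ j, hi ≤ j → j < n → z ≤ S j)) ?_ H ?_
  · rintro k s' ⟨hv, ha, ht, lo, hi, hlo, hhi, h1, h2, h3, h4, h5⟩
    refine ⟨trivial, trivial, fun hlt => ?_, fun hge => ?_⟩
    · simp only [Expr.eval, hlo, hhi] at hlt
      cases k with
      | zero => simp at h3; omega
      | succ k =>
      refine ⟨k, rfl, ?_⟩
      have hmid : ((lo : ℤ) + hi) / 2 = ((lo + hi) / 2 : ℕ) := by omega
      set mid : ℕ := (lo + hi) / 2 with hmid'
      have hSm : s'.a 1 (mid : ℤ) = S mid := by rw [ha]; exact hS _ (by omega)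
      have h40 : s'.v 40 = z := by rw [hv 40 (by omega), hz]
      rw [pow_succ] at h3
      simp +decide only [wp_seq, wp_assign, wp_ite, Expr.ok, Expr.eval, Expr.cost, true_and,
        true_or, St.set_v, St.set_a, St.tick_v, St.tick_a, if_true, if_false, hlo, hhi, hmid,
        hSm, h40]
      refine ⟨Or.inr ?_, ⟨by omega, by simp⟩, fun hc => ⟨Or.inr ?_, ?_⟩, fun hc => ?_⟩
      · rw [abs_of_nonneg (by omega)]; norm_num [varSize]; omega
      · rw [abs_of_nonneg (by omega)]; norm_num [varSize]; omega
      · refine ⟨fun x hx => ?_, ha, ?_, mid + 1, hi, ?_, ?_, ?_⟩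
        · simp [show x ≠ 41 by omega, show x ≠ 43 by omega, hv x hx]
        · simp; omega
        · simp
        · simp
        · refine ⟨by omega, h2, by omega, fun j hj => ?_, h5⟩
          exact (hmono' j mid (by omega) (by omega)).trans_lt hc
      · refine ⟨fun x hx => ?_, ha, ?_, lo, mid, ?_, ?_, ?_⟩
        · simp [show x ≠ 42 by omega, show x ≠ 43 by omega, hv x hx]
        · simp; omega
        · simp
        · simp
        · refine ⟨by omega, by omega, by omega, h4, fun j hj hjn => ?_⟩
          exact hc.trans (hmono' mid j hj hjn)
    · simp only [Expr.eval, hlo, hhi] at hge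
      obtain rfl : lo = hi := by omega
      refine hQ _ lo (fun x hx => hv x (by omega)) ha ?_ hlo ⟨h2, h4, h5⟩
      simp [Expr.cost]; omega
  · refine ⟨fun x hx => ?_, rfl, ?_, 0, n, ?_, ?_, ?_⟩
    · simp [show x ≠ 41 by omega, show x ≠ 42 by omega]
    · simp; omega
    · simp
    · simp [hn]
    · exact ⟨by omega, le_rfl, by simpa using hH, by simp, fun j hj hjn => by omega⟩

end WordRAM

namespace WordRAM

/-! ### Search trees

The leaves of a complete binary tree of height `H` are numbered from `2 ^ H` to `2 ^ (H + 1) - 1`;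
the ancestor of `l` at height `h` is `l / 2 ^ h`. -/

/-- `r` is the largest number with property `p`, where `0` is the value for "none". -/
structure IsBest (p : ℤ → Prop) (r : ℤ) : Prop where
  nonneg : 0 ≤ r
  ge : ∀ z, p z → z ≤ r
  mem : r = 0 ∨ p r

theorem IsBest.congr {p q : ℤ → Prop} {r : ℤ} (h : IsBest p r) (hpq : ∀ z, q z ↔ p z) :
    IsBest q r :=
  ⟨h.nonneg, fun z hz => h.ge z ((hpq z).1 hz), h.mem.imp_right (hpq r).2⟩

theorem IsBest.sup {p q : ℤ → Prop} {r r' : ℤ} (h : IsBest p r) (h' : IsBest q r') :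
    IsBest (fun z => p z ∨ q z) (max r r') := by
  refine ⟨h.nonneg.trans (le_max_left _ _), ?_, ?_⟩
  · rintro z (hz | hz)
    · exact (h.ge z hz).trans (le_max_left _ _)
    · exact (h'.ge z hz).trans (le_max_right _ _)
  · rcases max_choice r r' with e | e <;> rw [e]
    · exact h.mem.imp_right Or.inl
    · exact h'.mem.imp_right Or.inr

/-- The items of `J` left of the leaf `l` that are not below a node left of `l / 2 ^ h`. -/
def LeftOf (J : ℕ → ℤ → Prop) (l h : ℕ) (z : ℤ) : Prop :=
  ∃ l', J l' z ∧ l' < l ∧ l / 2 ^ h ≤ l' / 2 ^ h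

/-- The items of `J` below the node `p` of height `h`. -/
def Below (J : ℕ → ℤ → Prop) (h p : ℕ) (z : ℤ) : Prop := ∃ l', J l' z ∧ l' / 2 ^ h = p

theorem div_pow_succ (l h : ℕ) : l / 2 ^ (h + 1) = l / 2 ^ h / 2 := by
  rw [pow_succ, Nat.div_div_eq_div_mul]

/-- An even node is a left child, so passing to its parent adds nothing on the left. -/
theorem leftOf_succ_of_even {J : ℕ → ℤ → Prop} {l h : ℕ} (hp : l / 2 ^ h % 2 = 0) (z : ℤ) :
    LeftOf J l (h + 1) z ↔ LeftOf J l h z := by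
  simp only [LeftOf, div_pow_succ]
  refine exists_congr fun l' => and_congr_right fun _ => and_congr_right fun _ => ?_
  generalize l / 2 ^ h = p at *
  generalize l' / 2 ^ h = p'
  omega

/-- An odd node is a right child; its parent additionally covers exactly the subtree of its left
sibling, the node numbered one less. -/
theorem leftOf_succ_of_odd {J : ℕ → ℤ → Prop} {l h : ℕ} (hp : l / 2 ^ h % 2 = 1) (z : ℤ) :
    LeftOf J l (h + 1) z ↔ LeftOf J l h z ∨ Below J h (l / 2 ^ h - 1) z := by
  simp only [LeftOf, Below, div_pow_succ]
  constructor
  · rintro ⟨l', hJ, hl, hd⟩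
    by_cases h' : l / 2 ^ h ≤ l' / 2 ^ h
    · exact Or.inl ⟨l', hJ, hl, h'⟩
    · refine Or.inr ⟨l', hJ, ?_⟩
      generalize l / 2 ^ h = p at *
      generalize l' / 2 ^ h = p' at *
      omega
  · rintro (⟨l', hJ, hl, hd⟩ | ⟨l', hJ, hd⟩)
    · exact ⟨l', hJ, hl, by omega⟩
    · refine ⟨l', hJ, ?_, by rw [hd]; generalize l / 2 ^ h = p at *; omega⟩
      by_contra hl
      have := Nat.div_le_div_right (c := 2 ^ h) (not_lt.1 hl)
      generalize l / 2 ^ h = p at *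
      generalize l' / 2 ^ h = p' at *
      omega

/-- `l` is a leaf of the tree of height `H`. -/
def IsLeaf (H l : ℕ) : Prop := 2 ^ H ≤ l ∧ l < 2 ^ (H + 1)

theorem IsLeaf.div_lt_two {H l : ℕ} (hl : IsLeaf H l) : l / 2 ^ H = 1 := by
  have h := hl.2
  rw [pow_succ] at h
  exact Nat.div_eq_of_lt_le (by simpa using hl.1) (by omega)

/-- In heap numbering the binary length of a node number gives its depth, so equal nodes above
leaves have equal heights. -/
theorem IsLeaf.log {H l h : ℕ} (hl : IsLeaf H l) : Nat.log 2 (l / 2 ^ h) = H - h := by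
  rw [Nat.log_div_base_pow, Nat.log_eq_of_pow_le_of_lt_pow hl.1 hl.2]

theorem IsLeaf.lt_of_one_lt {H l h : ℕ} (hl : IsLeaf H l) (h1 : 1 < l / 2 ^ h) : h < H := by
  have := hl.log (h := h)
  have h2 : 0 < Nat.log 2 (l / 2 ^ h) := Nat.log_pos (by norm_num) h1
  omega

theorem IsLeaf.div_pos {H l h : ℕ} (hl : IsLeaf H l) (hh : h ≤ H) : 0 < l / 2 ^ h :=
  Nat.div_pos ((Nat.pow_le_pow_right (by norm_num) hh).trans hl.1) (by positivity)

/-- The left neighbour of an odd node has the same height. -/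
theorem IsLeaf.height_eq {H l l' h h' : ℕ} (hl : IsLeaf H l) (hl' : IsLeaf H l') (hh' : h' ≤ H)
    (hodd : l / 2 ^ h % 2 = 1) (h1 : 1 < l / 2 ^ h) (he : l' / 2 ^ h' = l / 2 ^ h - 1) :
    h' = h := by
  have e1 := hl.log (h := h)
  have e2 := hl'.log (h := h')
  have e3 := hl.lt_of_one_lt h1
  have e4 := Nat.log_div_base 2 (l / 2 ^ h)
  have e5 := Nat.log_div_base 2 (l' / 2 ^ h')
  have e6 : l / 2 ^ h / 2 = l' / 2 ^ h' / 2 := by omega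
  have e7 : 0 < Nat.log 2 (l / 2 ^ h) := Nat.log_pos (by norm_num) h1
  have e8 : 0 < Nat.log 2 (l' / 2 ^ h') := Nat.log_pos (by norm_num) (by omega)
  rw [e6] at e4
  omega

/-- The array `f` is divided into trees of height `H`. -/
def cell (H : ℕ) (f : ℤ → ℤ) (t p : ℕ) : ℤ := f (t * (2 * 2 ^ H) + p)

/-- Every node of the trees holds the best of the items below it. The item `I t l z` is
the number `z` at leaf `l` of tree `t`. -/
structure TreeRep (H : ℕ) (T : ℕ → ℕ → ℤ) (I : ℕ → ℕ → ℤ → Prop) : Prop where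
  leaf : ∀ t l z, I t l z → IsLeaf H l
  nonneg : ∀ t p, p < 2 ^ (H + 1) → 0 ≤ T t p
  ge : ∀ t l z, I t l z → ∀ h, h ≤ H → z ≤ T t (l / 2 ^ h)
  mem : ∀ t p, 0 < p → p < 2 ^ (H + 1) →
    T t p = 0 ∨ ∃ l h, h ≤ H ∧ l / 2 ^ h = p ∧ I t l (T t p)

theorem TreeRep.congr {H : ℕ} {T : ℕ → ℕ → ℤ} {I I' : ℕ → ℕ → ℤ → Prop} (hT : TreeRep H T I)
    (h : ∀ t l z, I' t l z ↔ I t l z) : TreeRep H T I' := by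
  have : I' = I := by funext t l z; exact propext (h t l z)
  rwa [this]

theorem TreeRep.empty (H : ℕ) : TreeRep H (fun _ _ => 0) fun _ _ _ => False :=
  ⟨by simp, by simp, by simp, by simp⟩

/-- An odd node's left neighbour holds the best of the items below it. -/
theorem TreeRep.isBest {H : ℕ} {T : ℕ → ℕ → ℤ} {I : ℕ → ℕ → ℤ → Prop} (hT : TreeRep H T I)
    {t l h : ℕ} (hl : IsLeaf H l) (hodd : l / 2 ^ h % 2 = 1) (h1 : 1 < l / 2 ^ h) :
    IsBest (Below (I t) h (l / 2 ^ h - 1)) (T t (l / 2 ^ h - 1)) := by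
  have hlt : l / 2 ^ h - 1 < 2 ^ (H + 1) :=
    (Nat.sub_le _ _).trans_lt ((Nat.div_le_self _ _).trans_lt hl.2)
  refine ⟨hT.nonneg _ _ hlt, ?_, ?_⟩
  · rintro z ⟨l', hI, he⟩
    rw [← he]
    exact hT.ge _ _ _ hI _ (hl.lt_of_one_lt h1).le
  · refine (hT.mem t (l / 2 ^ h - 1) (by omega) hlt).imp_right ?_
    rintro ⟨l', h', hh', he, hI⟩
    obtain rfl := hl.height_eq (hT.leaf _ _ _ hI) hh' hodd h1 he
    exact ⟨l', hI, he⟩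

/-- Only the ancestors of `l` have the new item below them, so taking the maximum with `z` on this
one path suffices. The other nodes keep their witnesses. -/
theorem TreeRep.insert {H : ℕ} {T T' : ℕ → ℕ → ℤ} {I : ℕ → ℕ → ℤ → Prop} (hT : TreeRep H T I)
    {t l : ℕ} {z : ℤ} (hl : IsLeaf H l)
    (hyes : ∀ h, h ≤ H → T' t (l / 2 ^ h) = max (T t (l / 2 ^ h)) z)
    (hno : ∀ u p, p < 2 ^ (H + 1) → (u = t → ∀ h, h ≤ H → p ≠ l / 2 ^ h) → T' u p = T u p) :
    TreeRep H T' fun u k y => I u k y ∨ u = t ∧ k = l ∧ y = z := by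
  have hlt : ∀ {l : ℕ}, IsLeaf H l → ∀ h, l / 2 ^ h < 2 ^ (H + 1) := fun hl h =>
    (Nat.div_le_self _ _).trans_lt hl.2
  have hle : ∀ u p, p < 2 ^ (H + 1) → T u p ≤ T' u p := by
    intro u p hp
    by_cases h : u = t → ∀ h, h ≤ H → p ≠ l / 2 ^ h
    · rw [hno u p hp h]
    · push Not at h
      obtain ⟨rfl, h, hh, rfl⟩ := h
      rw [hyes h hh]
      exact le_max_left _ _
  refine ⟨?_, fun u p hp => (hT.nonneg u p hp).trans (hle u p hp), ?_, ?_⟩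
  · rintro u k y (hI | ⟨rfl, rfl, rfl⟩)
    · exact hT.leaf _ _ _ hI
    · exact hl
  · rintro u k y (hI | ⟨rfl, rfl, rfl⟩) h hh
    · exact (hT.ge _ _ _ hI h hh).trans (hle _ _ (hlt (hT.leaf _ _ _ hI) h))
    · rw [hyes h hh]
      exact le_max_right _ _
  · intro u p hp hp'
    by_cases h : u = t → ∀ h, h ≤ H → p ≠ l / 2 ^ h
    · rw [hno u p hp' h]
      exact (hT.mem u p hp hp').imp_right fun ⟨k, h, hh, he, hI⟩ => ⟨k, h, hh, he, Or.inl hI⟩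
    · push Not at h
      obtain ⟨rfl, h, hh, rfl⟩ := h
      rw [hyes h hh]
      rcases max_choice (T u (l / 2 ^ h)) z with e | e <;> rw [e]
      · exact (hT.mem u _ hp hp').imp_right fun ⟨k, h, hh, he, hI⟩ => ⟨k, h, hh, he, Or.inl hI⟩
      · exact Or.inr ⟨l, h, hh, rfl, Or.inr ⟨rfl, rfl, rfl⟩⟩

/-- The best item left of leaf `♯45` in tree `♯44` of array `a`; the result is in variable `46`. -/
def query (a : ℕ) : Cmd :=
  46 ≔ ♭0 ;;
  .loop ♭1 ♯45
    (.ite ♭0 (♯45 -. (♯45 /. ♭2) *. ♭2)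
      (47 ≔ .arr a (♯44 *. (♭2 *. ♯3) +. (♯45 -. ♭1)) ;;
       .ite ♯46 ♯47 (46 ≔ ♯47) .skip)
      .skip ;;
     45 ≔ ♯45 /. ♭2)

variable {M B : ℤ}

/-- The walk goes from the leaf to the root and keeps the best item of `LeftOf`. This set is empty
at height `0` and consists of all items left of `l` at the root. Each right child met on the way
contributes its left sibling's entry. -/
theorem wp_query {a H : ℕ} {I : ℕ → ℕ → ℤ → Prop} {t l : ℕ} {Q : St → Prop} {s : St}
    (ha : a ≠ 0) (ha' : arrSize a = 14)
    (hN : s.v 3 = 2 ^ H) (ht : s.v 44 = t) (hl : s.v 45 = l) (hleaf : IsLeaf H l)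
    (hT : TreeRep H (cell H (s.a a)) I)
    (hQ : ∀ s' : St, (∀ x, x < 44 → s'.v x = s.v x) → s'.a = s.a →
      s'.time ≤ s.time + 50 * (H + 1) →
      IsBest (fun z => ∃ l', I t l' z ∧ l' < l) (s'.v 46) → Q s') :
    wp varSize arrSize M B (query a) Q s := by
  unfold query
  simp +decide only [wp_seq, wp_assign, Expr.ok, Expr.eval, Expr.cost, true_and, true_or]
  refine wp_loop (fun k s' => (∀ x, x < 45 → s'.v x = s.v x) ∧ s'.a = s.a ∧
    s'.time + 50 * k ≤ s.time + 50 * H + 10 ∧ ∃ h, h + k = H ∧ s'.v 45 = (l / 2 ^ h : ℕ) ∧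
      IsBest (LeftOf (I t) l h) (s'.v 46)) ?_ H ?_
  · rintro k s' ⟨hv, hsa, htime, h, hk, h45, hbest⟩
    refine ⟨trivial, trivial, fun hlt => ?_, fun hge => ?_⟩
    · simp only [Expr.eval, h45] at hlt
      have h1 : 1 < l / 2 ^ h := by exact_mod_cast hlt
      have hh := hleaf.lt_of_one_lt h1
      obtain ⟨k, rfl⟩ : ∃ k', k = k' + 1 := ⟨k - 1, by omega⟩
      refine ⟨k, rfl, ?_⟩
      have hdiv : ((l / 2 ^ h : ℕ) : ℤ) / 2 = (l / 2 ^ (h + 1) : ℕ) := by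
        rw [div_pow_succ]; omega
      have h44 : s'.v 44 = t := by rw [hv 44 (by omega), ht]
      have h3 : s'.v 3 = 2 ^ H := by rw [hv 3 (by omega), hN]
      have hcell : s'.a a (t * (2 * 2 ^ H) + (((l / 2 ^ h : ℕ) : ℤ) - 1)) =
          cell H (s.a a) t (l / 2 ^ h - 1) := by
        rw [hsa, cell]; congr 2; omega
      have hidx : 0 ≤ (t : ℤ) * (2 * 2 ^ H) + (((l / 2 ^ h : ℕ) : ℤ) - 1) := by
        have : 0 ≤ (t : ℤ) * (2 * 2 ^ H) := by positivity
        omega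
      simp +decide only [wp_seq, wp_assign, wp_ite, wp_skip, Expr.ok, Expr.eval, Expr.cost,
        true_and, true_or, St.set_v, St.set_a, St.tick_v, St.tick_a, if_true, if_false, h45,
        h44, h3, hcell, hidx, ha, ha', false_imp_iff, Expr.bnd]
      have hf : ∀ x, x < 45 → x ≠ 45 ∧ x ≠ 46 ∧ x ≠ 47 := fun x hx => by omega
      refine ⟨fun hodd => ?_, fun heven => ?_⟩
      · have hodd' : l / 2 ^ h % 2 = 1 := by omega
        have hbest' := ((hbest.sup (hT.isBest (t := t) hleaf hodd' h1)).congr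
          (leftOf_succ_of_odd hodd'))
        refine ⟨fun hc => ⟨fun x hx => ?_, hsa, ?_, h + 1, by omega, ?_, ?_⟩,
          fun hc => ⟨fun x hx => ?_, hsa, ?_, h + 1, by omega, ?_, ?_⟩⟩
        · simp [hf x hx, hv x hx]
        · simp; omega
        · simpa using hdiv
        · rw [max_eq_right hc.le] at hbest'
          simpa using hbest'
        · simp [hf x hx, hv x hx]
        · simp; omega
        · simpa using hdiv
        · rw [max_eq_left hc] at hbest'
          simpa using hbest'
      · have heven' : l / 2 ^ h % 2 = 0 := by omega
        refine ⟨fun x hx => ?_, hsa, ?_, h + 1, by omega, ?_, ?_⟩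
        · simp [hf x hx, hv x hx]
        · simp; omega
        · simpa using hdiv
        · simpa using hbest.congr (leftOf_succ_of_even heven')
    · simp only [Expr.eval, h45] at hge
      have hge' : l / 2 ^ h ≤ 1 := by exact_mod_cast hge
      -- The loop stops at a node number at most `1`. Its logarithm `H - h` vanishes, so the walk
      -- has reached the root.
      have hh : h = H := by
        by_contra hne
        have e := hleaf.log (h := h)
        have : Nat.log 2 (l / 2 ^ h) = 0 := by
          rw [Nat.log_eq_zero_iff]; omega
        omega
      subst hh
      refine hQ _ (fun x hx => hv x (by omega)) hsa ?_ (hbest.congr fun z => ?_)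
      · simp [Expr.cost]; omega
      · refine exists_congr fun l' => and_congr_right fun hI => ?_
        rw [hleaf.div_lt_two, (hT.leaf _ _ _ hI).div_lt_two]
        simp
  · refine ⟨fun x hx => ?_, rfl, ?_, 0, by omega, ?_, ?_⟩
    · simp [show x ≠ 46 by omega]
    · simp; omega
    · simp [hl]
    · refine ⟨by simp, ?_, by simp⟩
      rintro z ⟨l', hI, h1, h2⟩
      simp at h2; omega

/-- Insert the item `♯46` at leaf `♯45` of tree `♯44` of array `a`. -/
def insertItem (a : ℕ) : Cmd :=
  .loop ♭0 ♯45
    (.ite (.arr a (♯44 *. (♭2 *. ♯3) +. ♯45)) ♯46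
      (.store a (♯44 *. (♭2 *. ♯3) +. ♯45) ♯46)
      .skip ;;
     45 ≔ ♯45 /. ♭2)

/-- The invariant describes the array after the ancestors of height below `h` have been updated. The
loop ends after the root, when the halved node number becomes `0`, hence the `H + 1` iterations. -/
theorem wp_insertItem {a H : ℕ} {I : ℕ → ℕ → ℤ → Prop} {t l : ℕ} {z : ℤ} {Q : St → Prop} {s : St}
    (ha : a ≠ 0) (ha' : arrSize a = 14)
    (hN : s.v 3 = 2 ^ H) (ht : s.v 44 = t) (hl : s.v 45 = l) (hz : s.v 46 = z) (hleaf : IsLeaf H l)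
    (hT : TreeRep H (cell H (s.a a)) I)
    (hQ : ∀ s' : St, (∀ x, x < 44 → s'.v x = s.v x) → (∀ b, b ≠ a → s'.a b = s.a b) →
      s'.time ≤ s.time + 50 * (H + 2) →
      TreeRep H (cell H (s'.a a)) (fun u k y => I u k y ∨ u = t ∧ k = l ∧ y = z) → Q s') :
    wp varSize arrSize M B (insertItem a) Q s := by
  unfold insertItem
  have hanc : ∀ h, l / 2 ^ h < 2 ^ (H + 1) := fun h => (Nat.div_le_self _ _).trans_lt hleaf.2
  refine wp_loop (fun k s' => (∀ x, x ≠ 45 → s'.v x = s.v x) ∧ (∀ b, b ≠ a → s'.a b = s.a b) ∧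
    s'.time + 50 * k ≤ s.time + 50 * (H + 1) ∧ ∃ h, h + k = H + 1 ∧ s'.v 45 = (l / 2 ^ h : ℕ) ∧
      (∀ g, g < h → cell H (s'.a a) t (l / 2 ^ g) = max (cell H (s.a a) t (l / 2 ^ g)) z) ∧
      (∀ u p, p < 2 ^ (H + 1) → (u = t → ∀ g, g < h → p ≠ l / 2 ^ g) →
        cell H (s'.a a) u p = cell H (s.a a) u p)) ?_ (H + 1) ?_
  · rintro k s' ⟨hv, hsa, htime, h, hk, h45, hyes, hno⟩
    refine ⟨trivial, trivial, fun hlt => ?_, fun hge => ?_⟩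
    · simp only [Expr.eval, h45] at hlt
      have h1 : 0 < l / 2 ^ h := by exact_mod_cast hlt
      have hh : h ≤ H := by
        by_contra hh
        rw [Nat.div_eq_of_lt (hleaf.2.trans_le (Nat.pow_le_pow_right (by norm_num) (by omega)))]
          at h1
        omega
      obtain ⟨k, rfl⟩ : ∃ k', k = k' + 1 := ⟨k - 1, by omega⟩
      refine ⟨k, rfl, ?_⟩
      have hdiv : ((l / 2 ^ h : ℕ) : ℤ) / 2 = (l / 2 ^ (h + 1) : ℕ) := by
        rw [div_pow_succ]; omega
      have h44 : s'.v 44 = t := by rw [hv 44 (by omega), ht]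
      have h46 : s'.v 46 = z := by rw [hv 46 (by omega), hz]
      have h3 : s'.v 3 = 2 ^ H := by rw [hv 3 (by omega), hN]
      -- The ancestors of a leaf are pairwise distinct, so the current node still has its old entry.
      have hdec : ∀ g, g < h → l / 2 ^ h ≠ l / 2 ^ g := by
        intro g hg he
        have e1 := hleaf.log (h := h)
        have e2 := hleaf.log (h := g)
        rw [he] at e1
        omega
      have hcell : s'.a a (t * (2 * 2 ^ H) + ((l / 2 ^ h : ℕ) : ℤ)) =
          cell H (s.a a) t (l / 2 ^ h) :=
        hno t _ (hanc h) fun _ => hdec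
      have hidx : 0 ≤ (t : ℤ) * (2 * 2 ^ H) + ((l / 2 ^ h : ℕ) : ℤ) := by positivity
      simp +decide only [wp_seq, wp_assign, wp_ite, wp_skip, wp_store, Expr.ok, Expr.eval,
        Expr.cost, true_and, true_or, St.tick_v, St.tick_a, if_false, h45, h46,
        h44, h3, hcell, hidx, ha, ha', false_imp_iff, Expr.bnd, St.put_v]
      -- Whether or not the entry is overwritten, the new array has the maximum at the current node
      -- and is unchanged elsewhere. This is all that the invariant needs.
      have hstep : ∀ f : ℤ → ℤ,
          f (t * (2 * 2 ^ H) + ((l / 2 ^ h : ℕ) : ℤ)) = max (cell H (s.a a) t (l / 2 ^ h)) z →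
          (∀ i, i ≠ t * (2 * 2 ^ H) + ((l / 2 ^ h : ℕ) : ℤ) → f i = s'.a a i) →
          (∀ g, g < h + 1 → cell H f t (l / 2 ^ g) = max (cell H (s.a a) t (l / 2 ^ g)) z) ∧
          (∀ u p, p < 2 ^ (H + 1) → (u = t → ∀ g, g < h + 1 → p ≠ l / 2 ^ g) →
            cell H f u p = cell H (s.a a) u p) := by
        intro f hf1 hf2
        -- A tree occupies `2 ^ (H + 1)` consecutive cells, so remainder and quotient by this number
        -- recover node and tree.
        have hinj : ∀ u p : ℕ, p < 2 ^ (H + 1) →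
            (u : ℤ) * (2 * 2 ^ H) + p = t * (2 * 2 ^ H) + ((l / 2 ^ h : ℕ) : ℤ) →
            u = t ∧ p = l / 2 ^ h := by
          intro u p hp he
          have he' : p + (2 ^ (H + 1)) * u = l / 2 ^ h + 2 ^ (H + 1) * t := by
            have : ((p + (2 ^ (H + 1)) * u : ℕ) : ℤ) = (l / 2 ^ h + 2 ^ (H + 1) * t : ℕ) := by
              push_cast [pow_succ] at he ⊢
              linarith
            exact_mod_cast this
          have e1 := congrArg (· % 2 ^ (H + 1)) he'
          simp only [Nat.add_mul_mod_self_left, Nat.mod_eq_of_lt hp, Nat.mod_eq_of_lt (hanc h)]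
            at e1
          refine ⟨?_, e1⟩
          rw [e1] at he'
          exact Nat.eq_of_mul_eq_mul_left (by positivity) (Nat.add_left_cancel he')
        refine ⟨fun g hg => ?_, fun u p hp hne => ?_⟩
        · rcases Nat.lt_succ_iff_lt_or_eq.1 hg with hg | rfl
          · rw [← hyes g hg]
            refine hf2 _ fun he => ?_
            exact hdec g hg (hinj t _ (hanc g) he).2.symm
          · exact hf1
        · rw [← hno u p hp fun hu g hg => hne hu g (by omega)]
          refine hf2 _ fun he => ?_
          obtain ⟨e1, e2⟩ := hinj u p hp he
          exact hne e1 h (by omega) e2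
      refine ⟨fun hc => ⟨fun x hx => ?_, fun b hb => ?_, ?_, h + 1, by omega, ?_, ?_⟩,
        fun hc => ⟨fun x hx => ?_, fun b hb => ?_, ?_, h + 1, by omega, ?_, ?_⟩⟩
      · simp [hx, hv x hx]
      · rw [St.set_a, St.put_a_ne _ _ _ _ _ hb]; exact hsa b hb
      · simp; omega
      · simpa using hdiv
      · refine hstep _ ?_ ?_
        · simp [max_eq_right hc.le]
        · intro i hi
          simp only [St.set_a, St.put_a, if_true, if_neg hi]
          rfl
      · simp [hx, hv x hx]
      · exact hsa b hb
      · simp; omega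
      · simpa using hdiv
      · refine hstep _ ?_ fun i _ => rfl
        rw [max_eq_left hc]; exact hcell
    · simp only [Expr.eval, h45] at hge
      have hge' : l / 2 ^ h = 0 := Nat.le_zero.1 (by exact_mod_cast hge)
      have hh : h = H + 1 := by
        by_contra hne
        have := hleaf.div_pos (h := h) (by omega)
        omega
      subst hh
      refine hQ _ (fun x hx => hv x (by omega)) hsa ?_
        (hT.insert hleaf (fun g hg => hyes g (by omega)) fun u p hp hne =>
          hno u p hp fun hu g hg => hne hu g (by omega))
      simp [Expr.cost]; omega
  · exact ⟨fun _ _ => rfl, fun _ _ => rfl, by omega, 0, by omega, by simp [hl],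
      by simp, by simp⟩

end WordRAM

namespace WordRAM

/-! ### Two-dimensional search trees

The item `I k l z` is the number `z` at the pair `(k, l)` of leaves. It is kept at leaf `l` of
the trees whose numbers are the ancestors of `k`. -/

/-- The items of the tree that belongs to node `t`. -/
def Spread (H : ℕ) (I : ℕ → ℕ → ℤ → Prop) (t l : ℕ) (z : ℤ) : Prop :=
  ∃ k h, h ≤ H ∧ k / 2 ^ h = t ∧ I k l z

/-- The array `f` represents the items `I`. -/
structure TreeRep₂ (H : ℕ) (f : ℤ → ℤ) (I : ℕ → ℕ → ℤ → Prop) : Prop where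
  leaf : ∀ k l z, I k l z → IsLeaf H k
  rep : TreeRep H (cell H f) (Spread H I)

/-- The best item `(k, l)` with `k < ♯30` and `l < ♯31`; the result is in variable `32`. -/
def query₂ : Cmd :=
  32 ≔ ♭0 ;;
  .loop ♭1 ♯30
    (.ite ♭0 (♯30 -. (♯30 /. ♭2) *. ♭2)
      (44 ≔ ♯30 -. ♭1 ;; 45 ≔ ♯31 ;; query 4 ;;
       .ite ♯32 ♯46 (32 ≔ ♯46) .skip)
      .skip ;;
     30 ≔ ♯30 /. ♭2)

variable {M B : ℤ}

/-- The same walk towards the root in the first coordinate, where a left sibling contributes the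
answer of a one-dimensional query in its own tree. This explains the square of the height in the
running time. -/
theorem wp_query₂ {H : ℕ} {I : ℕ → ℕ → ℤ → Prop} {k l : ℕ} {Q : St → Prop} {s : St}
    (hN : s.v 3 = 2 ^ H) (hk : s.v 30 = k) (hl : s.v 31 = l) (hkleaf : IsLeaf H k)
    (hlleaf : IsLeaf H l) (hT : TreeRep₂ H (s.a 4) I)
    (hQ : ∀ s' : St, (∀ x, x < 30 → s'.v x = s.v x) → s'.a = s.a →
      s'.time ≤ s.time + 100 * ((H + 1) * (H + 1)) →
      IsBest (fun z => ∃ k' l', I k' l' z ∧ k' < k ∧ l' < l) (s'.v 32) → Q s') :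
    wp varSize arrSize M B query₂ Q s := by
  set J : ℕ → ℤ → Prop := fun k' z => ∃ l', I k' l' z ∧ l' < l with hJ
  unfold query₂
  simp +decide only [wp_seq, wp_assign, Expr.ok, Expr.eval, Expr.cost, true_and, true_or]
  refine wp_loop (fun m s' => (∀ x, x < 30 ∨ x = 31 → s'.v x = s.v x) ∧ s'.a = s.a ∧
    s'.time + m * (80 * (H + 1)) ≤ s.time + H * (80 * (H + 1)) + 10 ∧
    ∃ h, h + m = H ∧ s'.v 30 = (k / 2 ^ h : ℕ) ∧ IsBest (LeftOf J k h) (s'.v 32)) ?_ H ?_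
  · rintro m s' ⟨hv, hsa, htime, h, hm, h30, hbest⟩
    refine ⟨trivial, trivial, fun hlt => ?_, fun hge => ?_⟩
    · simp only [Expr.eval, h30] at hlt
      have h1 : 1 < k / 2 ^ h := by exact_mod_cast hlt
      have hh := hkleaf.lt_of_one_lt h1
      obtain ⟨m, rfl⟩ : ∃ m', m = m' + 1 := ⟨m - 1, by omega⟩
      refine ⟨m, rfl, ?_⟩
      rw [Nat.succ_mul] at htime
      have hdiv : ((k / 2 ^ h : ℕ) : ℤ) / 2 = (k / 2 ^ (h + 1) : ℕ) := by
        rw [div_pow_succ]; omega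
      have h31 : s'.v 31 = l := by rw [hv 31 (by omega), hl]
      have hf : ∀ x, x < 30 ∨ x = 31 → x ≠ 30 ∧ x ≠ 32 ∧ x ≠ 44 ∧ x ≠ 45 ∧ x < 44 :=
        fun x hx => by omega
      simp +decide only [wp_seq, wp_assign, wp_ite, wp_skip, Expr.ok, Expr.eval, Expr.cost,
        true_and, true_or, St.set_v, St.set_a, St.tick_v, St.tick_a, if_false, h30, h31]
      refine ⟨fun hodd => ?_, fun heven => ?_⟩
      · have hodd' : k / 2 ^ h % 2 = 1 := by
          clear hdiv; generalize k / 2 ^ h = p at hodd ⊢; omega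
        refine wp_query (t := k / 2 ^ h - 1) (l := l) (H := H) (I := Spread H I) (by norm_num) rfl
          ?_ ?_ ?_ hlleaf ?_ ?_
        · simp [hv 3 (by omega), hN]
        · simp [Nat.cast_sub h1.le]
        · simp
        · simpa [hsa] using hT.rep
        intro s₁ hv₁ ha₁ ht₁ hb₁
        -- The tree of a node collects items by node number, without regard to height. Since the
        -- number determines the height, it contains precisely the items below the left sibling.
        have hb₂ : IsBest (Below J h (k / 2 ^ h - 1)) (s₁.v 46) := by
          refine hb₁.congr fun z => ?_
          constructor
          · rintro ⟨k', ⟨l', hI, hl'⟩, he⟩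
            exact ⟨l', ⟨k', h, hh.le, he, hI⟩, hl'⟩
          · rintro ⟨l', ⟨k', h', hh', he, hI⟩, hl'⟩
            obtain rfl := hkleaf.height_eq (hT.leaf _ _ _ hI) hh' hodd' h1 he
            exact ⟨k', ⟨l', hI, hl'⟩, he⟩
        have hbest' := (hbest.sup hb₂).congr (leftOf_succ_of_odd hodd')
        have h30' : s₁.v 30 = (k / 2 ^ h : ℕ) := by rw [hv₁ 30 (by omega)]; simp [h30]
        have h32' : s₁.v 32 = s'.v 32 := by rw [hv₁ 32 (by omega)]; simp
        have hv' : ∀ x, x < 30 ∨ x = 31 → s₁.v x = s.v x := fun x hx => by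
          rw [hv₁ x (hf x hx).2.2.2.2]; simp [hf x hx, hv x hx]
        simp only [St.set_time, St.tick_time] at ht₁
        simp only [St.set_a, St.tick_a] at ha₁
        simp +decide only [wp_assign, wp_ite, wp_skip, Expr.ok, Expr.eval, Expr.cost,
          true_and, true_or, St.set_v, St.set_a, St.tick_v, St.tick_a, if_false, h30', h32', hdiv]
        refine ⟨fun hc => ⟨fun x hx => ?_, ha₁.trans hsa, ?_, h + 1, by omega, ?_, ?_⟩,
          fun hc => ⟨fun x hx => ?_, ha₁.trans hsa, ?_, h + 1, by omega, ?_, ?_⟩⟩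
        · simp [hf x hx, hv' x hx]
        · simp; omega
        · simp
        · rw [max_eq_right hc.le] at hbest'
          simpa using hbest'
        · simp [hf x hx, hv' x hx]
        · simp; omega
        · simp
        · rw [max_eq_left hc] at hbest'
          simpa [h32'] using hbest'
      · have heven' : k / 2 ^ h % 2 = 0 := by
          clear hdiv; generalize k / 2 ^ h = p at heven ⊢; omega
        refine ⟨fun x hx => ?_, hsa, ?_, h + 1, by omega, ?_, ?_⟩
        · simp [hf x hx, hv x hx]
        · simp; omega
        · simpa using hdiv
        · simpa using hbest.congr (leftOf_succ_of_even heven')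
    · simp only [Expr.eval, h30] at hge
      have hge' : k / 2 ^ h ≤ 1 := by exact_mod_cast hge
      have hh : h = H := by
        by_contra hne
        have e := hkleaf.log (h := h)
        have : Nat.log 2 (k / 2 ^ h) = 0 := by
          rw [Nat.log_eq_zero_iff]; omega
        omega
      subst hh
      refine hQ _ (fun x hx => hv x (Or.inl hx)) hsa ?_ (hbest.congr fun z => ?_)
      · simp only [Expr.cost, St.tick_time]
        nlinarith
      · constructor
        · rintro ⟨k', l', hI, h1, h2⟩
          refine ⟨k', ⟨l', hI, h2⟩, h1, ?_⟩
          rw [hkleaf.div_lt_two, (hT.leaf _ _ _ hI).div_lt_two]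
        · rintro ⟨k', ⟨l', hI, h2⟩, h1, -⟩
          exact ⟨k', l', hI, h1, h2⟩
  · refine ⟨fun x hx => ?_, rfl, ?_, 0, by omega, ?_, ?_⟩
    · simp [show x ≠ 32 by omega]
    · simp; omega
    · simp [hk]
    · refine ⟨by simp, ?_, by simp⟩
      rintro z ⟨k', hI, h1, h2⟩
      simp at h2; omega

/-- Insert the item `♯32` at the pair `(♯30, ♯31)`. -/
def insertItem₂ : Cmd :=
  .loop ♭0 ♯30
    (44 ≔ ♯30 ;; 45 ≔ ♯31 ;; 46 ≔ ♯32 ;; insertItem 4 ;; 30 ≔ ♯30 /. ♭2)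

/-- After all `H + 1` ancestors of `k` have been visited, the item has reached every tree in which
`Spread` expects it. -/
theorem wp_insertItem₂ {H : ℕ} {I : ℕ → ℕ → ℤ → Prop} {k l : ℕ} {z : ℤ} {Q : St → Prop} {s : St}
    (hN : s.v 3 = 2 ^ H) (hk : s.v 30 = k) (hl : s.v 31 = l) (hz : s.v 32 = z)
    (hkleaf : IsLeaf H k) (hlleaf : IsLeaf H l) (hT : TreeRep₂ H (s.a 4) I)
    (hQ : ∀ s' : St, (∀ x, x < 30 → s'.v x = s.v x) → (∀ b, b ≠ 4 → s'.a b = s.a b) →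
      s'.time ≤ s.time + 100 * ((H + 2) * (H + 2)) →
      TreeRep₂ H (s'.a 4) (fun k' l' y => I k' l' y ∨ k' = k ∧ l' = l ∧ y = z) → Q s') :
    wp varSize arrSize M B insertItem₂ Q s := by
  unfold insertItem₂
  refine wp_loop (fun m s' => (∀ x, x < 30 ∨ x = 31 ∨ x = 32 → s'.v x = s.v x) ∧
    (∀ b, b ≠ 4 → s'.a b = s.a b) ∧
    s'.time + m * (80 * (H + 2)) ≤ s.time + (H + 1) * (80 * (H + 2)) ∧
    ∃ h, h + m = H + 1 ∧ s'.v 30 = (k / 2 ^ h : ℕ) ∧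
      TreeRep H (cell H (s'.a 4)) (fun t l' y => Spread H I t l' y ∨
        (∃ g, g < h ∧ k / 2 ^ g = t) ∧ l' = l ∧ y = z)) ?_ (H + 1) ?_
  · rintro m s' ⟨hv, hsa, htime, h, hm, h30, hrep⟩
    refine ⟨trivial, trivial, fun hlt => ?_, fun hge => ?_⟩
    · simp only [Expr.eval, h30] at hlt
      have h1 : 0 < k / 2 ^ h := by exact_mod_cast hlt
      have hh : h ≤ H := by
        by_contra hh
        rw [Nat.div_eq_of_lt (hkleaf.2.trans_le (Nat.pow_le_pow_right (by norm_num) (by omega)))]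
          at h1
        omega
      obtain ⟨m, rfl⟩ : ∃ m', m = m' + 1 := ⟨m - 1, by omega⟩
      refine ⟨m, rfl, ?_⟩
      rw [Nat.succ_mul] at htime
      have hdiv : ((k / 2 ^ h : ℕ) : ℤ) / 2 = (k / 2 ^ (h + 1) : ℕ) := by
        rw [div_pow_succ]; omega
      have h31 : s'.v 31 = l := by rw [hv 31 (by omega), hl]
      have h32 : s'.v 32 = z := by rw [hv 32 (by omega), hz]
      simp +decide only [wp_seq, wp_assign, Expr.ok, Expr.eval, Expr.cost,
        true_and, true_or, St.set_v, St.tick_v, if_false, h30, h31, h32]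
      refine wp_insertItem (t := k / 2 ^ h) (l := l) (z := z) (H := H) (by norm_num) rfl
          ?_ ?_ ?_ ?_ hlleaf (by simpa using hrep) ?_
      · simp [hv 3 (by omega), hN]
      · simp
      · simp
      · simp
      intro s₁ hv₁ ha₁ ht₁ hrep₁
      have h30' : s₁.v 30 = (k / 2 ^ h : ℕ) := by rw [hv₁ 30 (by omega)]; simp [h30]
      simp only [St.set_time, St.tick_time] at ht₁
      simp only [St.set_a, St.tick_a] at ha₁
      simp +decide only [wp_assign, Expr.ok, Expr.eval, Expr.cost, true_and, true_or, h30', hdiv]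
      refine ⟨fun x hx => ?_, fun b hb => ?_, ?_, h + 1, by omega, ?_, ?_⟩
      · have hf : x ≠ 30 ∧ x ≠ 44 ∧ x ≠ 45 ∧ x ≠ 46 := by omega
        simp [hf, hv₁ x (by omega), hv x hx]
      · rw [St.set_a, ha₁ b hb, hsa b hb]
      · simp; omega
      · simp
      · refine hrep₁.congr fun t l' y => ?_
        constructor
        · rintro (hI | ⟨⟨g, hg, he⟩, h2, h3⟩)
          · exact Or.inl (Or.inl hI)
          · rcases Nat.lt_succ_iff_lt_or_eq.1 hg with hg | rfl
            · exact Or.inl (Or.inr ⟨⟨g, hg, he⟩, h2, h3⟩)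
            · exact Or.inr ⟨he.symm, h2, h3⟩
        · rintro ((hI | ⟨⟨g, hg, he⟩, h2, h3⟩) | ⟨he, h2, h3⟩)
          · exact Or.inl hI
          · exact Or.inr ⟨⟨g, hg.trans (Nat.lt_succ_self _), he⟩, h2, h3⟩
          · exact Or.inr ⟨⟨h, Nat.lt_succ_self _, he.symm⟩, h2, h3⟩
    · simp only [Expr.eval, h30] at hge
      have hge' : k / 2 ^ h = 0 := Nat.le_zero.1 (by exact_mod_cast hge)
      have hh : h = H + 1 := by
        by_contra hne
        have := hkleaf.div_pos (h := h) (by omega)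
        omega
      subst hh
      refine hQ _ (fun x hx => hv x (Or.inl hx)) hsa ?_ ⟨?_, hrep.congr fun t l' y => ?_⟩
      · simp only [Expr.cost, St.tick_time]
        nlinarith
      · rintro k' l' y (hI | ⟨rfl, -, -⟩)
        · exact hT.leaf _ _ _ hI
        · exact hkleaf
      · constructor
        · rintro ⟨k', g, hg, he, hI | ⟨rfl, h2, h3⟩⟩
          · exact Or.inl ⟨k', g, hg, he, hI⟩
          · exact Or.inr ⟨⟨g, by omega, he⟩, h2, h3⟩
        · rintro (⟨k', g, hg, he, hI⟩ | ⟨⟨g, hg, he⟩, h2, h3⟩)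
          · exact ⟨k', g, hg, he, Or.inl hI⟩
          · exact ⟨k, g, by omega, he, Or.inr ⟨rfl, h2, h3⟩⟩
  · refine ⟨fun _ _ => rfl, fun _ _ => rfl, by omega, 0, by omega, by simp [hk], ?_⟩
    exact hT.rep.congr fun t l' y => by simp

/-! ### Tournament trees -/

/-- Replace the entry of leaf `♯45` of array `2` by `♯48`. -/
def setLeaf : Cmd :=
  .store 2 ♯45 ♯48 ;; 45 ≔ ♯45 /. ♭2 ;;
  .loop ♭0 ♯45
    (.ite (.arr 2 (♭2 *. ♯45)) (.arr 2 (♭2 *. ♯45 +. ♭1))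
      (.store 2 ♯45 (.arr 2 (♭2 *. ♯45 +. ♭1)))
      (.store 2 ♯45 (.arr 2 (♭2 *. ♯45))) ;;
     45 ≔ ♯45 /. ♭2)

/-- Every inner node holds the maximum of its children. -/
def IsTournament (H : ℕ) (f : ℤ → ℤ) : Prop :=
  ∀ p : ℕ, 0 < p → p < 2 ^ H → f p = max (f (2 * p)) (f (2 * p + 1))

/-- Entries weakly increase from child to parent, and repeated halving ends at the root `1`. -/
theorem IsTournament.leaf_le {H : ℕ} {f : ℤ → ℤ} (hf : IsTournament H f) {l : ℕ} (hl : 0 < l)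
    (hl' : l < 2 ^ (H + 1)) : f l ≤ f 1 := by
  induction l using Nat.strong_induction_on with
  | _ l ih =>
    rcases Nat.eq_or_lt_of_le hl with h | h
    · rw [← h]; simp
    · refine le_trans ?_ (ih (l / 2) (by omega) (by omega) (by omega))
      rw [hf (l / 2) (by omega) (by rw [pow_succ] at hl'; omega)]
      rcases Nat.mod_two_eq_zero_or_one l with e | e
      · rw [show (2 * ((l / 2 : ℕ) : ℤ)) = l by omega]
        exact le_max_left _ _
      · rw [show (2 * ((l / 2 : ℕ) : ℤ) + 1) = l by omega]
        exact le_max_right _ _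

/-- Descend from the root, always to a child that attains the maximum. -/
theorem IsTournament.exists_leaf {H : ℕ} {f : ℤ → ℤ} (hf : IsTournament H f) :
    ∃ l, IsLeaf H l ∧ f l = f 1 := by
  have key : ∀ h, h ≤ H → ∃ l : ℕ, 2 ^ h ≤ l ∧ l < 2 ^ (h + 1) ∧ f l = f 1 := by
    intro h
    induction h with
    | zero => intro _; exact ⟨1, by simp⟩
    | succ h ih =>
      intro hh
      obtain ⟨l, h1, h2, h3⟩ := ih (by omega)
      have h4 : 2 ^ (h + 1) ≤ 2 ^ H := Nat.pow_le_pow_right (by norm_num) hh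
      have h5 : 0 < 2 ^ h := by positivity
      have := hf l (by omega) (by omega)
      rw [pow_succ] at h2
      rcases max_choice (f (2 * l)) (f (2 * l + 1)) with e | e
      · refine ⟨2 * l, by rw [pow_succ]; omega, by rw [pow_succ, pow_succ]; omega, ?_⟩
        push_cast
        rw [← e, ← this, h3]
      · refine ⟨2 * l + 1, by rw [pow_succ]; omega, by rw [pow_succ, pow_succ]; omega, ?_⟩
        push_cast
        rw [← e, ← this, h3]
  obtain ⟨l, h1, h2, h3⟩ := key H le_rfl
  exact ⟨l, ⟨h1, h2⟩, h3⟩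

/-- After the leaf is changed, the tournament property can fail at one inner node only, the node
`♯45`. Recomputing it moves the defect to its parent, until the number `0` is reached and no defect
is left. -/
theorem wp_setLeaf {H l : ℕ} {z : ℤ} {Q : St → Prop} {s : St} (hl : s.v 45 = l) (hz : s.v 48 = z)
    (hleaf : IsLeaf H l) (hT : IsTournament H (s.a 2))
    (hQ : ∀ s' : St, (∀ x, x < 44 → s'.v x = s.v x) → (∀ b, b ≠ 2 → s'.a b = s.a b) →
      s'.time ≤ s.time + 50 * (H + 2) → IsTournament H (s'.a 2) → s'.a 2 l = z →
      (∀ k : ℕ, IsLeaf H k → k ≠ l → s'.a 2 k = s.a 2 k) → Q s') :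
    wp varSize arrSize M B setLeaf Q s := by
  unfold setLeaf
  have hl2 : ((l : ℕ) : ℤ) / 2 = (l / 2 : ℕ) := by omega
  simp +decide only [wp_seq, wp_assign, wp_store, Expr.ok, Expr.eval, Expr.cost, true_and, true_or,
    hl, hz, hl2, St.put_v, false_imp_iff, Int.natCast_nonneg]
  have hlN := hleaf.1
  have hlN' : l < 2 * 2 ^ H := by have := hleaf.2; rw [pow_succ] at this; omega
  refine wp_loop (fun m s' => (∀ x, x ≠ 45 → s'.v x = s.v x) ∧
    (∀ b, b ≠ 2 → s'.a b = s.a b) ∧ s'.time + 50 * m ≤ s.time + 50 * H + 20 ∧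
    ∃ p : ℕ, s'.v 45 = p ∧ p < 2 ^ m ∧ m ≤ H ∧ s'.a 2 l = z ∧
      (∀ k : ℕ, IsLeaf H k → k ≠ l → s'.a 2 k = s.a 2 k) ∧
      ∀ q : ℕ, 0 < q → q < 2 ^ H → q ≠ p → s'.a 2 q = max (s'.a 2 (2 * q)) (s'.a 2 (2 * q + 1)))
    ?_ H ?_
  · rintro m s' ⟨hv, hsa, htime, p, h45, hpm, hmH, hal, hak, hint⟩
    refine ⟨trivial, trivial, fun hlt => ?_, fun hge => ?_⟩
    · simp only [Expr.eval, h45] at hlt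
      cases m with
      | zero => simp at hpm; omega
      | succ m =>
      refine ⟨m, rfl, ?_⟩
      rw [pow_succ] at hpm
      have hpH : p < 2 ^ H := by
        have : 2 ^ (m + 1) ≤ 2 ^ H := Nat.pow_le_pow_right (by norm_num) hmH
        rw [pow_succ] at this
        omega
      have hdiv : (p : ℤ) / 2 = (p / 2 : ℕ) := by omega
      have hne : ∀ k : ℕ, IsLeaf H k → (k : ℤ) ≠ p := by
        intro k hk he
        have := hk.1
        omega
      have i1 : (0 : ℤ) ≤ 2 * (p : ℤ) := by omega
      have i2 : (0 : ℤ) ≤ 2 * (p : ℤ) + 1 := by omega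
      -- Both outcomes of the comparison store the maximum of the children. The number of steps
      -- spent on the store does not affect variables or arrays, so any value may be put there.
      have hcommon : ∀ (w : ℤ) (n : ℕ), w = max (s'.a 2 (2 * p)) (s'.a 2 (2 * p + 1)) → n ≤ 45 →
          (∀ x, x ≠ 45 → (((s'.tick 5).put 2 p w n).set 45 ((p / 2 : ℕ) : ℤ) 4).v x = s.v x) ∧
          (∀ b, b ≠ 2 → ((s'.tick 5).put 2 p w n).a b = s.a b) ∧
          ∃ q : ℕ, ((p / 2 : ℕ) : ℤ) = q ∧ q < 2 ^ m ∧ m ≤ H ∧ ((s'.tick 5).put 2 p w n).a 2 l = z ∧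
            (∀ k : ℕ, IsLeaf H k → k ≠ l → ((s'.tick 5).put 2 p w n).a 2 k = s.a 2 k) ∧
            ∀ r : ℕ, 0 < r → r < 2 ^ H → r ≠ q → ((s'.tick 5).put 2 p w n).a 2 r =
              max (((s'.tick 5).put 2 p w n).a 2 (2 * r))
                (((s'.tick 5).put 2 p w n).a 2 (2 * r + 1)) := by
        intro w n hw hn
        refine ⟨fun x hx => by simp [hx, hv x hx], fun b hb => ?_, p / 2, rfl, by omega, by omega,
          ?_, fun k hk hkl => ?_, fun r hr hrH hrp => ?_⟩
        · rw [St.put_a_ne _ _ _ _ _ hb]; exact hsa b hb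
        · simp [hne l hleaf, hal]
        · simp [hne k hk, hak k hk hkl]
        · have e1 : (2 * (r : ℤ)) ≠ p := by omega
          have e2 : (2 * (r : ℤ) + 1) ≠ p := by omega
          simp only [St.put_a, if_true, if_neg e1, if_neg e2]
          by_cases hrp : r = p
          · subst hrp; simp [hw]
          · rw [if_neg (by exact_mod_cast hrp)]
            exact hint r hr hrH hrp
      simp +decide only [wp_seq, wp_assign, wp_ite, wp_store, Expr.ok, Expr.eval,
        Expr.cost, true_and, true_or, St.tick_v, St.tick_a, if_false, h45, hdiv, i1, i2,
        Int.natCast_nonneg, false_imp_iff, St.put_v]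
      refine ⟨fun hc => ?_, fun hc => ?_⟩
      · obtain ⟨c1, c2, c3⟩ := hcommon _ 0 (max_eq_right hc.le).symm (by norm_num)
        refine ⟨fun x hx => ?_, c2, ?_, ?_⟩
        · exact c1 x hx
        · simp; omega
        · simpa using c3
      · obtain ⟨c1, c2, c3⟩ := hcommon _ 0 (max_eq_left hc).symm (by norm_num)
        refine ⟨fun x hx => ?_, c2, ?_, ?_⟩
        · exact c1 x hx
        · simp; omega
        · simpa using c3
    · simp only [Expr.eval, h45] at hge
      refine hQ _ (fun x hx => hv x (by omega)) hsa ?_ (fun q hq hqH => hint q hq hqH (by omega))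
        hal hak
      simp [Expr.cost]; omega
  · refine ⟨fun x hx => ?_, fun b hb => ?_, ?_, l / 2, ?_, by omega, le_rfl, ?_, ?_, ?_⟩
    · simp [hx]
    · rw [St.set_a, St.put_a_ne _ _ _ _ _ hb]
    · simp; omega
    · simp
    · simp
    · intro k hk hkl
      simp [hkl]
    · intro q hq hqH hql
      have e1 : (q : ℤ) ≠ l := by omega
      have e2 : (2 * (q : ℤ)) ≠ l := by omega
      have e3 : (2 * (q : ℤ) + 1) ≠ l := by omega
      simp only [St.set_a, St.put_a, if_true, if_neg e1, if_neg e2, if_neg e3]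
      exact hT q hq hqH

end WordRAM

namespace WordRAM

variable {M B : ℤ}

/-! ### Parameters -/

/-- `N`, a power of two greater than `n + 1`, in variable `3`; the least `r ≥ 1` with
`n * q ≤ r * r * p` in variable `4`; a bound on the number of nodes in variable `6`. -/
def parameters : Cmd :=
  3 ≔ ♭1 ;;
  .loop ♯3 (♯0 +. ♭2) (3 ≔ ♯3 +. ♯3) ;;
  4 ≔ ♭1 ;;
  .loop (♯4 *. ♯4 *. ♯1) (♯0 *. ♯2) (4 ≔ ♯4 +. ♭1) ;;
  6 ≔ ♭2 *. ♯0 *. ♯4 +. ♭1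

/-- Linear search for `r` is affordable, since `r` also enters the cost of the main phases as a
factor. Minimality of `r` gives the strict inequality at `r - 1`, from which the running time is
bounded later. -/
theorem wp_parameters {n p q : ℕ} {Q : St → Prop} {s : St} (hM : 2 ≤ M) (h0 : s.v 0 = n)
    (h1 : s.v 1 = p) (h2 : s.v 2 = q) (hp : 0 < p) (hq : 0 < q) (hn : 0 < n) (hnM : (n : ℤ) < M)
    (hqM : (q : ℤ) < M)
    (hQ : ∀ (s' : St) (H r : ℕ), s'.v 0 = n → s'.a = s.a → s'.v 3 = 2 ^ H → n + 2 ≤ 2 ^ H →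
      2 ^ H ≤ 2 * (n + 1) → 0 < r → s'.v 4 = r → s'.v 6 = 2 * n * r + 1 → n * q ≤ r * r * p →
      (r - 1) * (r - 1) * p < n * q → s'.time ≤ s.time + 20 * (H + r + 2) → Q s') :
    wp varSize arrSize M B parameters Q s := by
  unfold parameters
  simp +decide only [wp_seq, wp_assign, Expr.ok, Expr.eval, Expr.cost, true_and, true_or]
  set H := Nat.clog 2 (n + 2) with hH
  have hlt : ∀ h, 2 ^ h < n + 2 ↔ h < H := fun h =>
    (Nat.lt_clog_iff_pow_lt (by norm_num)).symm
  have hHpos : 0 < H := (hlt 0).1 (by simp; omega)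
  -- The choice `n * q` works because `n * q ≤ (n * q) ^ 2 * p` for positive integers.
  have hex : ∃ r, 0 < r ∧ n * q ≤ r * r * p := ⟨n * q, by positivity, by nlinarith [Nat.mul_pos hn hq]⟩
  classical
  set r := Nat.find hex with hr
  obtain ⟨hr1, hr2⟩ := Nat.find_spec hex
  rw [← hr] at hr1 hr2
  have hrlt : ∀ j, 0 < j → j < r → j * j * p < n * q := by
    intro j hj hjr
    have := Nat.find_min hex hjr
    push Not at this
    exact this hj
  refine wp_loop (fun k s' => (∀ x, x ≠ 3 → s'.v x = s.v x) ∧ s'.a = s.a ∧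
    s'.time + 20 * k ≤ s.time + 20 * H + 2 ∧ ∃ h, h + k = H ∧ s'.v 3 = (2 ^ h : ℕ)) ?_ H ?_
  · rintro k s' ⟨hv, hsa, htime, h, hk, h3⟩
    have h0' : s'.v 0 = n := by rw [hv 0 (by omega), h0]
    refine ⟨trivial, ⟨trivial, trivial⟩, fun hc => ?_, fun hc => ?_⟩
    · simp only [Expr.eval, h3, h0'] at hc
      have hc' : 2 ^ h < n + 2 := by exact_mod_cast hc
      have hh := (hlt h).1 hc'
      obtain ⟨k, rfl⟩ : ∃ k', k = k' + 1 := ⟨k - 1, by omega⟩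
      refine ⟨k, rfl, ?_⟩
      simp only [wp_assign, Expr.ok, Expr.eval, Expr.cost, true_and, St.tick_v, h3]
      refine ⟨Or.inr ?_, fun x hx => by simp [hx, hv x hx], hsa, ?_, h + 1, by omega, ?_⟩
      · have e1 : ((2 ^ h : ℕ) : ℤ) ≤ n + 1 := by omega
        have e2 : M * 2 * 2 ≤ M ^ 3 := by
          have e3 : 0 ≤ M * M - 4 := by nlinarith
          have e4 : 0 ≤ M := by omega
          nlinarith [mul_nonneg e4 e3]
        rw [abs_of_nonneg (by positivity)]
        show _ ≤ M ^ 3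
        omega
      · simp; omega
      · simp [pow_succ]; ring
    · simp only [Expr.eval, h3, h0'] at hc
      have hNle : n + 2 ≤ 2 ^ h := by exact_mod_cast hc
      have hh : ¬ h < H := fun hh => absurd ((hlt h).2 hh) (by omega)
      obtain rfl : h = H := by omega
      simp +decide only [wp_seq, wp_assign, Expr.ok, Expr.eval, Expr.cost, true_and, true_or]
      refine wp_loop (fun k s'' => (∀ x, x ≠ 4 → s''.v x = s'.v x) ∧ s''.a = s'.a ∧
        s''.time + 20 * k ≤ s'.time + 20 * r + 8 ∧ ∃ j : ℕ, j + k = r ∧ 0 < j ∧ s''.v 4 = j)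
        ?_ (r - 1) ?_
      · rintro k s'' ⟨hv', hsa', htime', j, hjk, hj, h4⟩
        have h0'' : s''.v 0 = n := by rw [hv' 0 (by omega), h0']
        have h1'' : s''.v 1 = p := by rw [hv' 1 (by omega), hv 1 (by omega), h1]
        have h2'' : s''.v 2 = q := by rw [hv' 2 (by omega), hv 2 (by omega), h2]
        refine ⟨⟨⟨trivial, trivial⟩, trivial⟩, ⟨trivial, trivial⟩, fun hc => ?_, fun hc => ?_⟩
        · simp only [Expr.eval, h4, h0'', h1'', h2''] at hc
          have hc' : j * j * p < n * q := by exact_mod_cast hc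
          have hjr : j < r := by
            by_contra hjr
            obtain rfl : j = r := by omega
            omega
          obtain ⟨k, rfl⟩ : ∃ k', k = k' + 1 := ⟨k - 1, by omega⟩
          refine ⟨k, rfl, ?_⟩
          simp only [wp_assign, Expr.ok, Expr.eval, Expr.cost, true_and, St.tick_v, h4]
          refine ⟨Or.inr ?_, fun x hx => by simp [hx, hv' x hx], hsa', ?_, j + 1, by omega,
            by omega, ?_⟩
          · have e1 : j ≤ j * j * p := by
              rw [mul_assoc]; exact Nat.le_mul_of_pos_right j (Nat.mul_pos hj hp)
            have e2 : (n : ℤ) * q ≤ M * M :=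
              mul_le_mul hnM.le hqM.le (by positivity) (by omega)
            have e3 : (j : ℤ) < n * q := by exact_mod_cast e1.trans_lt hc'
            rw [abs_of_nonneg (by positivity)]
            show _ ≤ M ^ 2
            rw [pow_two]; omega
          · simp; omega
          · simp
        · simp only [Expr.eval, h4, h0'', h1'', h2''] at hc
          have hc' : n * q ≤ j * j * p := by exact_mod_cast hc
          have hjr : ¬ j < r := fun hjr => absurd (hrlt j hj hjr) (by omega)
          obtain rfl : j = r := by omega
          simp +decide only [wp_assign, Expr.ok, Expr.eval, Expr.cost, true_and, true_or,
            St.tick_v, h0'', h4]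
          refine hQ _ H r (by simp [h0'']) (hsa'.trans hsa) ?_ hNle ?_ hr1
            (by simp [h4]) (by simp) hr2 ?_ ?_
          · simp [hv' 3 (by omega), h3]
          -- Minimality of the exponent: half of `2 ^ H` is still below `n + 2`.
          · have e := (hlt (H - 1)).2 (by omega)
            have e2 : 2 ^ H = 2 * 2 ^ (H - 1) := by
              rw [← pow_succ', Nat.sub_add_cancel hHpos]
            omega
          · rcases Nat.lt_or_ge 1 r with hj1 | hj1
            · exact hrlt (r - 1) (by omega) (by omega)
            · rw [show r - 1 = 0 by omega, zero_mul, zero_mul]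
              positivity
          · simp; omega
      · refine ⟨fun x hx => by simp [hx], rfl, ?_, 1, by omega, by omega, ?_⟩
        · simp; omega
        · simp
  · refine ⟨fun x hx => by simp [hx], rfl, ?_, 0, by omega, ?_⟩
    · simp; omega
    · simp

/-! ### Sorting -/

/-- An upper bound on the entries of `Y` in variable `18`. -/
def upperBound : Cmd :=
  18 ≔ ♭0 ;; 10 ≔ ♭0 ;;
  .loop ♯10 ♯0
    (.ite ♯18 (.arr 0 (♯0 +. ♯10)) (18 ≔ .arr 0 (♯0 +. ♯10)) .skip ;;
     10 ≔ ♯10 +. ♭1)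

theorem wp_upperBound {n : ℕ} {Q : St → Prop} {s : St} (h0 : s.v 0 = n) (hnM : (n : ℤ) < M)
    (hB : B = 2 * n)
    (hQ : ∀ s' : St, (∀ x, x < 10 → s'.v x = s.v x) → s'.a = s.a →
      (∀ j : ℕ, j < n → s.a 0 (n + j) ≤ s'.v 18) → s'.time ≤ s.time + 40 * (n + 1) → Q s') :
    wp varSize arrSize M B upperBound Q s := by
  unfold upperBound
  simp +decide only [wp_seq, wp_assign, Expr.ok, Expr.eval, Expr.cost, true_and, true_or]
  refine wp_loop (fun k s' => (∀ x, x < 10 → s'.v x = s.v x) ∧ s'.a = s.a ∧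
    s'.time + 40 * k ≤ s.time + 40 * n + 4 ∧ ∃ i : ℕ, i + k = n ∧ s'.v 10 = i ∧
      (∀ j : ℕ, j < i → s.a 0 (n + j) ≤ s'.v 18)) ?_ n ?_
  · rintro k s' ⟨hv, hsa, htime, i, hik, h10, hub⟩
    have h0' : s'.v 0 = n := by rw [hv 0 (by omega), h0]
    refine ⟨trivial, trivial, fun hc => ?_, fun hc => ?_⟩
    · simp only [Expr.eval, h10, h0'] at hc
      obtain ⟨k, rfl⟩ : ∃ k', k = k' + 1 := ⟨k - 1, by omega⟩
      refine ⟨k, rfl, ?_⟩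
      have i1 : 0 ≤ (n : ℤ) + i := by positivity
      have i2 : (n : ℤ) + i < B := by omega
      have i3 : |(i : ℤ) + 1| ≤ M ^ varSize 10 := by
        rw [abs_of_nonneg (by positivity)]; norm_num [varSize]; omega
      have hf : ∀ x, x < 10 → x ≠ 10 ∧ x ≠ 18 := fun x hx => by omega
      simp +decide only [wp_seq, wp_assign, wp_ite, wp_skip, Expr.ok, Expr.eval, Expr.cost,
        true_and, true_or, St.set_v, St.set_a, St.tick_v, St.tick_a, if_false, if_true, h0', h10, i1, i2, i3,
        or_true, true_imp_iff, hsa]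
      refine ⟨fun hc => ⟨fun x hx => ?_, ?_, i + 1, by omega, ?_, fun j hj => ?_⟩,
        fun hc => ⟨fun x hx => ?_, ?_, i + 1, by omega, ?_, fun j hj => ?_⟩⟩
      · simp [hf x hx, hv x hx]
      · simp; omega
      · simp
      · rcases Nat.lt_succ_iff_lt_or_eq.1 hj with hj | rfl
        · exact (hub j hj).trans hc.le
        · exact le_rfl
      · simp [hf x hx, hv x hx]
      · simp; omega
      · simp
      · rcases Nat.lt_succ_iff_lt_or_eq.1 hj with hj | rfl
        · exact hub j hj
        · exact hc
    · simp only [Expr.eval, h10, h0'] at hc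
      obtain rfl : i = n := by omega
      exact hQ _ hv hsa hub (by simp [Expr.cost]; omega)
  · refine ⟨fun x hx => ?_, rfl, ?_, 0, by omega, by simp, by simp⟩
    · simp [show x ≠ 10 by omega, show x ≠ 18 by omega]
    · simp; omega

/-- Enter the numbers `Y j * n + j`, subtracted from a bound `♯5`, into the tournament. -/
def fill : Cmd :=
  5 ≔ ♯18 *. ♯0 +. ♯0 ;; 10 ≔ ♭0 ;;
  .loop ♯10 ♯0
    (45 ≔ ♯3 +. ♯10 ;; 48 ≔ ♯5 -. (.arr 0 (♯0 +. ♯10) *. ♯0 +. ♯10) ;; setLeaf ;;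
     10 ≔ ♯10 +. ♭1)

theorem isLeaf_add {H n j : ℕ} (hH : n + 2 ≤ 2 ^ H) (hj : j ≤ n + 1) : IsLeaf H (2 ^ H + j) :=
  ⟨by omega, by rw [pow_succ]; omega⟩

/-- Subtraction from a common upper bound turns the smallest key into the largest entry and makes
the entries of genuine keys positive, so that `0` can mark an absent leaf. The array of zeros is a
tournament to begin with. -/
theorem wp_fill {n H : ℕ} {Q : St → Prop} {s : St} (h0 : s.v 0 = n) (hnM : (n : ℤ) < M)
    (h3 : s.v 3 = 2 ^ H) (hH : n + 2 ≤ 2 ^ H) (hB : B = 2 * n) (ha2 : ∀ i, s.a 2 i = 0)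
    (hQ : ∀ s' : St, (∀ x, x < 10 → x ≠ 5 → s'.v x = s.v x) → s'.v 5 = s.v 18 * n + n →
      (∀ b, b ≠ 2 → s'.a b = s.a b) → IsTournament H (s'.a 2) →
      (∀ j : ℕ, j < n →
        s'.a 2 (2 ^ H + j : ℕ) = s.v 18 * n + n - (s.a 0 (n + j) * n + j)) →
      (∀ j : ℕ, n ≤ j → j < 2 ^ H → s'.a 2 (2 ^ H + j : ℕ) = 0) →
      s'.time ≤ s.time + 80 * (H + 2) * (n + 1) → Q s') :
    wp varSize arrSize M B fill Q s := by
  unfold fill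
  simp +decide only [wp_seq, wp_assign, Expr.ok, Expr.eval, Expr.cost, true_and, true_or,
    h0]
  refine wp_loop (fun k s' => (∀ x, x < 10 → x ≠ 5 → s'.v x = s.v x) ∧
    s'.v 5 = s.v 18 * n + n ∧ (∀ b, b ≠ 2 → s'.a b = s.a b) ∧ IsTournament H (s'.a 2) ∧
    s'.time + k * (80 * (H + 2)) ≤ s.time + n * (80 * (H + 2)) + 8 ∧
    ∃ i : ℕ, i + k = n ∧ s'.v 10 = i ∧
      (∀ j : ℕ, j < i →
        s'.a 2 (2 ^ H + j : ℕ) = s.v 18 * n + n - (s.a 0 (n + j) * n + j)) ∧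
      (∀ j : ℕ, i ≤ j → j < 2 ^ H → s'.a 2 (2 ^ H + j : ℕ) = 0)) ?_ n ?_
  · rintro k s' ⟨hv, h5, hsa, hT, htime, i, hik, h10, hleaf, hleaf'⟩
    have h0' : s'.v 0 = n := by rw [hv 0 (by omega) (by omega), h0]
    have h3' : s'.v 3 = 2 ^ H := by rw [hv 3 (by omega) (by omega), h3]
    refine ⟨trivial, trivial, fun hc => ?_, fun hc => ?_⟩
    · simp only [Expr.eval, h10, h0'] at hc
      obtain ⟨k, rfl⟩ : ∃ k', k = k' + 1 := ⟨k - 1, by omega⟩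
      refine ⟨k, rfl, ?_⟩
      rw [Nat.succ_mul] at htime
      have i1 : 0 ≤ (n : ℤ) + i := by positivity
      have i2 : (n : ℤ) + i < B := by omega
      have i3 : |(i : ℤ) + 1| ≤ M ^ varSize 10 := by
        rw [abs_of_nonneg (by positivity)]; norm_num [varSize]; omega
      have hf : ∀ x, x < 10 → x ≠ 10 ∧ x ≠ 45 ∧ x ≠ 48 := fun x hx => by omega
      simp +decide only [wp_seq, wp_assign, Expr.ok, Expr.eval, Expr.cost,
        true_and, true_or, St.set_v, St.set_a, St.tick_v, St.tick_a, if_false, if_true, h0', h10, h3', h5,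
        i1, i2, true_imp_iff]
      refine wp_setLeaf (l := 2 ^ H + i)
        (z := s.v 18 * n + n - (s'.a 0 (n + i) * n + i)) (by simp) (by simp) (isLeaf_add hH (by omega))
        (by simpa using hT) ?_
      intro s₁ hv₁ ha₁ ht₁ hT₁ hl₁ hk₁
      simp only [St.set_time, St.tick_time] at ht₁
      simp only [St.set_a, St.tick_a] at ha₁ hk₁
      have h10' : s₁.v 10 = i := by rw [hv₁ 10 (by omega)]; simp [h10]
      have h5' : s₁.v 5 = s.v 18 * n + n := by rw [hv₁ 5 (by omega)]; simp [h5]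
      simp +decide only [wp_assign, Expr.ok, Expr.eval, Expr.cost, true_and, h10', i3, or_true]
      refine ⟨fun x hx hx5 => ?_, by simpa using h5', fun b hb => ?_, hT₁, ?_, i + 1, by omega,
        by simp, fun j hj => ?_, fun j hj hjH => ?_⟩
      · simp [hf x hx, hv₁ x (by omega), hv x hx hx5]
      · rw [St.set_a, ha₁ b hb, hsa b hb]
      · simp; omega
      · rcases Nat.lt_succ_iff_lt_or_eq.1 hj with hj | rfl
        · rw [St.set_a, hk₁ _ (isLeaf_add hH (by omega)) (by omega), hleaf j hj]
        · rw [St.set_a, hl₁, hsa 0 (by norm_num)]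
      · rw [St.set_a, hk₁ _ ⟨by omega, by rw [pow_succ]; omega⟩ (by omega),
          hleaf' j (by omega) hjH]
    · simp only [Expr.eval, h10, h0'] at hc
      obtain rfl : i = n := by omega
      refine hQ _ hv h5 hsa hT hleaf hleaf' ?_
      simp only [St.tick_time, Expr.cost]
      nlinarith
  · refine ⟨fun x hx hx5 => ?_, by simp, fun _ _ => rfl, ?_, ?_, 0, by omega, by simp, by simp,
      fun j _ _ => ha2 _⟩
    · simp [show x ≠ 10 by omega, hx5]
    · intro p _ _
      simp [ha2]
    · simp; omega

/-- Extract the entries of the tournament in order and write them to array `1`. -/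
def extract : Cmd :=
  10 ≔ ♭0 ;;
  .loop ♯10 ♯0
    (19 ≔ ♯5 -. .arr 2 ♭1 ;; .store 1 ♯10 ♯19 ;;
     45 ≔ ♯3 +. (♯19 -. (♯19 /. ♯0) *. ♯0) ;; 48 ≔ ♭0 ;; setLeaf ;;
     10 ≔ ♯10 +. ♭1)

/-- `S` lists the numbers `y j * n + j` with `j < n` in increasing order. -/
structure IsSorted (n : ℕ) (y S : ℕ → ℤ) : Prop where
  lt : ∀ k l, k < l → l < n → S k < S l
  mem : ∀ k, k < n → ∃ j : ℕ, j < n ∧ S k = y j * n + j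
  exists_eq : ∀ j : ℕ, j < n → ∃ k, k < n ∧ S k = y j * n + j

/-- Selection sort with the tournament: `R` is the set of indices already removed. The keys written
so far are increasing and lie below all remaining keys, and the root belongs to the smallest
remaining one. -/
theorem wp_extract {n H : ℕ} {y : ℕ → ℤ} {off : ℤ} {Q : St → Prop} {s : St} (h0 : s.v 0 = n)
    (hnM : (n : ℤ) < M) (h3 : s.v 3 = 2 ^ H) (hH : n + 2 ≤ 2 ^ H) (h5 : s.v 5 = off)
    (hoff : ∀ j : ℕ, j < n → y j * n + j < off) (hT : IsTournament H (s.a 2))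
    (hfill : ∀ j : ℕ, j < n → s.a 2 (2 ^ H + j : ℕ) = off - (y j * n + j))
    (hfill' : ∀ j : ℕ, n ≤ j → j < 2 ^ H → s.a 2 (2 ^ H + j : ℕ) = 0)
    (hQ : ∀ s' : St, (∀ x, x < 10 → s'.v x = s.v x) → (∀ b, b ≠ 1 → b ≠ 2 → s'.a b = s.a b) →
      IsSorted n y (fun k => s'.a 1 k) → s'.time ≤ s.time + 100 * (H + 2) * (n + 1) → Q s') :
    wp varSize arrSize M B extract Q s := by
  unfold extract
  simp +decide only [wp_seq, wp_assign, Expr.ok, Expr.eval, Expr.cost, true_and, true_or]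
  refine wp_loop (fun k s' => (∀ x, x < 10 → s'.v x = s.v x) ∧
    (∀ b, b ≠ 1 → b ≠ 2 → s'.a b = s.a b) ∧ IsTournament H (s'.a 2) ∧
    s'.time + k * (100 * (H + 2)) ≤ s.time + n * (100 * (H + 2)) + 2 ∧
    ∃ (i : ℕ) (R : Finset ℕ), i + k = n ∧ s'.v 10 = i ∧ R ⊆ Finset.range n ∧ R.card = i ∧
      (∀ j : ℕ, j < n → s'.a 2 (2 ^ H + j : ℕ) = if j ∈ R then 0 else off - (y j * n + j)) ∧
      (∀ j : ℕ, n ≤ j → j < 2 ^ H → s'.a 2 (2 ^ H + j : ℕ) = 0) ∧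
      (∀ k l : ℕ, k < l → l < i → s'.a 1 k < s'.a 1 l) ∧
      (∀ k : ℕ, k < i → ∃ j : ℕ, j ∈ R ∧ s'.a 1 k = y j * n + j) ∧
      (∀ j : ℕ, j ∈ R → ∃ k : ℕ, k < i ∧ s'.a 1 k = y j * n + j) ∧
      (∀ j : ℕ, j < n → j ∉ R → ∀ k : ℕ, k < i → s'.a 1 k < y j * n + j)) ?_ n ?_
  · rintro k s' ⟨hv, hsa, hT, htime, i, R, hik, h10, hR, hRi, hleaf, hleaf', hS1, hS2, hS3, hS4⟩
    have h0' : s'.v 0 = n := by rw [hv 0 (by omega), h0]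
    have h3' : s'.v 3 = 2 ^ H := by rw [hv 3 (by omega), h3]
    have h5' : s'.v 5 = off := by rw [hv 5 (by omega), h5]
    refine ⟨trivial, trivial, fun hc => ?_, fun hc => ?_⟩
    · simp only [Expr.eval, h10, h0'] at hc
      obtain ⟨k, rfl⟩ : ∃ k', k = k' + 1 := ⟨k - 1, by omega⟩
      refine ⟨k, rfl, ?_⟩
      rw [Nat.succ_mul] at htime
      have i3 : |(i : ℤ) + 1| ≤ M ^ varSize 10 := by
        rw [abs_of_nonneg (by positivity)]; norm_num [varSize]; omega
      have hf : ∀ x, x < 10 → x ≠ 10 ∧ x ≠ 19 ∧ x ≠ 45 ∧ x ≠ 48 ∧ x < 44 := fun x hx => by omega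
      -- the root of the tournament
      obtain ⟨j, hjn, hjR, hroot⟩ : ∃ j : ℕ, j < n ∧ j ∉ R ∧ s'.a 2 1 = off - (y j * n + j) := by
        obtain ⟨j, hj, hjR⟩ : ∃ j ∈ Finset.range n, j ∉ R := by
          by_contra hcon
          push Not at hcon
          have := Finset.card_le_card (show Finset.range n ⊆ R from hcon)
          rw [Finset.card_range] at this
          omega
        rw [Finset.mem_range] at hj
        have hpos : 0 < s'.a 2 1 := by
          have e1 := hT.leaf_le (l := 2 ^ H + j) (by omega) (by rw [pow_succ]; omega)
          rw [hleaf j hj, if_neg hjR] at e1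
          have := hoff j hj
          omega
        obtain ⟨l, hl, he⟩ := hT.exists_leaf
        obtain ⟨m, rfl⟩ : ∃ m, l = 2 ^ H + m := ⟨l - 2 ^ H, by have := hl.1; omega⟩
        have hm := hl.2
        rw [pow_succ] at hm
        rcases Nat.lt_or_ge m n with hmn | hmn
        · rw [hleaf m hmn] at he
          split_ifs at he with hmR
          · omega
          · exact ⟨m, hmn, hmR, he.symm⟩
        · rw [hleaf' m hmn (by omega)] at he
          omega
      have hmin : ∀ m : ℕ, m < n → m ∉ R → y j * n + j ≤ y m * n + m := by
        intro m hm hmR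
        have e1 := hT.leaf_le (l := 2 ^ H + m) (by omega) (by rw [pow_succ]; omega)
        rw [hleaf m hm, if_neg hmR, hroot] at e1
        omega
      have hK : off - (off - (y j * n + j)) = y j * n + j := by ring
      -- As `0 ≤ j < n`, division of the key by `n` separates value and index; the index tells which
      -- leaf to erase.
      have hdiv : (y j * n + j) / (n : ℤ) = y j := by
        rw [add_comm, Int.add_mul_ediv_right _ _ (by omega),
          Int.ediv_eq_zero_of_lt (by omega) (by omega), zero_add]
      have hmod : y j * n + j - y j * n = j := by ring
      simp +decide only [wp_seq, wp_assign, wp_store, Expr.ok, Expr.eval, Expr.cost,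
        true_and, true_or, St.set_v, St.put_v, St.tick_v, St.tick_a, if_false, if_true, h0', h10,
        h3', h5', false_imp_iff, hroot, hK, hdiv, hmod, Int.natCast_nonneg]
      refine wp_setLeaf (l := 2 ^ H + j) (z := 0) (by simp) (by simp) (isLeaf_add hH (by omega))
        (by simpa [St.put_a_ne] using hT) ?_
      intro s₁ hv₁ ha₁ ht₁ hT₁ hl₁ hk₁
      simp only [St.set_time, St.tick_time, St.put_time] at ht₁
      simp only [St.set_a] at ha₁ hk₁
      have h10' : s₁.v 10 = i := by rw [hv₁ 10 (by omega)]; simp [h10]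
      have hS : ∀ k : ℕ, s₁.a 1 k = if k = i then y j * n + j else s'.a 1 k := by
        intro k
        rw [ha₁ 1 (by norm_num)]
        simp
      have hSlt : ∀ k : ℕ, k < i → s₁.a 1 k = s'.a 1 k := fun k hk => by
        rw [hS, if_neg (by omega)]
      have hSi : s₁.a 1 i = y j * n + j := by rw [hS, if_pos rfl]
      simp +decide only [wp_assign, Expr.ok, Expr.eval, Expr.cost, true_and, h10', i3, or_true]
      refine ⟨fun x hx => ?_, fun b hb hb' => ?_, hT₁, ?_, i + 1, insert j R, by omega, by simp,
        ?_, ?_, fun m hm => ?_, fun m hm hmH => ?_, fun k l hkl hl => ?_, fun k hk => ?_,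
        fun m hm => ?_, fun m hm hmR k hk => ?_⟩
      · rw [St.set_v, if_neg (hf x hx).1, hv₁ x (by omega)]
        simp [hf x hx, hv x hx]
      · rw [St.set_a, ha₁ b hb', St.put_a_ne _ _ _ _ _ hb, St.set_a, St.tick_a, hsa b hb hb']
      · simp; omega
      · exact Finset.insert_subset (Finset.mem_range.2 hjn) hR
      · rw [Finset.card_insert_of_notMem hjR, hRi]
      · rw [St.set_a]
        by_cases hmj : m = j
        · subst hmj
          rw [hl₁, if_pos (Finset.mem_insert_self _ _)]
        · rw [hk₁ _ (isLeaf_add hH (by omega)) (by omega), St.put_a_ne _ _ _ _ _ (by norm_num),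
            St.set_a, St.tick_a, hleaf m hm]
          simp [hmj]
      · rw [St.set_a, hk₁ _ ⟨by omega, by rw [pow_succ]; omega⟩ (by omega),
          St.put_a_ne _ _ _ _ _ (by norm_num), St.set_a, St.tick_a, hleaf' m hm hmH]
      · rw [St.set_a, hSlt k (by omega)]
        rcases Nat.lt_succ_iff_lt_or_eq.1 hl with hl | rfl
        · rw [hSlt l hl]; exact hS1 k l hkl hl
        · rw [hSi]; exact hS4 j hjn hjR k hkl
      · rw [St.set_a]
        rcases Nat.lt_succ_iff_lt_or_eq.1 hk with hk | rfl
        · rw [hSlt k hk]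
          obtain ⟨m, hm, he⟩ := hS2 k hk
          exact ⟨m, Finset.mem_insert_of_mem hm, he⟩
        · exact ⟨j, Finset.mem_insert_self _ _, hSi⟩
      · rw [St.set_a]
        rcases Finset.mem_insert.1 hm with rfl | hm
        · exact ⟨i, by omega, hSi⟩
        · obtain ⟨k, hk, he⟩ := hS3 m hm
          exact ⟨k, by omega, by rw [hSlt k hk, he]⟩
      · rw [Finset.mem_insert, not_or] at hmR
        rw [St.set_a]
        rcases Nat.lt_succ_iff_lt_or_eq.1 hk with hk | rfl
        · rw [hSlt k hk]; exact hS4 m hm hmR.2 k hk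
        · rw [hSi]
          -- Equal keys have equal remainders modulo `n`, hence the same index. So the order is
          -- strict even if values of `Y` repeat.
          refine lt_of_le_of_ne (hmin m hm hmR.2) fun he => hmR.1 ?_
          have e1 := congrArg (· % (n : ℤ)) he
          simp only [Int.mul_add_emod_self_right] at e1
          rw [Int.emod_eq_of_lt (by omega) (by omega), Int.emod_eq_of_lt (by omega) (by omega)] at e1
          omega
    · simp only [Expr.eval, h10, h0'] at hc
      obtain rfl : i = n := by omega
      have hRn : R = Finset.range i := Finset.eq_of_subset_of_card_le hR (by simp [hRi])
      refine hQ _ hv hsa ⟨hS1, fun k hk => ?_, fun j hj => hS3 j (by simpa [hRn] using hj)⟩ ?_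
      · obtain ⟨j, hj, he⟩ := hS2 k hk
        exact ⟨j, by simpa [hRn] using hj, he⟩
      · simp only [St.tick_time, Expr.cost]
        nlinarith
  · refine ⟨fun x hx => ?_, fun _ _ _ => rfl, hT, ?_, 0, ∅, by omega, by simp, by simp, by simp,
      fun j hj => ?_, hfill', by simp, by simp, by simp, by simp⟩
    · simp [show x ≠ 10 by omega]
    · simp; omega
    · simpa using hfill j hj

end WordRAM

/-! ### Common increasing subsequences of prefixes -/

/-- `Z` is an increasing common subsequence of the first `i` elements of `X` and the first `c`
elements of `Y`. -/
structure IsPrefixCIS (X Y : List ℤ) (i c : ℕ) (Z : List ℤ) : Prop where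
  pairwise : Z.Pairwise (· < ·)
  left : Z.Sublist (X.take i)
  right : Z.Sublist (Y.take c)

namespace IsPrefixCIS

variable {X Y Z : List ℤ} {i i' c c' : ℕ}

theorem nil : IsPrefixCIS X Y i c [] := ⟨.nil, List.nil_sublist _, List.nil_sublist _⟩

theorem mono (h : IsPrefixCIS X Y i c Z) (hi : i ≤ i') (hc : c ≤ c') :
    IsPrefixCIS X Y i' c' Z :=
  ⟨h.pairwise, h.left.trans (List.take_sublist_take_left hi),
    h.right.trans (List.take_sublist_take_left hc)⟩

theorem isCommonIncSubseq (h : IsPrefixCIS X Y i c Z) : IsCommonIncSubseq Z X Y :=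
  ⟨h.pairwise, h.left.trans (List.take_sublist _ _), h.right.trans (List.take_sublist _ _)⟩

theorem length_le (h : IsPrefixCIS X Y i c Z) : Z.length ≤ X.length :=
  h.isCommonIncSubseq.2.1.length_le

theorem of_isCommonIncSubseq (h : IsCommonIncSubseq Z X Y) (hi : X.length ≤ i)
    (hc : Y.length ≤ c) : IsPrefixCIS X Y i c Z :=
  ⟨h.1, by rw [List.take_of_length_le hi]; exact h.2.1,
    by rw [List.take_of_length_le hc]; exact h.2.2⟩

end IsPrefixCIS

theorem List.take_succ_eq_append_getD {X : List ℤ} {i : ℕ} (hi : i < X.length) :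
    X.take (i + 1) = X.take i ++ [X.getD i 0] := by
  rw [List.take_succ_eq_append_getElem hi, List.getD_eq_getElem _ _ hi]

theorem IsPrefixCIS.snoc {X Y Z : List ℤ} {i c j : ℕ} {v : ℤ} (h : IsPrefixCIS X Y i c Z)
    (hi : i < X.length) (hv : X.getD i 0 = v) (hcj : c ≤ j) (hj : j < Y.length)
    (hw : Y.getD j 0 = v) (hlt : ∀ z ∈ Z, z < v) :
    IsPrefixCIS X Y (i + 1) (j + 1) (Z ++ [v]) := by
  refine ⟨?_, ?_, ?_⟩
  · rw [List.pairwise_append]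
    exact ⟨h.pairwise, List.pairwise_singleton _ _, by simpa using hlt⟩
  · rw [List.take_succ_eq_append_getD hi, hv]
    exact h.left.append (List.Sublist.refl _)
  · rw [List.take_succ_eq_append_getD hj, hw]
    exact (h.right.trans (List.take_sublist_take_left hcj)).append (List.Sublist.refl _)

theorem List.sublist_concat_cases {Z W : List ℤ} {a : ℤ} (h : Z.Sublist (W ++ [a])) :
    Z.Sublist W ∨ ∃ Z', Z = Z' ++ [a] ∧ Z'.Sublist W := by
  obtain ⟨l₁, l₂, rfl, h₁, h₂⟩ := List.sublist_append_iff.1 h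
  rcases List.sublist_singleton.1 h₂ with rfl | rfl
  · left; simpa using h₁
  · exact Or.inr ⟨l₁, rfl, h₁⟩

theorem List.concat_sublist_take {Z Y : List ℤ} {v : ℤ} {c : ℕ}
    (h : (Z ++ [v]).Sublist (Y.take c)) :
    ∃ j, j < c ∧ j < Y.length ∧ Y.getD j 0 = v ∧ Z.Sublist (Y.take j) := by
  induction c with
  | zero => simp at h
  | succ c ih =>
    by_cases hc : c < Y.length
    · rw [List.take_succ_eq_append_getD hc] at h
      rcases List.sublist_concat_cases h with h | ⟨Z', he, h⟩
      · obtain ⟨j, h1, h2⟩ := ih h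
        exact ⟨j, by omega, h2⟩
      · obtain ⟨rfl, he'⟩ := List.append_inj' he rfl
        exact ⟨c, by omega, hc, by simpa using he'.symm, h⟩
    · rw [List.take_of_length_le (by omega)] at h
      obtain ⟨j, h1, h2⟩ := ih (by rwa [List.take_of_length_le (by omega)])
      exact ⟨j, by omega, h2⟩

/-- The recursion behind both phases: a chain either does not need the new element of `X`, or ends
with it. In the second case the last element is matched at some position `j` of `Y`, and the rest
lives in the first `j` elements. -/
theorem IsPrefixCIS.cases {X Y Z : List ℤ} {i c : ℕ} (hi : i < X.length)
    (h : IsPrefixCIS X Y (i + 1) c Z) :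
    IsPrefixCIS X Y i c Z ∨ ∃ Z' j, Z = Z' ++ [X.getD i 0] ∧ j < c ∧ j < Y.length ∧
      Y.getD j 0 = X.getD i 0 ∧ IsPrefixCIS X Y i j Z' ∧ ∀ z ∈ Z', z < X.getD i 0 := by
  have hl := h.left
  rw [List.take_succ_eq_append_getD hi] at hl
  rcases List.sublist_concat_cases hl with hl | ⟨Z', rfl, hl'⟩
  · exact Or.inl ⟨h.pairwise, hl, h.right⟩
  · obtain ⟨j, h1, h2, h3, h4⟩ := List.concat_sublist_take h.right
    have hp := List.pairwise_append.1 h.pairwise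
    exact Or.inr ⟨Z', j, rfl, h1, h2, h3, ⟨hp.1, hl', h4⟩, fun z hz => hp.2.2 z hz _ (by simp)⟩

namespace WordRAM

/-! ### Positions in the sorted sequence -/

/-- The first index below `n` at which `S` is at least `z` (and `n` if there is none). -/
noncomputable def firstGE (n : ℕ) (S : ℕ → ℤ) (z : ℤ) : ℕ := sInf {k | n ≤ k ∨ z ≤ S k}

theorem IsSorted.le {n : ℕ} {y S : ℕ → ℤ} (hS : IsSorted n y S) {k l : ℕ} (hkl : k ≤ l)
    (hl : l < n) : S k ≤ S l := by
  rcases hkl.eq_or_lt with rfl | h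
  · exact le_rfl
  · exact (hS.lt k l h hl).le

theorem IsSorted.isLB {n : ℕ} {y S : ℕ → ℤ} (hS : IsSorted n y S) (z : ℤ) :
    IsLB n S z (firstGE n S z) := by
  have hmem := Nat.sInf_mem (s := {k | n ≤ k ∨ z ≤ S k}) ⟨n, Or.inl le_rfl⟩
  refine ⟨Nat.sInf_le (Or.inl le_rfl), fun k hk => ?_, fun k hk hkn => ?_⟩
  · have := Nat.notMem_of_lt_sInf hk
    simp only [Set.mem_ofPred_eq, not_or, not_le] at this
    exact this.2
  · rcases hmem with h | h
    · exact absurd (h.trans hk) (by omega)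
    · exact h.trans (hS.le hk hkn)

theorem IsLB.unique {n : ℕ} {S : ℕ → ℤ} {z : ℤ} {r r' : ℕ} (h : IsLB n S z r)
    (h' : IsLB n S z r') : r = r' := by
  rcases lt_trichotomy r r' with hr | hr | hr
  · exact absurd (h'.lt r hr) (not_lt.2 (h.ge r le_rfl (hr.trans_le h'.le)))
  · exact hr
  · exact absurd (h.lt r' hr) (not_lt.2 (h'.ge r' le_rfl (hr.trans_le h.le)))

theorem firstGE_mono {n : ℕ} {S : ℕ → ℤ} {z z' : ℤ} (h : z ≤ z') :
    firstGE n S z ≤ firstGE n S z' := by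
  have hmem := Nat.sInf_mem (s := {k | n ≤ k ∨ z' ≤ S k}) ⟨n, Or.inl le_rfl⟩
  exact Nat.sInf_le (hmem.imp_right h.trans)

/-- The leaf of the search trees that belongs to the value `v`. -/
noncomputable def leafOf (n H : ℕ) (S : ℕ → ℤ) (v : ℤ) : ℕ := 2 ^ H + firstGE n S (v * n) + 1

theorem leafOf_mono {n H : ℕ} {S : ℕ → ℤ} {v w : ℤ} (h : v ≤ w) :
    leafOf n H S v ≤ leafOf n H S w := by
  have := firstGE_mono (n := n) (S := S)
    (mul_le_mul_of_nonneg_right h (by positivity : (0 : ℤ) ≤ n))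
  unfold leafOf
  omega

/-- This direction holds for all integers and serves soundness: chains found to the left of a leaf
have smaller values. -/
theorem lt_of_leafOf_lt {n H : ℕ} {S : ℕ → ℤ} {v w : ℤ} (h : leafOf n H S v < leafOf n H S w) :
    v < w := by
  by_contra hvw
  exact absurd (leafOf_mono (n := n) (H := H) (S := S) (not_lt.1 hvw)) (by omega)

/-- Strictness requires that the smaller value occurs in `Y`: its key lies between the two
thresholds and separates their positions. It serves completeness, where the values considered do
occur in `Y`. -/
theorem leafOf_lt {n H : ℕ} {y S : ℕ → ℤ} (hS : IsSorted n y S) {v w : ℤ} {j : ℕ} (hj : j < n)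
    (hv : y j = v) (hvw : v < w) : leafOf n H S v < leafOf n H S w := by
  obtain ⟨k, hk, he⟩ := hS.exists_eq j hj
  rw [hv] at he
  have h1 := hS.isLB (v * n)
  have h2 := hS.isLB (w * n)
  have e : v * n + n ≤ w * n := by nlinarith
  have h3 : firstGE n S (v * n) ≤ k := by
    by_contra hlt
    have := h1.lt k (by omega)
    omega
  have h4 : k < firstGE n S (w * n) := by
    by_contra hge
    have := h2.ge k (by omega) hk
    omega
  unfold leafOf
  omega

theorem isLeaf_leafOf {n H : ℕ} {y S : ℕ → ℤ} (hS : IsSorted n y S) (hH : n + 2 ≤ 2 ^ H) (v : ℤ) :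
    IsLeaf H (leafOf n H S v) :=
  isLeaf_add hH (Nat.succ_le_succ (hS.isLB _).le)

/-- An entry of `S` in the range of the value `v`. -/
theorem IsSorted.eq_of_mem_range {n : ℕ} {y S : ℕ → ℤ} (hS : IsSorted n y S) {k : ℕ} {v : ℤ}
    (hk : k < n) (h1 : v * n ≤ S k) (h2 : S k < v * n + n) :
    ∃ j : ℕ, j < n ∧ S k - v * n = j ∧ y j = v := by
  obtain ⟨j, hj, he⟩ := hS.mem k hk
  have hv : y j = v := by
    rcases lt_trichotomy (y j) v with h | h | h
    · nlinarith
    · exact h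
    · nlinarith
  exact ⟨j, hj, by rw [he, hv]; ring, hv⟩

/-! ### Nodes -/

/-- `id` is the last node of a chain with values `Z`; node `k` has value `nv k` and predecessor
`np k`, and there is no node `0`. -/
inductive Chain (nv np : ℤ → ℤ) : ℕ → List ℤ → Prop
  | nil : Chain nv np 0 []
  | snoc {id par : ℕ} {Z : List ℤ} {v : ℤ} (hp : np id = par) (hv : nv id = v) (hlt : par < id)
      (h : Chain nv np par Z) : Chain nv np id (Z ++ [v])

/-- Predecessors have smaller numbers, so a chain ending at `id` never looks beyond `id`, and adding
later nodes does not disturb it. -/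
theorem Chain.congr {nv np nv' np' : ℤ → ℤ} {id : ℕ} {Z : List ℤ} (h : Chain nv np id Z)
    (hv : ∀ k : ℕ, k ≤ id → nv' k = nv k) (hp : ∀ k : ℕ, k ≤ id → np' k = np k) :
    Chain nv' np' id Z := by
  induction h with
  | nil => exact .nil
  | snoc hp' hv' hlt h ih =>
    exact .snoc ((hp _ le_rfl).trans hp') ((hv _ le_rfl).trans hv') hlt
      (ih (fun k hk => hv k (by omega)) (fun k hk => hp k (by omega)))

/-- The variables and arrays that the two phases of the algorithm only read. -/
structure Env (n H r : ℕ) (X Y : List ℤ) (S : ℕ → ℤ) (s : St) : Prop where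
  v0 : s.v 0 = n
  v3 : s.v 3 = 2 ^ H
  v4 : s.v 4 = r
  v6 : s.v 6 = 2 * n * r + 1
  x : ∀ i : ℕ, i < n → s.a 0 i = X.getD i 0
  S : ∀ k : ℕ, k < n → s.a 1 k = S k

theorem Env.congr {n H r : ℕ} {X Y : List ℤ} {S : ℕ → ℤ} {s s' : St} (h : Env n H r X Y S s)
    (hv : ∀ x, x < 7 → s'.v x = s.v x) (ha : ∀ b, b < 2 → s'.a b = s.a b) :
    Env n H r X Y S s' where
  v0 := (hv 0 (by omega)).trans h.v0
  v3 := (hv 3 (by omega)).trans h.v3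
  v4 := (hv 4 (by omega)).trans h.v4
  v6 := (hv 6 (by omega)).trans h.v6
  x i hi := by rw [ha 0 (by omega)]; exact h.x i hi
  S k hk := by rw [ha 1 (by omega)]; exact h.S k hk

/-- There are `cnt` nodes, and the best chain known has length `len` and ends with the node
`best`. -/
structure Nodes (X Y : List ℤ) (s : St) (cnt len best : ℕ) : Prop where
  v7 : s.v 7 = cnt
  v8 : s.v 8 = len
  v9 : s.v 9 = best
  best_le : best ≤ cnt
  chain : ∃ Z, Chain (s.a 5) (s.a 6) best Z ∧ Z.length = len ∧ IsCommonIncSubseq Z X Y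

theorem Nodes.congr {X Y : List ℤ} {s s' : St} {cnt len best : ℕ} (h : Nodes X Y s cnt len best)
    (hv : ∀ x, 7 ≤ x → x < 10 → s'.v x = s.v x) (h5 : s'.a 5 = s.a 5) (h6 : s'.a 6 = s.a 6) :
    Nodes X Y s' cnt len best where
  v7 := (hv 7 (by omega) (by omega)).trans h.v7
  v8 := (hv 8 (by omega) (by omega)).trans h.v8
  v9 := (hv 9 (by omega) (by omega)).trans h.v9
  best_le := h.best_le
  chain := by rw [h5, h6]; exact h.chain

/-- Create a node with value `♯11` whose predecessor is encoded in `♯14` and that ends a chain of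
length `♯16`. -/
def newNode : Cmd :=
  7 ≔ ♯7 +. ♭1 ;; .store 5 ♯7 ♯11 ;; .store 6 ♯7 (♯14 -. (♯14 /. ♯6) *. ♯6) ;;
  .ite ♯8 ♯16 (8 ≔ ♯16 ;; 9 ≔ ♯7) .skip

variable {M B : ℤ}

/-- The remainder of the packed query result modulo `♯6` is the predecessor; the result `0` of an
unsuccessful query yields `0`, the end of the empty chain. The record chain is replaced only by a
strictly longer one. -/
theorem wp_newNode {X Y Z : List ℤ} {cnt len best par id : ℕ} {v e : ℤ} {Q : St → Prop} {s : St}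
    (hN : Nodes X Y s cnt len best) (hid : s.v 6 = id) (hcnt : cnt < id) (hidM : (id : ℤ) ≤ M ^ 6)
    (h11 : s.v 11 = v) (h14 : s.v 14 = e * id + par) (hpar : par ≤ cnt)
    (hc : Chain (s.a 5) (s.a 6) par Z) (h16 : s.v 16 = Z.length + 1)
    (hZ : IsCommonIncSubseq (Z ++ [v]) X Y)
    (hQ : ∀ (s' : St) (best' : ℕ), (∀ x, x < 7 ∨ 9 < x → s'.v x = s.v x) →
      (∀ b, b < 5 → s'.a b = s.a b) → s'.time ≤ s.time + 60 →
      (∀ (k : ℕ) (W : List ℤ), k ≤ cnt → Chain (s.a 5) (s.a 6) k W →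
        Chain (s'.a 5) (s'.a 6) k W) →
      Chain (s'.a 5) (s'.a 6) (cnt + 1) (Z ++ [v]) →
      Nodes X Y s' (cnt + 1) (max len (Z.length + 1)) best' → Q s') :
    wp varSize arrSize M B newNode Q s := by
  have hdiv : (e * id + par) / (id : ℤ) = e := by
    rw [add_comm, Int.add_mul_ediv_right _ _ (by omega),
      Int.ediv_eq_zero_of_lt (by omega) (by omega), zero_add]
  have hmod : e * id + par - e * id = (par : ℤ) := by ring
  have hsz : |(cnt : ℤ) + 1| ≤ M ^ varSize 7 := by
    rw [abs_of_nonneg (by positivity)]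
    have : varSize 7 = 6 := rfl
    rw [this]
    omega
  have hnn : (0 : ℤ) ≤ (cnt : ℤ) + 1 := by positivity
  unfold newNode
  simp +decide only [wp_seq, wp_assign, wp_store, wp_ite, wp_skip, Expr.ok, Expr.eval, Expr.cost,
    true_and, true_or, or_true, St.set_v, St.tick_v, St.put_v, hN.v7, hN.v8, h11, h14, h16, hid,
    hdiv, hmod, hsz, hnn, if_true, if_false, false_imp_iff]
  have h5 : ∀ (t : St) (k : ℕ), t.a 5 = (Function.update (s.a 5) (cnt + 1) v) → k ≤ cnt →
      t.a 5 k = s.a 5 k := fun t k ht hk => by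
    rw [ht, Function.update_of_ne (by omega)]
  have h6 : ∀ (t : St) (k : ℕ), t.a 6 = (Function.update (s.a 6) (cnt + 1) par) → k ≤ cnt →
      t.a 6 k = s.a 6 k := fun t k ht hk => by
    rw [ht, Function.update_of_ne (by omega)]
  have hall : ∀ t : St, t.a 5 = (Function.update (s.a 5) (cnt + 1) v) →
      t.a 6 = (Function.update (s.a 6) (cnt + 1) par) →
      (∀ (k : ℕ) (W : List ℤ), k ≤ cnt → Chain (s.a 5) (s.a 6) k W → Chain (t.a 5) (t.a 6) k W) ∧
      Chain (t.a 5) (t.a 6) (cnt + 1) (Z ++ [v]) := by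
    intro t ht5 ht6
    have h1 : ∀ (k : ℕ) (W : List ℤ), k ≤ cnt → Chain (s.a 5) (s.a 6) k W →
        Chain (t.a 5) (t.a 6) k W := fun k W hk hW =>
      hW.congr (fun j hj => h5 t j ht5 (by omega)) fun j hj => h6 t j ht6 (by omega)
    refine ⟨h1, .snoc (par := par) ?_ ?_ (by omega) (h1 par Z hpar hc)⟩
    · rw [ht6]; simp
    · rw [ht5]; simp
  obtain ⟨W, hW1, hW2, hW3⟩ := hN.chain
  refine ⟨fun hlt => ?_, fun hge => ?_⟩
  · have hf : ∀ x, x < 7 ∨ 9 < x → x ≠ 7 ∧ x ≠ 8 ∧ x ≠ 9 := fun x hx => by omega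
    refine hQ _ (cnt + 1) (fun x hx => ?_) (fun b hb => ?_) ?_ ?_ ?_ ?_
    · simp [hf x hx]
    · simp only [St.set_a, St.tick_a]
      rw [St.put_a_ne _ _ _ _ _ (by omega), St.put_a_ne _ _ _ _ _ (by omega)]; rfl
    · simp
    · refine (hall _ ?_ ?_).1 <;> · simp [St.put]
    · refine (hall _ ?_ ?_).2 <;> · simp [St.put]
    · refine ⟨by simp, ?_, by simp, le_rfl, Z ++ [v], (hall _ ?_ ?_).2, ?_, hZ⟩
      · simp; omega
      · simp [St.put]
      · simp [St.put]
      · simp; omega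
  · have hf : ∀ x, x < 7 ∨ 9 < x → x ≠ 7 ∧ x ≠ 8 ∧ x ≠ 9 := fun x hx => by omega
    refine hQ _ best (fun x hx => ?_) (fun b hb => ?_) ?_ ?_ ?_ ?_
    · simp [hf x hx]
    · simp only [St.tick_a]
      rw [St.put_a_ne _ _ _ _ _ (by omega), St.put_a_ne _ _ _ _ _ (by omega)]; rfl
    · simp
    · refine (hall _ ?_ ?_).1 <;> · simp [St.put]
    · refine (hall _ ?_ ?_).2 <;> · simp [St.put]
    · refine ⟨by simp, ?_, by simp [hN.v9], hN.best_le.trans (Nat.le_succ _), W,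
        (hall _ ?_ ?_).1 _ _ hN.best_le hW1, ?_, hW3⟩
      · simp [hN.v8]; omega
      · simp [St.put]
      · simp [St.put]
      · omega

/-- Fetch the `♯10`-th element of `X`, its position in array `1` and its leaf. -/
def locate : Cmd :=
  11 ≔ .arr 0 ♯10 ;; 40 ≔ ♯11 *. ♯0 ;; lowerBound ;; 12 ≔ ♯3 +. ♯41 +. ♭1

theorem wp_locate {n H r i : ℕ} {X Y : List ℤ} {y S : ℕ → ℤ} {Q : St → Prop} {s : St}
    (hE : Env n H r X Y S s) (hS : IsSorted n y S) (hnM : (n : ℤ) < M) (hH : n + 2 ≤ 2 ^ H)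
    (hB : B = 2 * n) (h10 : s.v 10 = i) (hi : i < n)
    (hQ : ∀ s' : St, (∀ x, x < 11 → s'.v x = s.v x) → s'.a = s.a →
      s'.v 11 = X.getD i 0 → s'.v 12 = leafOf n H S (X.getD i 0) →
      s'.v 41 = firstGE n S (X.getD i 0 * n) → s'.time ≤ s.time + 50 * (H + 1) → Q s') :
    wp varSize arrSize M B locate Q s := by
  have hiB : (i : ℤ) < B := by omega
  unfold locate
  simp +decide only [wp_seq, wp_assign, Expr.ok, Expr.eval, Expr.cost, true_and, true_or, h10,
    St.set_v, if_true, if_false, hE.x i hi, hE.v0, Int.natCast_nonneg, hiB, true_imp_iff]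
  refine wp_lowerBound (z := X.getD i 0 * n) (H := H) (n := n) (S := S) (by simp [hE.v0]) (by simp)
    (fun k hk => by simpa using hE.S k hk) hS.lt (by omega) hnM.le ?_
  intro s₁ k hv₁ ha₁ ht₁ h41 hlb
  have hk := hlb.unique (hS.isLB _)
  have h3 : s₁.v 3 = 2 ^ H := by rw [hv₁ 3 (by omega)]; simp [hE.v3]
  have h11 : s₁.v 11 = X.getD i 0 := by rw [hv₁ 11 (by omega)]; simp
  simp only [St.set_time] at ht₁
  simp +decide only [wp_assign, Expr.ok, Expr.eval, Expr.cost, true_and, true_or, h3, h41]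
  refine hQ _ (fun x hx => ?_) (by simpa using ha₁) ?_ ?_ ?_ ?_
  · simp [show x ≠ 11 by omega, show x ≠ 12 by omega, show x ≠ 40 by omega, hv₁ x (by omega)]
  · rw [St.set_v, if_neg (by norm_num), h11]
  · simp [leafOf, hk]
  · simp [h41, hk]
  · simp; omega

end WordRAM

namespace WordRAM

/-! ### First phase: short common increasing subsequences -/

/-- The item `z` at leaf `l` of tree `t` describes an increasing common subsequence of length `t`
of the first `i` elements of `X` and the first `c` elements of `Y`, where `c` is as small as
possible if `z` is as large as possible. -/
def ItemA (n H r : ℕ) (X Y : List ℤ) (S nv np : ℤ → ℤ) (cnt i t l : ℕ) (z : ℤ) : Prop :=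
  ∃ (c id : ℕ) (Z : List ℤ), z = ((n : ℤ) + 1 - c) * (2 * n * r + 1) + id ∧ c ≤ n ∧ id ≤ cnt ∧
    Chain nv np id Z ∧ Z.length = t ∧ IsPrefixCIS X Y i c Z ∧
    ∀ w ∈ Z, leafOf n H (fun k => S k) w ≤ l

/-- Items stay meaningful when nodes are added or a longer prefix of `X` is considered, so nothing
is ever removed from the trees. -/
theorem ItemA.mono {n H r : ℕ} {X Y : List ℤ} {S nv np nv' np' : ℤ → ℤ}
    {cnt cnt' i i' t l : ℕ} {z : ℤ} (h : ItemA n H r X Y S nv np cnt i t l z)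
    (hc : ∀ (k : ℕ) (W : List ℤ), k ≤ cnt → Chain nv np k W → Chain nv' np' k W)
    (hcnt : cnt ≤ cnt') (hi : i ≤ i') : ItemA n H r X Y S nv' np' cnt' i' t l z := by
  obtain ⟨c, id, Z, h1, h2, h3, h4, h5, h6, h7⟩ := h
  exact ⟨c, id, Z, h1, h2, h3.trans hcnt, hc _ _ h3 h4, h5, h6.mono hi le_rfl, h7⟩

/-- Position `j` of `Y` extends an increasing common subsequence of length `t - 1` by the `i`-th
element of `X`. -/
def Extends (X Y : List ℤ) (i t j : ℕ) : Prop :=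
  ∃ Z, Z.length + 1 = t ∧ IsPrefixCIS X Y i j Z ∧ (∀ z ∈ Z, z < X.getD i 0) ∧ j < Y.length ∧
    Y.getD j 0 = X.getD i 0

/-- The items are complete for the first `i` elements of `X`. -/
def CompleteA (n H r : ℕ) (X Y : List ℤ) (S : ℤ → ℤ) (i : ℕ) (I : ℕ → ℕ → ℤ → Prop) : Prop :=
  ∀ (Z : List ℤ) (c : ℕ), c ≤ n → Z.length ≤ r → IsPrefixCIS X Y i c Z →
    ∃ l z, I Z.length l z ∧ ((n : ℤ) + 1 - c) * (2 * n * r + 1) ≤ z ∧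
      ∀ v, (∀ w ∈ Z, w < v) → l < leafOf n H (fun k => S k) v

/-- The state of the search trees before level `t` is processed for the `i`-th element of `X`. -/
structure InvA (n H r : ℕ) (X Y : List ℤ) (S nv np : ℤ → ℤ) (cnt len i t : ℕ)
    (I : ℕ → ℕ → ℤ → Prop) : Prop where
  sound : ∀ u l z, I u l z → ItemA n H r X Y S nv np cnt i u l z ∨
    l = leafOf n H (fun k => S k) (X.getD i 0) ∧ ItemA n H r X Y S nv np cnt (i + 1) u l z
  complete : CompleteA n H r X Y S i I
  done : ∀ u j, u < t → Extends X Y i u j →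
    ∃ z, I u (leafOf n H (fun k => S k) (X.getD i 0)) z ∧
      ((n : ℤ) - j) * (2 * n * r + 1) ≤ z
  le_len : ∀ u l z, I u l z → u ≤ len

section

variable {n H r : ℕ} {X Y : List ℤ} {S nv np : ℤ → ℤ} {cnt len i t : ℕ}
  {I : ℕ → ℕ → ℤ → Prop}

/-- What the best item says about the next element. -/
theorem InvA.best (h : InvA n H r X Y S nv np cnt len i t I) (ht : 0 < t) (htr : t ≤ r)
    (hcnt : cnt < 2 * n * r + 1) (hY : Y.length = n) {e : ℤ}
    (he : IsBest (fun z => ∃ l, I (t - 1) l z ∧ l < leafOf n H (fun k => S k) (X.getD i 0)) e) :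
    ∃ c : ℕ, c ≤ n + 1 ∧ e / (2 * n * r + 1) = (n : ℤ) + 1 - c ∧
      (∀ j, Extends X Y i t j → c ≤ j) ∧
      (c ≤ n → ∃ (id : ℕ) (Z : List ℤ), e = ((n : ℤ) + 1 - c) * (2 * n * r + 1) + id ∧ id ≤ cnt ∧
        Chain nv np id Z ∧ Z.length + 1 = t ∧ IsPrefixCIS X Y i c Z ∧ ∀ w ∈ Z, w < X.getD i 0) := by
  have hD : (cnt : ℤ) < 2 * n * r + 1 := by exact_mod_cast hcnt
  have hext : ∀ j, Extends X Y i t j → ((n : ℤ) + 1 - j) * (2 * n * r + 1) ≤ e ∧ j < n := by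
    rintro j ⟨Z, hZ, hcis, hlt, hj, -⟩
    obtain ⟨l, z, h1, h2, h3⟩ := h.complete Z j (by omega) (by omega) hcis
    rw [show Z.length = t - 1 by omega] at h1
    exact ⟨h2.trans (he.ge z ⟨l, h1, h3 _ hlt⟩), by omega⟩
  rcases he.mem with rfl | ⟨l, hI, hl⟩
  -- No chain was found. The value `c = n + 1` matches the formula for the quotient, since `0 = n +
  -- 1 - c`, and lies beyond all positions of `Y`. A genuine item would be positive because `c ≤ n`.
  · refine ⟨n + 1, le_rfl, by simp, fun j hj => ?_, fun h => by omega⟩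
    obtain ⟨h1, h2⟩ := hext j hj
    have : 0 < ((n : ℤ) + 1 - j) * (2 * n * r + 1) := mul_pos (by omega) (by positivity)
    omega
  -- Items already created for the current element of `X` sit at its own leaf, and the query is
  -- strictly to the left of it. Hence the element is not used twice.
  · obtain ⟨c, id, Z, h1, h2, h3, h4, h5, h6, h7⟩ : ItemA n H r X Y S nv np cnt i (t - 1) l e := by
      rcases h.sound _ _ _ hI with h | h
      · exact h
      · omega
    refine ⟨c, by omega, ?_, fun j hj => ?_, fun _ => ⟨id, Z, h1, h3, h4, by omega, h6, ?_⟩⟩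
    · rw [h1, add_comm, Int.add_mul_ediv_right _ _ (by positivity),
        Int.ediv_eq_zero_of_lt (by omega) (by omega), zero_add]
    · obtain ⟨h8, h9⟩ := hext j hj
      by_contra hlt
      have : ((n : ℤ) + 1 - j) ≥ ((n : ℤ) + 1 - c) + 1 := by omega
      have := mul_le_mul_of_nonneg_right this (by positivity : (0 : ℤ) ≤ 2 * n * r + 1)
      have hid : (id : ℤ) ≤ cnt := by exact_mod_cast h3
      linarith
    · exact fun w hw => lt_of_leafOf_lt ((h7 w hw).trans_lt hl)

/-- If the level admits no extension, its completeness requirement is vacuous and the trees stay as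
they are. -/
theorem InvA.succ_of_not (h : InvA n H r X Y S nv np cnt len i t I)
    (hno : ∀ j, ¬ Extends X Y i t j) : InvA n H r X Y S nv np cnt len i (t + 1) I where
  sound := h.sound
  complete := h.complete
  done u j hu hj := by
    rcases Nat.lt_succ_iff_lt_or_eq.1 hu with hu | rfl
    · exact h.done u j hu hj
    · exact absurd hj (hno j)
  le_len := h.le_len

/-- The earliest possible end position dominates all others: whatever can follow a chain ending
later can also follow this one. So one item per level and element of `X` is enough. -/
theorem InvA.succ_of_insert (h : InvA n H r X Y S nv np cnt len i t I) {nv' np' : ℤ → ℤ}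
    {Z : List ℤ} {j : ℕ}
    (hc : ∀ (k : ℕ) (W : List ℤ), k ≤ cnt → Chain nv np k W → Chain nv' np' k W)
    (hnew : Chain nv' np' (cnt + 1) (Z ++ [X.getD i 0])) (hZ : Z.length + 1 = t)
    (hcis : IsPrefixCIS X Y (i + 1) (j + 1) (Z ++ [X.getD i 0])) (hj : j < n)
    (hmin : ∀ j', Extends X Y i t j' → j ≤ j') :
    InvA n H r X Y S nv' np' (cnt + 1) (max len t) i (t + 1) fun u k y => I u k y ∨
      u = t ∧ k = leafOf n H (fun k => S k) (X.getD i 0) ∧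
      y = ((n : ℤ) - j) * (2 * n * r + 1) + (cnt + 1) where
  sound := by
    rintro u l z (hI | ⟨rfl, rfl, rfl⟩)
    · rcases h.sound u l z hI with h | ⟨h', h⟩
      · exact Or.inl (h.mono hc (by omega) le_rfl)
      · exact Or.inr ⟨h', h.mono hc (by omega) le_rfl⟩
    · refine Or.inr ⟨rfl, j + 1, cnt + 1, _, by push_cast; ring, hj, le_rfl, hnew, by simp [hZ],
        hcis, fun w hw => leafOf_mono ?_⟩
      rcases List.mem_append.1 hw with hw' | hw'
      · exact ((List.pairwise_append.1 hcis.pairwise).2.2 w hw' _ (by simp)).le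
      · exact (List.mem_singleton.1 hw').le
  complete := fun Z c h1 h2 h3 =>
    let ⟨l, z, h4, h5⟩ := h.complete Z c h1 h2 h3
    ⟨l, z, Or.inl h4, h5⟩
  done u j' hu hj' := by
    rcases Nat.lt_succ_iff_lt_or_eq.1 hu with hu | rfl
    · obtain ⟨z, h1, h2⟩ := h.done u j' hu hj'
      exact ⟨z, Or.inl h1, h2⟩
    · refine ⟨_, Or.inr ⟨rfl, rfl, rfl⟩, ?_⟩
      have := hmin j' hj'
      have := mul_le_mul_of_nonneg_right (show (n : ℤ) - j' ≤ n - j by omega)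
        (by positivity : (0 : ℤ) ≤ 2 * n * r + 1)
      linarith
  le_len := by
    rintro u l z (hI | ⟨rfl, -⟩)
    · exact (h.le_len u l z hI).trans (le_max_left _ _)
    · exact le_max_right _ _

/-- A chain of the longer prefix that uses the new element is covered by `done` at its own length,
and any other chain by the old completeness. -/
theorem InvA.next (h : InvA n H r X Y S nv np cnt len i (r + 1) I) (hi : i < X.length)
    (hS : IsSorted n (fun j => Y.getD j 0) fun k => S k) (hY : Y.length = n) :
    InvA n H r X Y S nv np cnt len (i + 1) 1 I where
  sound u l z hI := Or.inl <| by
    rcases h.sound u l z hI with h | ⟨-, h⟩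
    · exact h.mono (fun _ _ _ h => h) le_rfl (by omega)
    · exact h
  complete Z c hc hZ hcis := by
    rcases hcis.cases hi with h' | ⟨Z', j, rfl, h1, h2, h3, h4, h5⟩
    · exact h.complete Z c hc hZ h'
    · rw [List.length_append, List.length_singleton] at hZ ⊢
      obtain ⟨z, h6, h7⟩ := h.done (Z'.length + 1) j (by omega) ⟨Z', rfl, h4, h5, h2, h3⟩
      refine ⟨_, z, h6, ?_, fun v hv => ?_⟩
      · have := mul_le_mul_of_nonneg_right (show (n : ℤ) + 1 - c ≤ n - j by omega)
          (by positivity : (0 : ℤ) ≤ 2 * n * r + 1)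
        linarith
      · exact leafOf_lt hS (hY ▸ h2) h3 (hv _ (by simp))
  done := by
    rintro u j hu ⟨Z, hZ, -⟩
    omega
  le_len := h.le_len

/-- The empty chain is an explicit item at leaf `2 ^ H`. This leaf is free, and left of every value,
because of the `+ 1` in `leafOf`. -/
theorem InvA.init :
    InvA n H r X Y S nv np 0 0 0 1
      fun u l z => u = 0 ∧ l = 2 ^ H ∧ z = ((n : ℤ) + 1) * (2 * n * r + 1) where
  sound := by
    rintro u l z ⟨rfl, rfl, rfl⟩
    exact Or.inl ⟨0, 0, [], by simp, by omega, le_rfl, .nil, rfl, .nil, by simp⟩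
  complete Z c hc hZ hcis := by
    obtain rfl : Z = [] := by simpa using hcis.left
    refine ⟨_, _, ⟨rfl, rfl, rfl⟩, ?_, fun v _ => ?_⟩
    · have := mul_le_mul_of_nonneg_right (show (n : ℤ) + 1 - c ≤ n + 1 by omega)
        (by positivity : (0 : ℤ) ≤ 2 * n * r + 1)
      linarith
    · unfold leafOf; omega
  done := by
    rintro u j hu ⟨Z, hZ, -⟩
    omega
  le_len := by
    rintro u l z ⟨rfl, -⟩
    exact le_rfl

end

/-- Process one level: find the best chain of the previous level with smaller values and extend it
as early as possible. -/
def stepA : Cmd :=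
  44 ≔ ♯13 -. ♭1 ;; 45 ≔ ♯12 ;; query 3 ;; 14 ≔ ♯46 ;;
  40 ≔ ♯11 *. ♯0 +. ((♯0 +. ♭1) -. ♯14 /. ♯6) ;; lowerBound ;;
  .ite ♯41 ♯0
    (17 ≔ .arr 1 ♯41 -. ♯11 *. ♯0 ;;
     .ite ♯17 ♯0
      (16 ≔ ♯13 ;; newNode ;; 44 ≔ ♯13 ;; 45 ≔ ♯12 ;; 46 ≔ (♯0 -. ♯17) *. ♯6 +. ♯7 ;;
       insertItem 3)
      .skip)
    .skip ;;
  13 ≔ ♯13 +. ♭1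

variable {M B : ℤ}

/-- The query yields the shortest prefix `c` of `Y`, and the first key that is at least `x * n + c`
belongs to the first occurrence of `x` from position `c` on. If that key is missing or belongs to
another value, the level has no extension. -/
theorem wp_stepA {n H r i t cnt len best : ℕ} {X Y : List ℤ} {S : ℤ → ℤ} {I : ℕ → ℕ → ℤ → Prop}
    {Q : St → Prop} {s : St}
    (hE : Env n H r X Y (fun k => S k) s) (hS : IsSorted n (fun j => Y.getD j 0) fun k => S k)
    (hX : X.length = n) (hY : Y.length = n) (hH : n + 2 ≤ 2 ^ H) (hnM : (n : ℤ) < M)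
    (hrM : (r : ℤ) + 1 ≤ M ^ 3) (hD : (2 * n * r + 1 : ℤ) ≤ M ^ 6)
    (hi : i < n) (h11 : s.v 11 = X.getD i 0)
    (h12 : s.v 12 = leafOf n H (fun k => S k) (X.getD i 0)) (h13 : s.v 13 = t) (ht : 0 < t)
    (htr : t ≤ r) (hN : Nodes X Y s cnt len best) (hcnt : cnt < 2 * n * r + 1)
    (hT : TreeRep H (cell H (s.a 3)) I)
    (hI : InvA n H r X Y S (s.a 5) (s.a 6) cnt len i t I)
    (hQ : ∀ (s' : St) (cnt' len' best' : ℕ) (I' : ℕ → ℕ → ℤ → Prop),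
      (∀ x, x < 7 ∨ 9 < x → x < 13 → s'.v x = s.v x) → (∀ b, b ≠ 3 → b < 5 → s'.a b = s.a b) →
      s'.v 13 = t + 1 → s'.time ≤ s.time + 300 * (H + 2) → cnt' ≤ cnt + 1 →
      Nodes X Y s' cnt' len' best' → TreeRep H (cell H (s'.a 3)) I' →
      InvA n H r X Y S (s'.a 5) (s'.a 6) cnt' len' i (t + 1) I' → Q s') :
    wp varSize arrSize M B stepA Q s := by
  have hleaf : IsLeaf H (leafOf n H (fun k => S k) (X.getD i 0)) := isLeaf_leafOf hS hH _
  have ht1 : |(t : ℤ) + 1| ≤ M ^ varSize 13 := by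
    rw [abs_of_nonneg (by positivity)]
    have : varSize 13 = 3 := rfl
    rw [this]; omega
  unfold stepA
  simp +decide only [wp_seq, wp_assign, Expr.ok, Expr.eval, Expr.cost, true_and, true_or,
    St.set_v, if_false]
  refine wp_query (H := H) (t := t - 1) (l := leafOf n H (fun k => S k) (X.getD i 0)) (I := I)
    (by norm_num) rfl (by simp [hE.v3]) (by simp [h13]; omega) (by simp [h12]) hleaf
    (by simpa using hT) ?_
  intro s₁ hv₁ ha₁ ht₁ he
  obtain ⟨c, hcn, hdiv, hmin, hget⟩ := hI.best ht htr hcnt hY he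
  simp only [St.set_v, St.set_a, St.set_time] at hv₁ ha₁ ht₁
  have hv₁' : ∀ x, x < 44 → s₁.v x = s.v x := fun x hx => by
    rw [hv₁ x hx, if_neg (by omega), if_neg (by omega)]
  simp +decide only [wp_seq, wp_assign, Expr.ok, Expr.eval, Expr.cost, true_and, true_or,
    St.set_v, if_true, if_false, hv₁' 0 (by norm_num), hv₁' 6 (by norm_num), hv₁' 11 (by norm_num), hE.v0, hE.v6, h11, hdiv]
  refine wp_lowerBound (z := X.getD i 0 * n + c) (H := H) (n := n) (S := fun k => S k)
    (by simp [hv₁', hE.v0]) (by simp)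
    (fun k hk => by simpa [ha₁] using hE.S k hk) hS.lt (by omega) hnM.le ?_
  intro s₂ k hv₂ ha₂ ht₂ h41 hlb
  simp only [St.set_v, St.set_a, St.set_time] at hv₂ ha₂ ht₂
  rw [ha₁] at ha₂
  have h14 : s₂.v 14 = s₁.v 46 := by rw [hv₂ 14 (by omega)]; simp
  have hv₂' : ∀ x, x < 14 → s₂.v x = s.v x := fun x hx => by
    rw [hv₂ x (by omega), if_neg (by omega), if_neg (by omega), hv₁' x (by omega)]
  -- An admissible end position has its key at or after index `k`, so `S k` exists and belongs to a
  -- position no later.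
  have hext : ∀ j, Extends X Y i t j → k < n ∧ S k ≤ X.getD i 0 * n + j := by
    intro j hj
    have hcj := hmin j hj
    obtain ⟨Z, -, -, -, hjn, hy⟩ := hj
    obtain ⟨k', hk', he'⟩ := hS.exists_eq j (by omega)
    rw [hy] at he'
    have hkk : k ≤ k' := by
      by_contra hlt
      have := hlb.lt k' (by omega)
      omega
    have hle : S k ≤ S k' := hS.le hkk hk'
    exact ⟨by omega, by omega⟩
  have hSk : k < n → s₂.a 1 k = S k := fun hk => by rw [ha₂]; exact hE.S k hk
  have hk0 : (0 : ℤ) ≤ k := by positivity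
  -- The two unsuccessful branches end in the same way, without any change to the trees.
  have hfinal : ∀ s₃ : St, (∀ x, x < 14 → s₃.v x = s.v x) → s₃.a = s.a →
      s₃.time ≤ s.time + 80 * (H + 1) + 100 → (∀ j, ¬ Extends X Y i t j) →
      Q (s₃.set 13 (t + 1) (1 + 1 + 1 + 1)) := by
    intro s₃ hv₃ ha₃ ht₃ hno
    refine hQ _ cnt len best I (fun x _ hx => ?_) (fun b _ _ => by rw [St.set_a, ha₃]) (by simp) ?_
      (by omega) (hN.congr (fun x _ hx => ?_) (by rw [St.set_a, ha₃]) (by rw [St.set_a, ha₃]))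
      (by rw [St.set_a, ha₃]; exact hT) (by rw [St.set_a, ha₃]; exact hI.succ_of_not hno)
    · rw [St.set_v, if_neg (by omega), hv₃ x (by omega)]
    · simp; omega
    · rw [St.set_v, if_neg (by omega), hv₃ x (by omega)]
  simp +decide only [wp_ite, wp_seq, wp_skip, wp_assign, Expr.ok, Expr.eval, Expr.cost, true_and,
    true_or, h41, hv₂' 0 (by norm_num), hv₂' 11 (by norm_num), hv₂' 13 (by norm_num), hE.v0, h11, h13, hk0, ht1, or_true, false_imp_iff, St.tick_v,
    St.tick_a, St.set_v, if_true, if_false]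
  refine ⟨fun hlt => ?_, fun hge => ?_⟩
  · have hlt' : k < n := by exact_mod_cast hlt
    refine ⟨fun hjlt => ?_, fun hjge => ?_⟩
    · rw [hSk hlt'] at hjlt
      have hz := hlb.ge k le_rfl hlt'
      obtain ⟨j, hj, hSj, hyj⟩ := hS.eq_of_mem_range (v := X.getD i 0) hlt' (by omega) (by omega)
      have hcj : c ≤ j := by omega
      -- Here `c ≤ j < n`, so the query did find a chain.
      obtain ⟨id, Z, h1, h2, h3, h4, h5, h6⟩ := hget (by omega)
      have hcis := h5.snoc (hX ▸ hi) rfl hcj (hY ▸ hj) hyj h6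
      refine wp_newNode (X := X) (Y := Y) (cnt := cnt) (len := len) (best := best) (Z := Z)
        (par := id) (id := 2 * n * r + 1) (v := X.getD i 0) (e := (n : ℤ) + 1 - c)
        (hN.congr (fun x hx hx' => ?_) ?_ ?_) ?_ hcnt (by exact_mod_cast hD) ?_ ?_ h2 ?_ ?_
        hcis.isCommonIncSubseq ?_
      · simp [show x ≠ 16 by omega, show x ≠ 17 by omega, hv₂' x (by omega)]
      · simp [ha₂]
      · simp [ha₂]
      · simp [hv₂', hE.v6]
      · simp [hv₂', h11]
      · simp [h14, h1]
      · simpa [ha₂] using h3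
      · simp; omega
      intro s₃ best' hv₃ ha₃ ht₃ hc₃ hnew hN₃
      simp only [St.set_v, St.set_a, St.tick_v, St.tick_a, St.set_time, St.tick_time, ha₂]
        at hv₃ ha₃ ht₃ hc₃ hnew
      have hv₃' : ∀ x, x < 7 ∨ 9 < x → x < 14 → s₃.v x = s.v x := fun x hx hx' => by
        rw [hv₃ x hx, if_neg (by omega), if_neg (by omega), hv₂' x hx']
      have h17 : s₃.v 17 = j := by
        rw [hv₃ 17 (by omega), if_neg (by omega), if_pos rfl, hE.S k hlt', hSj]
      simp +decide only [wp_seq, wp_assign, Expr.ok, Expr.eval, Expr.cost, true_and, true_or,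
        St.set_v, if_false, hv₃' 0 (by norm_num) (by norm_num),
        hv₃' 6 (by norm_num) (by norm_num), hE.v0, hE.v6, h17, hN₃.v7]
      refine wp_insertItem (H := H) (t := t) (l := leafOf n H (fun k => S k) (X.getD i 0)) (I := I)
        (z := ((n : ℤ) - j) * (2 * n * r + 1) + (cnt + 1)) (by norm_num) rfl
        (by simp [hv₃', hE.v3]) (by simp [hv₃', h13]) (by simp [hv₃', h12]) (by simp) hleaf
        (by simpa [ha₃ 3] using hT) ?_
      intro s₄ hv₄ ha₄ ht₄ hT₄
      simp only [St.set_v, St.set_a, St.set_time] at hv₄ ha₄ ht₄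
      have hv₄' : ∀ x, x < 14 → s₄.v x = s₃.v x := fun x hx => by
        rw [hv₄ x (by omega), if_neg (by omega), if_neg (by omega), if_neg (by omega)]
      simp +decide only [wp_assign, Expr.ok, Expr.eval, Expr.cost, true_and, hv₄' 13 (by norm_num), hv₃' 13 (by norm_num) (by norm_num),
        h13, ht1, or_true]
      rw [h4] at hN₃
      refine hQ _ (cnt + 1) (max len t) best' _ (fun x hx hx' => ?_) (fun b hb hb' => ?_) (by simp)
        ?_ le_rfl (hN₃.congr (fun x _ hx => ?_) ?_ ?_) (by simpa using hT₄) ?_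
      · rw [St.set_v, if_neg (by omega), hv₄' x (by omega), hv₃' x hx (by omega)]
      · rw [St.set_a, ha₄ b hb, ha₃ b hb']
      · simp; omega
      · rw [St.set_v, if_neg (by omega), hv₄' x (by omega)]
      · rw [St.set_a, ha₄ 5 (by norm_num)]
      · rw [St.set_a, ha₄ 6 (by norm_num)]
      · rw [St.set_a, ha₄ 5 (by norm_num), ha₄ 6 (by norm_num)]
        refine hI.succ_of_insert hc₃ hnew h4 hcis hj fun j' hj' => ?_
        have := (hext j' hj').2
        omega
    · rw [hSk hlt'] at hjge
      refine hfinal _ (fun x hx => ?_) (by simpa using ha₂) ?_ fun j hj => ?_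
      · simp [show x ≠ 17 by omega, hv₂' x hx]
      · simp; omega
      · obtain ⟨h1, h2⟩ := hext j hj
        obtain ⟨Z, -, -, -, hjn, -⟩ := hj
        omega
  · refine hfinal _ (fun x hx => ?_) (by simpa using ha₂) ?_ fun j hj => ?_
    · simp [hv₂' x hx]
    · simp; omega
    · have := (hext j hj).1
      omega

/-- Process all levels up to `♯4` for all elements of `X`. -/
def phaseA : Cmd :=
  44 ≔ ♭0 ;; 45 ≔ ♯3 ;; 46 ≔ (♯0 +. ♭1) *. ♯6 ;; insertItem 3 ;;
  7 ≔ ♭0 ;; 8 ≔ ♭0 ;; 9 ≔ ♭0 ;; 10 ≔ ♭0 ;;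
  .loop ♯10 ♯0 (locate ;; 13 ≔ ♭1 ;; .loop ♯13 (♯4 +. ♭1) stepA ;; 10 ≔ ♯10 +. ♭1)

/-- Each of the `n * r` level steps adds at most one node. Completeness after the last element,
applied with the whole of `Y`, gives an item at the level of each chain of length at most `r`, and
levels with items do not exceed the recorded length. -/
theorem wp_phaseA {n H r : ℕ} {X Y : List ℤ} {S : ℤ → ℤ} {Q : St → Prop} {s : St}
    (hE : Env n H r X Y (fun k => S k) s) (hS : IsSorted n (fun j => Y.getD j 0) fun k => S k)
    (hX : X.length = n) (hY : Y.length = n) (hH : n + 2 ≤ 2 ^ H) (hnM : (n : ℤ) < M)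
    (hrM : (r : ℤ) + 1 ≤ M ^ 3) (hD : (2 * n * r + 1 : ℤ) ≤ M ^ 6) (hB : B = 2 * n)
    (h3 : s.a 3 = fun _ => 0)
    (hQ : ∀ (s' : St) (cnt len best : ℕ), (∀ x, x < 7 → s'.v x = s.v x) →
      (∀ b, b ≠ 3 → b < 5 → s'.a b = s.a b) →
      s'.time ≤ s.time + 400 * (H + 2) * ((r + 1) * (n + 1)) → cnt ≤ n * r →
      Nodes X Y s' cnt len best →
      (∀ Z, IsCommonIncSubseq Z X Y → Z.length ≤ r → Z.length ≤ len) → Q s') :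
    wp varSize arrSize M B phaseA Q s := by
  have hf : ∀ x, x < 7 → x ≠ 7 ∧ x ≠ 8 ∧ x ≠ 9 ∧ x ≠ 10 ∧ x ≠ 13 ∧ x ≠ 44 ∧ x ≠ 45 ∧ x ≠ 46 :=
    fun x hx => by omega
  have hleaf : IsLeaf H (2 ^ H) := ⟨le_rfl, by rw [pow_succ]; omega⟩
  have hempty : TreeRep H (cell H (s.a 3)) fun _ _ _ => False := by
    rw [h3]; exact TreeRep.empty H
  unfold phaseA
  simp +decide only [wp_seq, wp_assign, Expr.ok, Expr.eval, Expr.cost, true_and, true_or,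
    St.set_v, if_false, hE.v0, hE.v3, hE.v6]
  refine wp_insertItem (H := H) (t := 0) (l := 2 ^ H) (z := ((n : ℤ) + 1) * (2 * n * r + 1))
    (by norm_num) rfl (by simp [hE.v3]) (by simp) (by simp) (by simp) hleaf
    (by simpa using hempty) ?_
  intro s₁ hv₁ ha₁ ht₁ hT₁
  simp only [St.set_v, St.set_a, St.set_time] at hv₁ ha₁ ht₁
  simp +decide only [wp_seq, wp_assign, Expr.ok, Expr.eval, Expr.cost, true_and, true_or]
  -- A level step costs `300 * (H + 2)`; the surplus pays for the loop guard. The constant is kept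
  -- opaque so that the nonlinear products remain atoms for `omega`.
  obtain ⟨T, hTdef⟩ : ∃ T, T = 310 * (H + 2) := ⟨_, rfl⟩
  refine wp_loop (fun k s' => (∀ x, x < 7 → s'.v x = s.v x) ∧
    (∀ b, b ≠ 3 → b < 5 → s'.a b = s.a b) ∧
    s'.time + T * (r + 1) * k ≤ s.time + T + T * (r + 1) * n ∧
    ∃ (i cnt len best : ℕ) (I : ℕ → ℕ → ℤ → Prop), i + k = n ∧ s'.v 10 = i ∧ cnt ≤ i * r ∧
      Nodes X Y s' cnt len best ∧ TreeRep H (cell H (s'.a 3)) I ∧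
      InvA n H r X Y S (s'.a 5) (s'.a 6) cnt len i 1 I) ?_ n ?_
  · rintro k s₂ ⟨hv₂, ha₂, ht₂, i, cnt, len, best, I, hik, h10, hcnt, hN, hT, hI⟩
    have hE₂ := hE.congr hv₂ fun b hb => ha₂ b (by omega) (by omega)
    refine ⟨trivial, trivial, fun hlt => ?_, fun hge => ?_⟩
    · simp only [Expr.eval, h10, hE₂.v0] at hlt
      have hi : i < n := by exact_mod_cast hlt
      obtain ⟨k, rfl⟩ : ∃ k', k = k' + 1 := ⟨k - 1, by omega⟩
      refine ⟨k, rfl, ?_⟩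
      rw [Nat.mul_succ] at ht₂
      rw [wp_seq]
      refine wp_locate (hE₂.congr (s' := s₂.tick _) (fun _ _ => rfl) fun _ _ => rfl) hS hnM hH hB
        h10 hi ?_
      intro s₃ hv₃ ha₃ h11₃ h12₃ _ ht₃
      simp only [St.tick_v, St.tick_a, St.tick_time, Expr.cost] at hv₃ ha₃ ht₃
      simp +decide only [wp_seq, wp_assign, Expr.ok, Expr.eval, Expr.cost, true_and, true_or]
      refine wp_loop (fun l s' => (∀ x, x < 7 ∨ 9 < x → x < 13 → s'.v x = s₃.v x) ∧
        (∀ b, b ≠ 3 → b < 5 → s'.a b = s.a b) ∧ s'.time + T * l ≤ s₃.time + 10 + T * r ∧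
        ∃ (t cnt len best : ℕ) (I : ℕ → ℕ → ℤ → Prop), t + l = r + 1 ∧ 0 < t ∧ s'.v 13 = t ∧
          cnt + 1 ≤ i * r + t ∧
          Nodes X Y s' cnt len best ∧ TreeRep H (cell H (s'.a 3)) I ∧
          InvA n H r X Y S (s'.a 5) (s'.a 6) cnt len i t I) ?_ r ?_
      · rintro l s₄ ⟨hv₄, ha₄, ht₄, t, cnt, len, best, I, htl, ht0, h13, hcnt, hN, hT, hI⟩
        have hv₄' : ∀ x, x < 7 → s₄.v x = s.v x := fun x hx => by
          rw [hv₄ x (by omega) (by omega), hv₃ x (by omega), hv₂ x hx]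
        have hE₄ := hE.congr hv₄' fun b hb => ha₄ b (by omega) (by omega)
        refine ⟨trivial, ⟨trivial, trivial⟩, fun hlt => ?_, fun hge => ?_⟩
        · simp only [Expr.eval, h13, hE₄.v4] at hlt
          have htr : t ≤ r := by omega
          obtain ⟨l, rfl⟩ : ∃ l', l = l' + 1 := ⟨l - 1, by omega⟩
          refine ⟨l, rfl, ?_⟩
          rw [Nat.mul_succ] at ht₄
          have hir : i * r + r ≤ n * r := by nlinarith
          refine wp_stepA (hE₄.congr (s' := s₄.tick _) (fun _ _ => rfl) fun _ _ => rfl) hS hX hY hH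
            hnM hrM hD hi (by simpa [hv₄] using h11₃) (by simpa [hv₄] using h12₃)
            (by simpa using h13) ht0 htr (hN.congr (fun _ _ _ => rfl) rfl rfl)
            (by nlinarith) (by simpa using hT) (by simpa using hI) ?_
          intro s₅ cnt' len' best' I' hv₅ ha₅ h13₅ ht₅ hcnt' hN₅ hT₅ hI₅
          simp only [St.tick_v, St.tick_a, St.tick_time, Expr.cost] at hv₅ ha₅ ht₅
          exact ⟨fun x hx hx' => (hv₅ x hx hx').trans (hv₄ x hx hx'),
            fun b hb hb' => (ha₅ b hb hb').trans (ha₄ b hb hb'), by omega,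
            t + 1, cnt', len', best', I', by omega, by omega, by simpa using h13₅, by omega,
            hN₅, hT₅, hI₅⟩
        · simp only [Expr.eval, h13, hE₄.v4] at hge
          obtain rfl : t = r + 1 := by omega
          have h10₄ : s₄.v 10 = i := by
            rw [hv₄ 10 (by omega) (by omega), hv₃ 10 (by omega), h10]
          have hsz : |(i : ℤ) + 1| ≤ M ^ varSize 10 := by
            rw [abs_of_nonneg (by positivity)]
            norm_num [varSize]; omega
          simp +decide only [wp_assign, Expr.ok, Expr.eval, Expr.cost, true_and, St.tick_v, h10₄,
            hsz, or_true]
          refine ⟨fun x hx => ?_, ha₄, ?_, i + 1, cnt, len, best, I, by omega, by simp, ?_,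
            hN.congr (fun x hx hx' => ?_) rfl rfl, hT, hI.next (by omega) hS hY⟩
          · simp [hf x hx, hv₄' x hx]
          · simp
            have e : T * (r + 1) = T * r + T := Nat.mul_succ T r
            generalize T * (r + 1) * k = W at *
            generalize T * (r + 1) * n = W' at *
            omega
          · rw [Nat.succ_mul]; omega
          · simp [show x ≠ 10 by omega]
      · refine ⟨fun x hx hx' => ?_, fun b hb hb' => ?_, ?_, 1, cnt, len, best, I, by omega,
          by omega, by simp, by omega, hN.congr (fun x hx hx' => ?_) ?_ ?_, ?_, ?_⟩
        · simp [show x ≠ 13 by omega]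
        · rw [St.set_a, ha₃, ha₂ b hb hb']
        · simp
        · rw [St.set_v, if_neg (by omega), hv₃ x (by omega)]
        · rw [St.set_a, ha₃]
        · rw [St.set_a, ha₃]
        · rw [St.set_a, ha₃]; exact hT
        · rw [St.set_a, ha₃]; exact hI
    · simp only [Expr.eval, h10, hE₂.v0] at hge
      obtain rfl : i = n := by omega
      refine hQ _ cnt len best hv₂ ha₂ ?_ hcnt (hN.congr (fun _ _ _ => rfl) rfl rfl) ?_
      · simp only [St.tick_time, Expr.cost]
        have h1 : T * (r + 1) * i + T * (r + 1) = T * ((r + 1) * (i + 1)) := by ring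
        have h2 : 1 ≤ (r + 1) * (i + 1) := Nat.mul_pos (by omega) (by omega)
        have h3 : T * 1 ≤ T * (r + 1) := Nat.mul_le_mul_left _ (by omega)
        have h4 : 1 ≤ (H + 2) * ((r + 1) * (i + 1)) := Nat.mul_pos (by omega) h2
        rw [hTdef] at h1 h3 ht₂
        simp only [mul_assoc] at *
        omega
      · intro Z hZ hZr
        obtain ⟨l, z, hIz, -⟩ := hI.complete Z i le_rfl hZr
          (.of_isCommonIncSubseq hZ hX.le hY.le)
        exact hI.le_len _ _ _ hIz
  · refine ⟨fun x hx => ?_, fun b hb _ => ?_, ?_, 0, 0, 0, 0, _, by omega, by simp, by omega,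
      ⟨by simp, by simp, by simp, le_rfl, [], .nil, rfl, .nil, List.nil_sublist _,
        List.nil_sublist _⟩, hT₁.congr fun u l z => ?_, InvA.init⟩
    · simp [hf x hx, hv₁ x (by omega)]
    · simpa using ha₁ b hb
    · simp; omega
    · simp

end WordRAM

namespace WordRAM

/-! ### Second phase: rare values -/

/-- The value `v` occurs at most `r` times in `Y`. -/
def Light (n r : ℕ) (S : ℤ → ℤ) (v : ℤ) : Prop :=
  firstGE n (fun k => S k) (v * n) + r < n →
    v * n + n ≤ S (firstGE n (fun k => S k) (v * n) + r : ℕ)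

/-- The item `z` at the leaves `l₁` and `l₂` describes an increasing common subsequence of the
first `i` elements of `X` and the first `l₂ - 2 ^ H + 1` elements of `Y`. -/
def ItemB (n H r : ℕ) (X Y : List ℤ) (S nv np : ℤ → ℤ) (cnt i l₁ l₂ : ℕ) (z : ℤ) : Prop :=
  ∃ (j id : ℕ) (Z : List ℤ), z = Z.length * (2 * n * r + 1) + id ∧ l₂ = 2 ^ H + j ∧ id ≤ cnt ∧
    Chain nv np id Z ∧ IsPrefixCIS X Y i (j + 1) Z ∧ ∀ w ∈ Z, leafOf n H (fun k => S k) w ≤ l₁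

theorem ItemB.mono {n H r : ℕ} {X Y : List ℤ} {S nv np nv' np' : ℤ → ℤ}
    {cnt cnt' i i' l₁ l₂ : ℕ} {z : ℤ} (h : ItemB n H r X Y S nv np cnt i l₁ l₂ z)
    (hc : ∀ (k : ℕ) (W : List ℤ), k ≤ cnt → Chain nv np k W → Chain nv' np' k W)
    (hcnt : cnt ≤ cnt') (hi : i ≤ i') : ItemB n H r X Y S nv' np' cnt' i' l₁ l₂ z := by
  obtain ⟨j, id, Z, h1, h2, h3, h4, h5, h6⟩ := h
  exact ⟨j, id, Z, h1, h2, h3.trans hcnt, hc _ _ h3 h4, h5.mono hi le_rfl, h6⟩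

/-- `Z` is an increasing common subsequence of rare values that can be extended by the `i`-th
element of `X`, using only elements of `Y` before the `j`-th. -/
structure LightExt (n r : ℕ) (X Y : List ℤ) (S : ℤ → ℤ) (i j : ℕ) (Z : List ℤ) : Prop where
  light : ∀ w ∈ Z, Light n r S w
  cis : IsPrefixCIS X Y i j Z
  lt : ∀ w ∈ Z, w < X.getD i 0
  pos : j < Y.length

/-- The items are complete for the first `i` elements of `X`. -/
def CompleteB (n H r : ℕ) (X Y : List ℤ) (S : ℤ → ℤ) (i : ℕ) (I : ℕ → ℕ → ℤ → Prop) : Prop :=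
  ∀ (Z : List ℤ) (c : ℕ), Z ≠ [] → (∀ w ∈ Z, Light n r S w) → IsPrefixCIS X Y i c Z →
    ∃ l₁ l₂ z, I l₁ l₂ z ∧ (Z.length : ℤ) * (2 * n * r + 1) ≤ z ∧ l₂ < 2 ^ H + c ∧
      ∀ v, (∀ w ∈ Z, w < v) → l₁ < leafOf n H (fun k => S k) v

/-- The state of the search tree before index `k` is processed for the `i`-th element of `X`. -/
structure InvB (n H r : ℕ) (X Y : List ℤ) (S nv np : ℤ → ℤ) (cnt len i k : ℕ)
    (I : ℕ → ℕ → ℤ → Prop) : Prop where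
  sound : ∀ l₁ l₂ z, I l₁ l₂ z → ItemB n H r X Y S nv np cnt i l₁ l₂ z ∨
    l₁ = leafOf n H (fun k => S k) (X.getD i 0) ∧ ItemB n H r X Y S nv np cnt (i + 1) l₁ l₂ z
  complete : CompleteB n H r X Y S i I
  done : ∀ (j k' : ℕ) (Z : List ℤ), k' < k → k' < n → S k' = X.getD i 0 * n + j →
    LightExt n r X Y S i j Z →
    ∃ z, I (leafOf n H (fun k => S k) (X.getD i 0)) (2 ^ H + j) z ∧
      ((Z.length : ℤ) + 1) * (2 * n * r + 1) ≤ z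
  le_len : ∀ l₁ l₂ z, I l₁ l₂ z → z < ((len : ℤ) + 1) * (2 * n * r + 1)

section

variable {n H r : ℕ} {X Y : List ℤ} {S nv np : ℤ → ℤ} {cnt len i k : ℕ}
  {I : ℕ → ℕ → ℤ → Prop}

/-- What the best item says about the next element. -/
theorem InvB.best (h : InvB n H r X Y S nv np cnt len i k I) (hcnt : cnt < 2 * n * r + 1)
    {j : ℕ} {e : ℤ}
    (he : IsBest (fun z => ∃ l₁ l₂, I l₁ l₂ z ∧ l₁ < leafOf n H (fun k => S k) (X.getD i 0) ∧
      l₂ < 2 ^ H + j) e) :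
    ∃ (id : ℕ) (Z : List ℤ), e = Z.length * (2 * n * r + 1) + id ∧ id ≤ cnt ∧
      e / (2 * n * r + 1) = Z.length ∧ Chain nv np id Z ∧ IsPrefixCIS X Y i j Z ∧
      (∀ w ∈ Z, w < X.getD i 0) ∧ ∀ Z', LightExt n r X Y S i j Z' → Z'.length ≤ Z.length := by
  have hD : (cnt : ℤ) < 2 * n * r + 1 := by exact_mod_cast hcnt
  have hext : ∀ Z', LightExt n r X Y S i j Z' → (Z'.length : ℤ) * (2 * n * r + 1) ≤ e := by
    intro Z' hZ'
    -- The empty chain has no item in this phase. It corresponds to the default value `0`, which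
    -- encodes length `0` and node `0`.
    by_cases hnil : Z' = []
    · subst hnil; simpa using he.nonneg
    · obtain ⟨l₁, l₂, z, h1, h2, h3, h4⟩ := h.complete Z' j hnil hZ'.light hZ'.cis
      exact h2.trans (he.ge z ⟨l₁, l₂, h1, h4 _ hZ'.lt, h3⟩)
  obtain ⟨id, Z, h1, h2, h3, h4, h5⟩ : ∃ (id : ℕ) (Z : List ℤ),
      e = Z.length * (2 * n * r + 1) + id ∧ id ≤ cnt ∧ Chain nv np id Z ∧ IsPrefixCIS X Y i j Z ∧
      ∀ w ∈ Z, w < X.getD i 0 := by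
    rcases he.mem with rfl | ⟨l₁, l₂, hI, hl₁, hl₂⟩
    · exact ⟨0, [], by simp, by omega, .nil, .nil, by simp⟩
    · obtain ⟨j', id, Z, h1, h2, h3, h4, h5, h6⟩ : ItemB n H r X Y S nv np cnt i l₁ l₂ e := by
        rcases h.sound _ _ _ hI with h | h
        · exact h
        · omega
      exact ⟨id, Z, h1, h3, h4, h5.mono le_rfl (by omega),
        fun w hw => lt_of_leafOf_lt ((h6 w hw).trans_lt hl₁)⟩
  have hdiv : e / (2 * n * r + 1) = Z.length := by
    rw [h1, add_comm, Int.add_mul_ediv_right _ _ (by positivity),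
      Int.ediv_eq_zero_of_lt (by omega) (by omega), zero_add]
  refine ⟨id, Z, h1, h2, hdiv, h3, h4, h5, fun Z' hZ' => ?_⟩
  have := (Int.le_ediv_iff_mul_le (by positivity)).2 (hext Z' hZ')
  omega

/-- The entry at index `k` does not belong to the current value, so no new obligation arises. -/
theorem InvB.succ_of_not (h : InvB n H r X Y S nv np cnt len i k I)
    (hno : k < n → ∀ j : ℕ, j < Y.length → S k ≠ X.getD i 0 * n + j) :
    InvB n H r X Y S nv np cnt len i (k + 1) I where
  sound := h.sound
  complete := h.complete
  done j k' Z hk' hn hS hZ := by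
    rcases Nat.lt_succ_iff_lt_or_eq.1 hk' with hk' | rfl
    · exact h.done j k' Z hk' hn hS hZ
    · exact absurd hS (hno hn j hZ.pos)
  le_len := h.le_len

/-- For a fixed pair of positions in `X` and `Y` only the length matters, so one item with a longest
admissible predecessor covers all chains ending there. -/
theorem InvB.succ_of_insert (h : InvB n H r X Y S nv np cnt len i k I)
    (hcnt : cnt + 1 < 2 * n * r + 1) {nv' np' : ℤ → ℤ} {Z : List ℤ} {j : ℕ}
    (hc : ∀ (k : ℕ) (W : List ℤ), k ≤ cnt → Chain nv np k W → Chain nv' np' k W)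
    (hnew : Chain nv' np' (cnt + 1) (Z ++ [X.getD i 0]))
    (hcis : IsPrefixCIS X Y (i + 1) (j + 1) (Z ++ [X.getD i 0]))
    (hSk : S k = X.getD i 0 * n + j)
    (hmax : ∀ Z', LightExt n r X Y S i j Z' → Z'.length ≤ Z.length) :
    InvB n H r X Y S nv' np' (cnt + 1) (max len (Z.length + 1)) i (k + 1) fun l₁ l₂ y =>
      I l₁ l₂ y ∨ l₁ = leafOf n H (fun k => S k) (X.getD i 0) ∧ l₂ = 2 ^ H + j ∧
        y = ((Z.length : ℤ) + 1) * (2 * n * r + 1) + (cnt + 1) where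
  sound := by
    rintro l₁ l₂ z (hI | ⟨rfl, rfl, rfl⟩)
    · rcases h.sound l₁ l₂ z hI with h | ⟨h', h⟩
      · exact Or.inl (h.mono hc (by omega) le_rfl)
      · exact Or.inr ⟨h', h.mono hc (by omega) le_rfl⟩
    · refine Or.inr ⟨rfl, j, cnt + 1, _, by simp, rfl, le_rfl, hnew, hcis,
        fun w hw => leafOf_mono ?_⟩
      rcases List.mem_append.1 hw with hw' | hw'
      · exact ((List.pairwise_append.1 hcis.pairwise).2.2 w hw' _ (by simp)).le
      · exact (List.mem_singleton.1 hw').le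
  complete := fun Z c h1 h2 h3 =>
    let ⟨l₁, l₂, z, h4, h5⟩ := h.complete Z c h1 h2 h3
    ⟨l₁, l₂, z, Or.inl h4, h5⟩
  done j' k' Z' hk' hn hS hZ' := by
    rcases Nat.lt_succ_iff_lt_or_eq.1 hk' with hk' | rfl
    · obtain ⟨z, h1, h2⟩ := h.done j' k' Z' hk' hn hS hZ'
      exact ⟨z, Or.inl h1, h2⟩
    · obtain rfl : j' = j := by omega
      refine ⟨_, Or.inr ⟨rfl, rfl, rfl⟩, ?_⟩
      have := hmax Z' hZ'
      have := mul_le_mul_of_nonneg_right (show (Z'.length : ℤ) + 1 ≤ Z.length + 1 by omega)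
        (by positivity : (0 : ℤ) ≤ 2 * n * r + 1)
      linarith
  -- The bound concerns the packed number, not the chain: node numbers are below `2 * n * r + 1`, so
  -- `z` stays under the next multiple, and comparison with completeness bounds lengths.
  le_len := by
    have hD : ((cnt : ℤ) + 1) < 2 * n * r + 1 := by exact_mod_cast hcnt
    have hD' : (0 : ℤ) ≤ 2 * n * r + 1 := by positivity
    rintro l₁ l₂ z (hI | ⟨-, -, rfl⟩)
    · have h1 := h.le_len l₁ l₂ z hI
      have := mul_le_mul_of_nonneg_right
        (show (len : ℤ) + 1 ≤ (max len (Z.length + 1) : ℕ) + 1 by omega) hD'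
      linarith
    · have := mul_le_mul_of_nonneg_right
        (show (Z.length : ℤ) + 1 + 1 ≤ (max len (Z.length + 1) : ℕ) + 1 by omega) hD'
      linarith

/-- Continue with the next element of `X`. -/
theorem InvB.next {k' : ℕ} (h : InvB n H r X Y S nv np cnt len i
      (firstGE n (fun k => S k) (X.getD i 0 * n) + r) I) (hi : i < X.length)
    (hS : IsSorted n (fun j => Y.getD j 0) fun k => S k) (hY : Y.length = n)
    (hk' : k' = firstGE n (fun k => S k) (X.getD (i + 1) 0 * n)) :
    InvB n H r X Y S nv np cnt len (i + 1) k' I where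
  sound l₁ l₂ z hI := Or.inl <| by
    rcases h.sound l₁ l₂ z hI with h | ⟨-, h⟩
    · exact h.mono (fun _ _ _ h => h) le_rfl (by omega)
    · exact h
  complete Z c hne hZ hcis := by
    rcases hcis.cases hi with h' | ⟨Z', j, rfl, h1, h2, h3, h4, h5⟩
    · exact h.complete Z c hne hZ h'
    · obtain ⟨k, hk, he⟩ := hS.exists_eq j (hY ▸ h2)
      rw [h3] at he
      -- This is the only place where lightness matters: the block of a light value ends within `r`
      -- entries, so the loop over `r` occurrences has reached index `k`.
      have hkr : k < firstGE n (fun k => S k) (X.getD i 0 * n) + r := by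
        by_contra hge
        have hl := hZ (X.getD i 0) (by simp)
        have h6 := hl (by omega)
        have h7 := hS.le (not_lt.1 hge) hk
        omega
      obtain ⟨z, h6, h7⟩ := h.done j k Z' hkr hk he
        ⟨fun w hw => hZ w (by simp [hw]), h4, h5, h2⟩
      refine ⟨_, _, z, h6, ?_, by omega, fun v hv => ?_⟩
      · simpa using h7
      · exact leafOf_lt hS (hY ▸ h2) h3 (hv _ (by simp))
  done j k Z hk _ he hZ := by
    have := (hS.isLB (X.getD (i + 1) 0 * n)).lt k (by omega)
    omega
  le_len := h.le_len

/-- All keys before the start of a block are below the keys of its value, so `done` is vacuous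
there. -/
theorem InvB.init (hS : IsSorted n (fun j => Y.getD j 0) fun k => S k) :
    InvB n H r X Y S nv np cnt len 0 (firstGE n (fun k => S k) (X.getD 0 0 * n))
      fun _ _ _ => False where
  sound := by simp
  complete Z c hne hZ hcis := absurd (by simpa using hcis.left) hne
  done j k Z hk _ he hZ := by
    have := (hS.isLB (X.getD 0 0 * n)).lt k hk
    omega
  le_len := by simp

end

/-- Process the `♯13`-th entry of array `1`. -/
def stepB : Cmd :=
  .ite ♯13 ♯0
    (17 ≔ .arr 1 ♯13 -. ♯11 *. ♯0 ;;
     .ite ♯17 ♯0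
      (30 ≔ ♯12 ;; 31 ≔ ♯3 +. ♯17 ;; query₂ ;; 14 ≔ ♯32 ;; 16 ≔ ♯14 /. ♯6 +. ♭1 ;; newNode ;;
       30 ≔ ♯12 ;; 31 ≔ ♯3 +. ♯17 ;; 32 ≔ ♯16 *. ♯6 +. ♯7 ;; insertItem₂)
      .skip)
    .skip ;;
  13 ≔ ♯13 +. ♭1

variable {M B : ℤ}

-- Index `k` is not before the start of the block, so the difference to `x * n` is nonnegative; it
-- is a position of an occurrence of `x` exactly if it is below `n`. The query at leaves `leafOf x`
-- and `2 ^ H + j` then imposes smaller values and earlier positions.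
set_option maxHeartbeats 1000000 in
theorem wp_stepB {n H r i k cnt len best : ℕ} {X Y : List ℤ} {S : ℤ → ℤ} {I : ℕ → ℕ → ℤ → Prop}
    {Q : St → Prop} {s : St}
    (hE : Env n H r X Y (fun k => S k) s) (hS : IsSorted n (fun j => Y.getD j 0) fun k => S k)
    (hX : X.length = n) (hY : Y.length = n) (hH : n + 2 ≤ 2 ^ H) (hnM : (n : ℤ) < M)
    (hkM : (k : ℤ) + 1 ≤ M ^ 3) (hD : (2 * n * r + 1 : ℤ) ≤ M ^ 6)
    (hi : i < n) (h11 : s.v 11 = X.getD i 0)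
    (h12 : s.v 12 = leafOf n H (fun k => S k) (X.getD i 0)) (h13 : s.v 13 = k)
    (hk : firstGE n (fun k => S k) (X.getD i 0 * n) ≤ k)
    (hN : Nodes X Y s cnt len best) (hcnt : cnt + 1 < 2 * n * r + 1)
    (hT : TreeRep₂ H (s.a 4) I)
    (hI : InvB n H r X Y S (s.a 5) (s.a 6) cnt len i k I)
    (hQ : ∀ (s' : St) (cnt' len' best' : ℕ) (I' : ℕ → ℕ → ℤ → Prop),
      (∀ x, x < 7 ∨ 9 < x → x < 16 → x ≠ 13 → x ≠ 14 → s'.v x = s.v x) →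
      (∀ b, b < 4 → s'.a b = s.a b) →
      s'.v 13 = k + 1 → s'.time ≤ s.time + 300 * ((H + 2) * (H + 2)) → cnt' ≤ cnt + 1 →
      len ≤ len' →
      Nodes X Y s' cnt' len' best' → TreeRep₂ H (s'.a 4) I' →
      InvB n H r X Y S (s'.a 5) (s'.a 6) cnt' len' i (k + 1) I' → Q s') :
    wp varSize arrSize M B stepB Q s := by
  have hleaf : IsLeaf H (leafOf n H (fun k => S k) (X.getD i 0)) := isLeaf_leafOf hS hH _
  have hsq : 4 ≤ (H + 2) * (H + 2) := by nlinarith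
  have hk1 : |(k : ℤ) + 1| ≤ M ^ varSize 13 := by
    rw [abs_of_nonneg (by positivity)]
    have : varSize 13 = 3 := rfl
    rw [this]; omega
  have hk0 : (0 : ℤ) ≤ k := by positivity
  have hfinal : ∀ s₃ : St, (∀ x, x < 16 → s₃.v x = s.v x) → s₃.a = s.a →
      s₃.time ≤ s.time + 100 → (k < n → ∀ j : ℕ, j < Y.length → S k ≠ X.getD i 0 * n + j) →
      Q (s₃.set 13 (k + 1) (1 + 1 + 1 + 1)) := by
    intro s₃ hv₃ ha₃ ht₃ hno
    refine hQ _ cnt len best I (fun x _ hx hx' _ => ?_) (fun b _ => by rw [St.set_a, ha₃])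
      (by simp) ?_ (by omega) le_rfl
      (hN.congr (fun x _ hx => ?_) (by rw [St.set_a, ha₃]) (by rw [St.set_a, ha₃]))
      (by rw [St.set_a, ha₃]; exact hT) (by rw [St.set_a, ha₃]; exact hI.succ_of_not hno)
    · rw [St.set_v, if_neg (by omega), hv₃ x (by omega)]
    · simp; omega
    · rw [St.set_v, if_neg (by omega), hv₃ x (by omega)]
  unfold stepB
  simp +decide only [wp_ite, wp_seq, wp_skip, wp_assign, Expr.ok, Expr.eval, Expr.cost, true_and,
    true_or, hE.v0, hE.v3, h11, h12, h13, hk0, hk1, or_true, false_imp_iff, St.tick_v,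
    St.tick_a, St.set_v, if_true, if_false]
  refine ⟨fun hlt => ?_, fun hge => ?_⟩
  · have hlt' : k < n := by exact_mod_cast hlt
    have hSk : s.a 1 k = S k := hE.S k hlt'
    refine ⟨fun hjlt => ?_, fun hjge => ?_⟩
    · rw [hSk] at hjlt
      have hz := (hS.isLB (X.getD i 0 * n)).ge k hk hlt'
      obtain ⟨j, hj, hSj, hyj⟩ := hS.eq_of_mem_range (v := X.getD i 0) hlt' hz (by omega)
      have hleaf₂ : IsLeaf H (2 ^ H + j) := isLeaf_add hH (by omega)
      refine wp_query₂ (H := H) (k := leafOf n H (fun k => S k) (X.getD i 0)) (l := 2 ^ H + j)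
        (I := I) (by simp [hE.v3]) (by simp) (by simpa [hSk] using hSj) hleaf hleaf₂
        (by simpa using hT) ?_
      intro s₁ hv₁ ha₁ ht₁ he
      simp only [St.set_v, St.set_a, St.set_time, St.tick_v, St.tick_a, St.tick_time]
        at hv₁ ha₁ ht₁
      have hv₁' : ∀ x, x < 17 → s₁.v x = s.v x := fun x hx => by
        rw [hv₁ x (by omega), if_neg (by omega), if_neg (by omega), if_neg (by omega)]
      have h17₁ : s₁.v 17 = j := by
        rw [hv₁ 17 (by omega), if_neg (by omega), if_neg (by omega), if_pos rfl, hSk, hSj]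
      obtain ⟨id, Z, h1, h2, hdiv, h3, h4, h5, hmax⟩ := hI.best (by omega) he
      have hcis := h4.snoc (hX ▸ hi) rfl le_rfl (hY ▸ hj) hyj h5
      simp +decide only [wp_seq, wp_assign, Expr.ok, Expr.eval, Expr.cost, true_and, true_or,
        St.set_v, if_true, if_false, hv₁' 6 (by norm_num), hE.v6, hdiv]
      refine wp_newNode (X := X) (Y := Y) (cnt := cnt) (len := len) (best := best) (Z := Z)
        (par := id) (id := 2 * n * r + 1) (v := X.getD i 0) (e := Z.length)
        (hN.congr (fun x hx hx' => ?_) ?_ ?_) ?_ (by omega) (by exact_mod_cast hD) ?_ ?_ h2 ?_ ?_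
        hcis.isCommonIncSubseq ?_
      · simp [show x ≠ 14 by omega, show x ≠ 16 by omega, hv₁' x (by omega)]
      · simp [ha₁]
      · simp [ha₁]
      · simp [hv₁', hE.v6]
      · simp [hv₁', h11]
      · simp [h1]
      · simpa [ha₁] using h3
      · simp
      intro s₃ best' hv₃ ha₃ ht₃ hc₃ hnew hN₃
      simp only [St.set_v, St.set_a, St.set_time, ha₁] at hv₃ ha₃ ht₃ hc₃ hnew
      have hv₃' : ∀ x, x < 7 ∨ 9 < x → x < 16 → x ≠ 14 → s₃.v x = s.v x := fun x hx hx' hx'' => by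
        rw [hv₃ x hx, if_neg (by omega), if_neg (by omega), hv₁' x (by omega)]
      have h17 : s₃.v 17 = j := by
        rw [hv₃ 17 (by omega), if_neg (by omega), if_neg (by omega), h17₁]
      have h16 : s₃.v 16 = Z.length + 1 := by
        rw [hv₃ 16 (by omega), if_pos rfl]
      -- The static size of the expression is too large here. The true value is small because a
      -- chain has at most `n` elements.
      have hsz : |((Z.length : ℤ) + 1) * (2 * n * r + 1) + ((cnt + 1 : ℕ) : ℤ)| ≤
          M ^ varSize 32 := by
        have hlen := hcis.length_le
        rw [hX, List.length_append, List.length_singleton] at hlen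
        have hlen' : (Z.length : ℤ) + 1 ≤ n := by exact_mod_cast hlen
        have hD' : (0 : ℤ) ≤ 2 * n * r + 1 := by positivity
        have hc : ((cnt + 1 : ℕ) : ℤ) ≤ 2 * n * r + 1 := by exact_mod_cast hcnt.le
        rw [abs_of_nonneg (by positivity)]
        calc ((Z.length : ℤ) + 1) * (2 * n * r + 1) + ((cnt + 1 : ℕ) : ℤ)
            ≤ ((n : ℤ) + 1) * (2 * n * r + 1) := by nlinarith
          _ ≤ M * M ^ 6 := mul_le_mul (by omega) hD hD' (by omega)
          _ = M ^ 7 := by ring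
          _ ≤ M ^ varSize 32 := pow_le_pow_right₀ (by omega) (by decide)
      simp +decide only [wp_seq, wp_assign, Expr.ok, Expr.eval, Expr.cost, true_and, true_or,
        St.set_v, if_false, hv₃' 3 (by norm_num) (by norm_num) (by norm_num),
        hv₃' 6 (by norm_num) (by norm_num) (by norm_num),
        hv₃' 12 (by norm_num) (by norm_num) (by norm_num), hE.v3, hE.v6, h12, h16, h17, hN₃.v7,
        hsz, or_true]
      refine wp_insertItem₂ (H := H) (k := leafOf n H (fun k => S k) (X.getD i 0))
        (l := 2 ^ H + j) (I := I)
        (z := ((Z.length : ℤ) + 1) * (2 * n * r + 1) + (cnt + 1))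
        (by simp [hv₃', hE.v3]) (by simp) (by simp) (by simp) hleaf hleaf₂
        (by simpa [ha₃ 4] using hT) ?_
      intro s₄ hv₄ ha₄ ht₄ hT₄
      simp only [St.set_v, St.set_a, St.set_time] at hv₄ ha₄ ht₄
      have hv₄' : ∀ x, x < 17 → s₄.v x = s₃.v x := fun x hx => by
        rw [hv₄ x (by omega), if_neg (by omega), if_neg (by omega), if_neg (by omega)]
      simp +decide only [wp_assign, Expr.ok, Expr.eval, Expr.cost, true_and,
        hv₄' 13 (by norm_num), hv₃' 13 (by norm_num) (by norm_num) (by norm_num),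
        h13, hk1, or_true]
      refine hQ _ (cnt + 1) (max len (Z.length + 1)) best' _ (fun x hx hx' h1 h2 => ?_)
        (fun b hb => ?_) (by simp) ?_ le_rfl (le_max_left _ _)
        (hN₃.congr (fun x _ hx => ?_) ?_ ?_) (by simpa using hT₄) ?_
      · rw [St.set_v, if_neg (by omega), hv₄' x (by omega), hv₃' x hx (by omega) h2]
      · rw [St.set_a, ha₄ b (by omega), ha₃ b (by omega)]
      · have hsq' : (H + 1) * (H + 1) ≤ (H + 2) * (H + 2) := by nlinarith
        generalize (H + 1) * (H + 1) = W at *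
        generalize (H + 2) * (H + 2) = W' at *
        simp; omega
      · rw [St.set_v, if_neg (by omega), hv₄' x (by omega)]
      · rw [St.set_a, ha₄ 5 (by norm_num)]
      · rw [St.set_a, ha₄ 6 (by norm_num)]
      · rw [St.set_a, ha₄ 5 (by norm_num), ha₄ 6 (by norm_num)]
        exact hI.succ_of_insert hcnt hc₃ hnew hcis (by omega) hmax
    · rw [hSk] at hjge
      refine hfinal _ (fun x hx => ?_) rfl ?_ fun _ j hj => ?_
      · simp [show x ≠ 17 by omega]
      · simp
      · omega
  · refine hfinal _ (fun x hx => ?_) rfl ?_ fun hlt => ?_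
    · simp
    · simp
    · omega

theorem TreeRep₂.empty (H : ℕ) : TreeRep₂ H (fun _ => 0) fun _ _ _ => False :=
  ⟨by simp, (TreeRep.empty H).congr fun t l z => by simp [Spread]⟩

/-- Process up to `♯4` occurrences in `Y` of all elements of `X`. -/
def phaseB : Cmd :=
  10 ≔ ♭0 ;;
  .loop ♯10 ♯0
    (locate ;; 13 ≔ ♯41 ;; 15 ≔ ♯41 +. ♯4 ;; .loop ♯13 ♯15 stepB ;; 10 ≔ ♯10 +. ♭1)

/-- Node numbering continues after phase A, so that both phases together stay within `2 * n * r`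
nodes, and the record can only improve. -/
theorem wp_phaseB {n H r cnt₀ len₀ best₀ : ℕ} {X Y : List ℤ} {S : ℤ → ℤ} {Q : St → Prop} {s : St}
    (hE : Env n H r X Y (fun k => S k) s) (hS : IsSorted n (fun j => Y.getD j 0) fun k => S k)
    (hX : X.length = n) (hY : Y.length = n) (hH : n + 2 ≤ 2 ^ H) (hnM : (n : ℤ) < M)
    (hrM : (n : ℤ) + r ≤ M ^ 3) (hD : (2 * n * r + 1 : ℤ) ≤ M ^ 6) (hB : B = 2 * n)
    (h4 : s.a 4 = fun _ => 0) (hN : Nodes X Y s cnt₀ len₀ best₀) (hcnt₀ : cnt₀ ≤ n * r)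
    (hQ : ∀ (s' : St) (cnt len best : ℕ), (∀ x, x < 7 → s'.v x = s.v x) →
      s'.time ≤ s.time + 500 * ((H + 2) * (H + 2)) * ((r + 1) * (n + 1)) →
      Nodes X Y s' cnt len best → len₀ ≤ len →
      (∀ Z, IsCommonIncSubseq Z X Y → (∀ w ∈ Z, Light n r S w) → Z.length ≤ len) → Q s') :
    wp varSize arrSize M B phaseB Q s := by
  unfold phaseB
  simp +decide only [wp_seq, wp_assign, Expr.ok, Expr.eval, Expr.cost, true_and, true_or]
  obtain ⟨T, hTdef⟩ : ∃ T, T = 310 * ((H + 2) * (H + 2)) := ⟨_, rfl⟩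
  have hsq : 2 * (H + 2) ≤ (H + 2) * (H + 2) := Nat.mul_le_mul_right _ (by omega)
  have hnr : 2 * n * r = n * r + n * r := by ring
  refine wp_loop (fun k s' => (∀ x, x < 7 → s'.v x = s.v x) ∧
    (∀ b, b < 4 → s'.a b = s.a b) ∧
    s'.time + T * (r + 1) * k ≤ s.time + T + T * (r + 1) * n ∧
    ∃ (i cnt len best : ℕ) (I : ℕ → ℕ → ℤ → Prop), i + k = n ∧ s'.v 10 = i ∧
      cnt ≤ n * r + i * r ∧ len₀ ≤ len ∧ Nodes X Y s' cnt len best ∧ TreeRep₂ H (s'.a 4) I ∧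
      InvB n H r X Y S (s'.a 5) (s'.a 6) cnt len i
        (firstGE n (fun k => S k) (X.getD i 0 * n)) I) ?_ n ?_
  · rintro k s₂ ⟨hv₂, ha₂, ht₂, i, cnt, len, best, I, hik, h10, hcnt, hlen, hN, hT, hI⟩
    have hE₂ := hE.congr hv₂ fun b hb => ha₂ b (by omega)
    refine ⟨trivial, trivial, fun hlt => ?_, fun hge => ?_⟩
    · simp only [Expr.eval, h10, hE₂.v0] at hlt
      have hi : i < n := by exact_mod_cast hlt
      obtain ⟨k, rfl⟩ : ∃ k', k = k' + 1 := ⟨k - 1, by omega⟩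
      refine ⟨k, rfl, ?_⟩
      rw [Nat.mul_succ] at ht₂
      rw [wp_seq]
      refine wp_locate (hE₂.congr (s' := s₂.tick _) (fun _ _ => rfl) fun _ _ => rfl) hS hnM hH hB
        h10 hi ?_
      intro s₃ hv₃ ha₃ h11₃ h12₃ h41₃ ht₃
      have hk₀ := (hS.isLB (X.getD i 0 * n)).le
      generalize hk₀' : firstGE n (fun k => S k) (X.getD i 0 * n) = k₀ at *
      simp only [St.tick_v, St.tick_a, St.tick_time, Expr.cost] at hv₃ ha₃ ht₃
      simp +decide only [wp_seq, wp_assign, Expr.ok, Expr.eval, Expr.cost, true_and, true_or,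
        St.set_v, if_false, h41₃, hv₃ 4 (by norm_num), hE₂.v4]
      refine wp_loop (fun l s' => (∀ x, x < 7 ∨ 9 < x → x < 13 → s'.v x = s₃.v x) ∧
        s'.v 15 = k₀ + r ∧
        (∀ b, b < 4 → s'.a b = s.a b) ∧ s'.time + T * l ≤ s₃.time + 10 + T * r ∧
        ∃ (k cnt len best : ℕ) (I : ℕ → ℕ → ℤ → Prop), k + l = k₀ + r ∧ k₀ ≤ k ∧ s'.v 13 = k ∧
          cnt + k₀ ≤ n * r + i * r + k ∧ len₀ ≤ len ∧
          Nodes X Y s' cnt len best ∧ TreeRep₂ H (s'.a 4) I ∧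
          InvB n H r X Y S (s'.a 5) (s'.a 6) cnt len i k I) ?_ r ?_
      · rintro l s₄ ⟨hv₄, h15, ha₄, ht₄, t, cnt, len, best, I, htl, ht0, h13, hcnt, hlen, hN, hT,
          hI⟩
        have hv₄' : ∀ x, x < 7 → s₄.v x = s.v x := fun x hx => by
          rw [hv₄ x (by omega) (by omega), hv₃ x (by omega), hv₂ x hx]
        have hE₄ := hE.congr hv₄' fun b hb => ha₄ b (by omega)
        refine ⟨trivial, trivial, fun hlt => ?_, fun hge => ?_⟩
        · simp only [Expr.eval, h13, h15] at hlt
          obtain ⟨l, rfl⟩ : ∃ l', l = l' + 1 := ⟨l - 1, by omega⟩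
          refine ⟨l, rfl, ?_⟩
          rw [Nat.mul_succ] at ht₄
          have hir : i * r + r ≤ n * r := by nlinarith
          refine wp_stepB (hE₄.congr (s' := s₄.tick _) (fun _ _ => rfl) fun _ _ => rfl) hS hX hY hH
            hnM (k := t) (by omega) hD hi (by simpa [hv₄] using h11₃) (by simpa [hv₄] using h12₃)
            (by simpa using h13) (by omega) (hN.congr (fun _ _ _ => rfl) rfl rfl)
            (by omega) (by simpa using hT) (by simpa using hI) ?_
          intro s₅ cnt' len' best' I' hv₅ ha₅ h13₅ ht₅ hcnt' hlen' hN₅ hT₅ hI₅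
          simp only [St.tick_v, St.tick_a, St.tick_time, Expr.cost] at hv₅ ha₅ ht₅
          exact ⟨fun x hx hx' => (hv₅ x hx (by omega) (by omega) (by omega)).trans (hv₄ x hx hx'),
            (hv₅ 15 (by omega) (by omega) (by omega) (by omega)).trans h15,
            fun b hb => (ha₅ b hb).trans (ha₄ b hb), by omega,
            t + 1, cnt', len', best', I', by omega, by omega, by simpa using h13₅, by omega,
            hlen.trans hlen', hN₅, hT₅, hI₅⟩
        · simp only [Expr.eval, h13, h15] at hge
          obtain rfl : t = k₀ + r := by omega
          have h10₄ : s₄.v 10 = i := by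
            rw [hv₄ 10 (by omega) (by omega), hv₃ 10 (by omega), h10]
          have hsz : |(i : ℤ) + 1| ≤ M ^ varSize 10 := by
            rw [abs_of_nonneg (by positivity)]
            norm_num [varSize]; omega
          simp +decide only [wp_assign, Expr.ok, Expr.eval, Expr.cost, true_and, St.tick_v, h10₄,
            hsz, or_true]
          subst hk₀'
          refine ⟨fun x hx => ?_, ha₄, ?_, i + 1, cnt, len, best, I, by omega, by simp, ?_, hlen,
            hN.congr (fun x hx hx' => ?_) rfl rfl, hT, hI.next (by omega) hS hY rfl⟩
          · simp [show x ≠ 10 by omega, hv₄' x hx]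
          · simp
            have e : T * (r + 1) = T * r + T := Nat.mul_succ T r
            generalize T * (r + 1) * k = W at *
            generalize T * (r + 1) * n = W' at *
            omega
          · rw [Nat.succ_mul]; omega
          · simp [show x ≠ 10 by omega]
      · refine ⟨fun x hx hx' => ?_, by simp, fun b hb => ?_, ?_, k₀, cnt, len, best, I, by omega,
          le_rfl, by simp, by omega, hlen, hN.congr (fun x hx hx' => ?_) ?_ ?_, ?_, ?_⟩
        · simp [show x ≠ 13 by omega, show x ≠ 15 by omega]
        · rw [St.set_a, St.set_a, ha₃, ha₂ b hb]
        · simp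
        · rw [St.set_v, if_neg (by omega), St.set_v, if_neg (by omega), hv₃ x (by omega)]
        · rw [St.set_a, St.set_a, ha₃]
        · rw [St.set_a, St.set_a, ha₃]
        · rw [St.set_a, St.set_a, ha₃]; exact hT
        · rw [St.set_a, St.set_a, ha₃]; exact hI
    · simp only [Expr.eval, h10, hE₂.v0] at hge
      obtain rfl : i = n := by omega
      refine hQ _ cnt len best hv₂ ?_ (hN.congr (fun _ _ _ => rfl) rfl rfl) hlen ?_
      · simp only [St.tick_time, Expr.cost]
        have h1 : T * (r + 1) * i + T * (r + 1) = T * ((r + 1) * (i + 1)) := by ring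
        have h2 : 1 ≤ (r + 1) * (i + 1) := Nat.mul_pos (by omega) (by omega)
        have h3 : T ≤ T * (r + 1) := Nat.le_mul_of_pos_right _ (by omega)
        have h4 : 1 ≤ (H + 2) * (H + 2) * ((r + 1) * (i + 1)) := Nat.mul_pos (by positivity) h2
        rw [hTdef] at h1 h3 ht₂
        simp only [mul_assoc] at *
        omega
      · intro Z hZ hlight
        by_cases hnil : Z = []
        · simp [hnil]
        · obtain ⟨l₁, l₂, z, hIz, hz, -⟩ := hI.complete Z i hnil hlight
            (.of_isCommonIncSubseq hZ hX.le hY.le)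
          -- Completeness and the bound on items give `|Z| * D ≤ z < (len + 1) * D` with `D = 2 * n
          -- * r + 1`.
          have h1 := lt_of_mul_lt_mul_right (hz.trans_lt (hI.le_len _ _ _ hIz)) (by positivity)
          omega
  · refine ⟨fun x hx => ?_, fun b hb => rfl, ?_, 0, cnt₀, len₀, best₀, _, by omega, by simp,
      by omega, le_rfl, hN.congr (fun x hx hx' => ?_) rfl rfl, ?_, InvB.init hS⟩
    · simp [show x ≠ 10 by omega]
    · simp; omega
    · simp [show x ≠ 10 by omega]
    · simp only [St.set_a, h4]; exact TreeRep₂.empty H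

end WordRAM

namespace WordRAM

/-! ### Output -/

theorem Chain.eq_concat {nv np : ℤ → ℤ} {id : ℕ} {Z : List ℤ} (h : Chain nv np id Z)
    (hne : Z ≠ []) : ∃ par Z', np id = (par : ℕ) ∧ Z = Z' ++ [nv id] ∧ Chain nv np par Z' := by
  cases h with
  | nil => exact absurd rfl hne
  | snoc hp hv _ h => exact ⟨_, _, hp, by rw [hv], h⟩

/-- Write the best chain to the beginning of the memory. -/
def reconstruct : Cmd :=
  13 ≔ ♯8 ;; 0 ≔ ♯8 ;;
  .loop ♭0 ♯13 (13 ≔ ♯13 -. ♭1 ;; .store 0 ♯13 (.arr 5 ♯9) ;; 9 ≔ .arr 6 ♯9)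

variable {M B : ℤ}

/-- Following predecessors yields the chain from its end, so cells are filled downwards from `len -
1`. The known part `V` is already stored, the part `W` still hangs at node `♯9`. Overwriting the
input is harmless at this stage. -/
theorem wp_reconstruct {n cnt len best : ℕ} {X Y : List ℤ} {Q : St → Prop} {s : St}
    (hX : X.length = n) (hnM : (n : ℤ) < M) (hB : B = 2 * n) (hN : Nodes X Y s cnt len best)
    (hQ : ∀ (s' : St) (Z : List ℤ), IsCommonIncSubseq Z X Y → Z.length = len → s'.v 0 = len →
      (∀ k : ℕ, k < len → s'.a 0 k = Z.getD k 0) → s'.time ≤ s.time + 40 * (n + 1) → Q s') :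
    wp varSize arrSize M B reconstruct Q s := by
  obtain ⟨Z, hZ, hlen, hcis⟩ := hN.chain
  have hlenn : len ≤ n := by rw [← hlen, ← hX]; exact hcis.2.1.length_le
  have hM1 : 1 ≤ M := by omega
  have h3 : M ≤ M ^ 3 := le_self_pow₀ hM1 (by norm_num)
  have s13 : ∀ k : ℕ, k ≤ len → |(k : ℤ)| ≤ M ^ varSize 13 := fun k hk => by
    rw [abs_of_nonneg (by positivity)]
    have : varSize 13 = 3 := rfl
    rw [this]; omega
  have s0 : |(len : ℤ)| ≤ M ^ varSize 0 := by
    rw [abs_of_nonneg (by positivity)]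
    have : varSize 0 = 1 := rfl
    rw [this, pow_one]; omega
  unfold reconstruct
  simp +decide only [wp_seq, wp_assign, Expr.ok, Expr.eval, Expr.cost, true_and, hN.v8,
    s13 len le_rfl, s0, or_true, St.set_v, if_false]
  refine wp_loop (fun k s' => s'.v 0 = len ∧ s'.time + 30 * k ≤ s.time + 30 * len + 8 ∧
    k ≤ len ∧ s'.v 13 = k ∧ s'.a 5 = s.a 5 ∧ s'.a 6 = s.a 6 ∧
    (∀ j : ℕ, k ≤ j → j < len → s'.a 0 j = Z.getD j 0) ∧
    ∃ (id : ℕ) (W V : List ℤ), s'.v 9 = id ∧ W ++ V = Z ∧ W.length = k ∧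
      Chain (s.a 5) (s.a 6) id W) ?_ len ?_
  · rintro k s' ⟨h0, ht, hk, h13, h5, h6, hout, id, W, V, h9, hWV, hW, hch⟩
    refine ⟨trivial, trivial, fun hlt => ?_, fun hge => ?_⟩
    · simp only [Expr.eval, h13] at hlt
      obtain ⟨k, rfl⟩ : ∃ k', k = k' + 1 := ⟨k - 1, by omega⟩
      refine ⟨k, rfl, ?_⟩
      have e13 : ((k + 1 : ℕ) : ℤ) - 1 = k := by push_cast; ring
      have hkB : (k : ℤ) < B := by omega
      obtain ⟨par, W', hpar, rfl, hch'⟩ := hch.eq_concat (by rintro rfl; simp at hW)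
      have hW' : W'.length = k := by simpa using hW
      simp +decide only [wp_seq, wp_assign, wp_store, Expr.ok, Expr.eval, Expr.cost, true_and,
        true_or, St.set_v, St.set_a, St.tick_v, St.tick_a, St.put_v, if_true, if_false, h13, e13,
        s13 k (by omega), or_true, h9, Int.natCast_nonneg, hkB, true_imp_iff, false_imp_iff, h5,
        h6, St.put_a, hpar]
      refine ⟨by simp [h0], by simp; omega, by omega, ?_, ?_, fun j hj hj' => ?_, par,
        W', [s.a 5 id] ++ V, by simp, by rw [← hWV]; simp, hW', hch'⟩
      · rw [St.put_a_ne _ _ _ _ _ (by norm_num)]; exact h5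
      · rw [St.put_a_ne _ _ _ _ _ (by norm_num)]; exact h6
      · by_cases hjk : j = k
        · subst hjk
          simp [← hWV, ← hW']
        · simpa [hjk] using hout j (by omega) hj'
    · simp only [Expr.eval, h13] at hge
      refine hQ _ Z hcis hlen h0 (fun j hj => hout j (by omega) hj) ?_
      simp [Expr.cost]; omega
  · exact ⟨by simp, by simp; omega, le_rfl, by simp, rfl, rfl, fun j hj hj' => by omega,
      best, Z, [], by simp [hN.v9], by simp, hlen, hZ⟩

/-! ### The algorithm -/

/-- There are few frequent values. -/
theorem length_mul_le_of_not_light {n r : ℕ} {y : ℕ → ℤ} {S : ℤ → ℤ}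
    (hS : IsSorted n y fun k => S k) {W : List ℤ} (hW : W.Pairwise (· < ·))
    (hheavy : ∀ w ∈ W, ¬ Light n r S w) : W.length * r ≤ n := by
  -- The lower bound `a` is carried along so that the induction can count the entries of the sorted
  -- sequence from the block of `a` on.
  have key : ∀ W : List ℤ, W.Pairwise (· < ·) → (∀ w ∈ W, ¬ Light n r S w) →
      ∀ a, (∀ w ∈ W, a ≤ w) → firstGE n (fun k => S k) (a * n) + W.length * r ≤ n := by
    intro W
    induction W with
    | nil => intro _ _ a _; simpa using (hS.isLB (a * n)).le
    | cons v W ih =>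
      intro hW hheavy a ha
      obtain ⟨h1, h2⟩ := List.pairwise_cons.1 hW
      have h3 := ih h2 (fun w hw => hheavy w (by simp [hw])) (v + 1)
        (fun w hw => by have := h1 w hw; omega)
      have h4 := hheavy v (by simp)
      unfold Light at h4
      push Not at h4
      have h5 : firstGE n (fun k => S k) (a * n) ≤ firstGE n (fun k => S k) (v * n) :=
        firstGE_mono (mul_le_mul_of_nonneg_right (ha v (by simp)) (by positivity))
      -- Failure of lightness means that the entry `r` places after the start of the block still
      -- belongs to `v`, so the block of `v + 1` starts later.
      have h6 : firstGE n (fun k => S k) (v * n) + r < firstGE n (fun k => S k) ((v + 1) * n) := by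
        by_contra hge
        have := (hS.isLB ((v + 1) * n)).ge _ (not_lt.1 hge) h4.1
        have e : (v + 1) * n = v * n + n := by ring
        omega
      rw [List.length_cons, Nat.succ_mul]
      omega
  cases W with
  | nil => simp
  | cons v W =>
    have := key _ hW hheavy v (by
      rintro w (_ | ⟨_, hw⟩)
      · exact le_rfl
      · exact ((List.pairwise_cons.1 hW).1 w hw).le)
    omega

theorem _root_.IsCommonIncSubseq.of_sublist {X Y Z Z' : List ℤ} (h : IsCommonIncSubseq Z X Y)
    (hZ : Z'.Sublist Z) : IsCommonIncSubseq Z' X Y :=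
  ⟨h.1.sublist hZ, hZ.trans h.2.1, hZ.trans h.2.2⟩

/-- If all common subsequences of length at most `r` or of rare values have length at
most `len`, then `len` is close to the optimum. -/
theorem lcis_le_of_light {n r len₀ len : ℕ} {X Y : List ℤ} {S : ℤ → ℤ}
    (hS : IsSorted n (fun j => Y.getD j 0) fun k => S k)
    (hshort : ∀ Z, IsCommonIncSubseq Z X Y → Z.length ≤ r → Z.length ≤ len₀) (hlen : len₀ ≤ len)
    (hlight : ∀ Z, IsCommonIncSubseq Z X Y → (∀ w ∈ Z, Light n r S w) → Z.length ≤ len) :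
    lcis X Y ≤ len ∨ r ≤ len ∧ ∃ h, lcis X Y ≤ len + h ∧ h * r ≤ n := by
  classical
  obtain ⟨Z, hZ, hZl⟩ := (lcis_isGreatest X Y).1
  rw [← hZl]
  by_cases hr : Z.length ≤ r
  · exact Or.inl ((hshort Z hZ hr).trans hlen)
  -- A long optimum contains a chain of length exactly `r`, so the output has at least this length;
  -- this turns the additive loss into a multiplicative one.
  · have h1 := hshort (Z.take r) (hZ.of_sublist (List.take_sublist _ _)) (by simp)
    rw [List.length_take, min_eq_left (by omega)] at h1
    refine Or.inr ⟨h1.trans hlen, (Z.filter fun w => ¬ Light n r S w).length, ?_,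
      length_mul_le_of_not_light hS (hZ.1.filter _) (by simp)⟩
    have h2 := hlight (Z.filter fun w => Light n r S w) (hZ.of_sublist List.filter_sublist)
      (by simp)
    have h3 := List.length_eq_length_filter_add (l := Z) fun w => decide (Light n r S w)
    simp only [decide_not] at *
    omega

/-- The approximation algorithm. -/
def approxLCIS : Cmd :=
  parameters ;; upperBound ;; fill ;; extract ;; phaseA ;; phaseB ;; reconstruct

/-- The number `40` is a common bound for all sizes that occur. The check is a finite computation,
independent of the input. -/
theorem wf_approxLCIS : approxLCIS.wf varSize arrSize 40 = true := by decide

/-- The factor `1180` is the sum of the constants `20`, `40`, `80`, `100`, `400`, `500` and `40` of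
the seven parts, each of whose remaining factors is bounded by the one product. -/
theorem wp_approxLCIS {n p q : ℕ} {X Y : List ℤ} {Q : St → Prop} {s : St} (hM : 2 ≤ M)
    (hX : X.length = n) (hY : Y.length = n) (hp : 0 < p) (hq : 0 < q) (hn : 0 < n)
    (hnM : (n : ℤ) < M) (hqM : (q : ℤ) < M) (hB : B = 2 * n) (h0 : s.v 0 = n) (h1 : s.v 1 = p)
    (h2 : s.v 2 = q) (hsX : ∀ i : ℕ, i < n → s.a 0 i = X.getD i 0)
    (hsY : ∀ j : ℕ, j < n → s.a 0 (n + j) = Y.getD j 0) (ha : ∀ b, 0 < b → s.a b = fun _ => 0)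
    (hQ : ∀ (s' : St) (H r : ℕ) (Z : List ℤ), IsCommonIncSubseq Z X Y →
      (lcis X Y ≤ Z.length ∨ r ≤ Z.length ∧ ∃ h, lcis X Y ≤ Z.length + h ∧ h * r ≤ n) →
      s'.v 0 = Z.length → (∀ k : ℕ, k < Z.length → s'.a 0 k = Z.getD k 0) →
      2 ^ H ≤ 2 * (n + 1) → 0 < r → n * q ≤ r * r * p → (r - 1) * (r - 1) * p < n * q →
      s'.time ≤ s.time + 1180 * ((H + 2) * (H + 2) * ((r + 1) * (n + 1))) → Q s') :
    wp varSize arrSize M B approxLCIS Q s := by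
  unfold approxLCIS
  rw [wp_seq]
  refine wp_parameters hM h0 h1 h2 hp hq hn hnM hqM ?_
  intro s₁ H r h0₁ ha₁ h3₁ hH hH' hr h4₁ h6₁ hr₁ hr₂ ht₁
  -- From `(r - 1) ^ 2 ≤ (r - 1) ^ 2 * p < n * q ≤ M ^ 2`.
  have hrM : (r : ℤ) ≤ M := by
    have e : (((r - 1 : ℕ) : ℤ)) * ((r - 1 : ℕ) : ℤ) < M * M := by
      have e1 : ((r - 1 : ℕ) : ℤ) * ((r - 1 : ℕ) : ℤ) * 1 ≤
          ((r - 1 : ℕ) : ℤ) * ((r - 1 : ℕ) : ℤ) * p :=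
        mul_le_mul_of_nonneg_left (by omega) (by positivity)
      have e2 : (((r - 1 : ℕ) : ℤ)) * ((r - 1 : ℕ) : ℤ) * p < n * q := by exact_mod_cast hr₂
      have e3 : (n : ℤ) * q ≤ M * M := mul_le_mul hnM.le hqM.le (by positivity) (by omega)
      linarith
    have := lt_of_mul_self_lt_mul_self₀ (by omega) e
    omega
  have hM3 : 4 * M ≤ M ^ 3 := by nlinarith [mul_self_nonneg (M - 2), mul_nonneg (by omega : 0 ≤ M) (by nlinarith : 0 ≤ M * M - 4)]
  have hD : (2 * n * r + 1 : ℤ) ≤ M ^ 6 := by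
    have e1 : (n : ℤ) * r ≤ M * M := mul_le_mul hnM.le hrM (by positivity) (by omega)
    have e2 : 4 * M * (4 * M) ≤ M ^ 3 * M ^ 3 :=
      mul_le_mul hM3 hM3 (by omega) (by positivity)
    have e3 : M ^ 6 = M ^ 3 * M ^ 3 := by ring
    nlinarith
  rw [wp_seq]
  refine wp_upperBound h0₁ hnM hB ?_
  intro s₂ hv₂ ha₂ hub ht₂
  rw [ha₁] at ha₂ hub
  have h0₂ := (hv₂ 0 (by norm_num)).trans h0₁
  have h3₂ := (hv₂ 3 (by norm_num)).trans h3₁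
  rw [wp_seq]
  refine wp_fill h0₂ hnM h3₂ hH hB (by simp [ha₂, ha]) ?_
  intro s₃ hv₃ h5₃ ha₃ hT₃ hfill hfill' ht₃
  simp only [ha₂] at hfill
  rw [wp_seq]
  refine wp_extract (y := fun j => Y.getD j 0) ((hv₃ 0 (by norm_num) (by norm_num)).trans h0₂) hnM
    ((hv₃ 3 (by norm_num) (by norm_num)).trans h3₂) hH h5₃ (fun j hj => ?_) hT₃
    (fun j hj => by rw [hfill j hj, hsY j hj]) hfill' ?_
  · have := hub j hj
    rw [hsY j hj] at this
    have := mul_le_mul_of_nonneg_right this (by positivity : (0 : ℤ) ≤ n)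
    omega
  intro s₄ hv₄ ha₄ hS ht₄
  have hv : ∀ x, x < 7 → x ≠ 5 → s₄.v x = s₁.v x := fun x hx hx' => by
    rw [hv₄ x (by omega), hv₃ x (by omega) hx', hv₂ x (by omega)]
  have ha₄' : ∀ b, b ≠ 1 → b ≠ 2 → s₄.a b = s.a b := fun b hb hb' => by
    rw [ha₄ b hb hb', ha₃ b hb', ha₂]
  have hE : Env n H r X Y (fun k => s₄.a 1 k) s₄ :=
    ⟨(hv 0 (by norm_num) (by norm_num)).trans h0₁, (hv 3 (by norm_num) (by norm_num)).trans h3₁,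
      (hv 4 (by norm_num) (by norm_num)).trans h4₁, (hv 6 (by norm_num) (by norm_num)).trans h6₁,
      fun i hi => by rw [ha₄' 0 (by norm_num) (by norm_num)]; exact hsX i hi, fun _ _ => rfl⟩
  rw [wp_seq]
  refine wp_phaseA (S := s₄.a 1) hE hS hX hY hH hnM (by omega) hD hB
    ((ha₄' 3 (by norm_num) (by norm_num)).trans (ha 3 (by norm_num))) ?_
  intro s₅ cnt₀ len₀ best₀ hv₅ ha₅ ht₅ hcnt₀ hN₅ hshort
  rw [wp_seq]
  refine wp_phaseB (S := s₄.a 1)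
    (hE.congr hv₅ fun b hb => ha₅ b (by omega) (by omega)) hS hX hY hH hnM (by omega) hD hB
    ((ha₅ 4 (by norm_num) (by norm_num)).trans
      ((ha₄' 4 (by norm_num) (by norm_num)).trans (ha 4 (by norm_num)))) hN₅ hcnt₀ ?_
  intro s₆ cnt len best _ ht₆ hN₆ hlen hlight
  refine wp_reconstruct hX hnM hB hN₆ ?_
  rintro s₇ Z hZ rfl h0₇ hout ht₇
  refine hQ s₇ H r Z hZ (lcis_le_of_light hS hshort hlen hlight) h0₇ hout hH' hr hr₁ hr₂ ?_
  generalize hW : (H + 2) * (H + 2) * ((r + 1) * (n + 1)) = W at *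
  have b3 : (H + 2) * ((r + 1) * (n + 1)) ≤ W := by
    rw [← hW, mul_assoc]; exact Nat.le_mul_of_pos_left _ (by omega)
  have b2 : (H + 2) * (n + 1) ≤ W := by
    refine le_trans (Nat.mul_le_mul_left _ ?_) b3
    exact Nat.le_mul_of_pos_left _ (by omega)
  have b4 : n + 1 ≤ W := le_trans (Nat.le_mul_of_pos_left _ (by omega)) b2
  have b1 : H + r + 2 ≤ W := by
    have e1 : r ≤ (H + 2) * r := Nat.le_mul_of_pos_left _ (by omega)
    have e2 : (H + 2) * (r + 1) ≤ (H + 2) * ((r + 1) * (n + 1)) :=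
      Nat.mul_le_mul_left _ (Nat.le_mul_of_pos_right _ (by omega))
    rw [Nat.mul_succ] at e2
    omega
  simp only [mul_assoc] at *
  omega

end WordRAM

/-! ### Running the compiled algorithm on the encoded input -/

namespace WordRAM

/-- The initial state of the algorithm. -/
def initial (X Y : List ℤ) (p q : ℕ) : St where
  v := (lcisInput X Y p q).reg
  a := fun b i => if b = 0 then if 0 ≤ i then (X ++ Y).getD i.toNat 0 else 0 else 0
  time := 0

theorem abs_getD_le {X : List ℤ} {M : ℤ} (hM : 0 ≤ M) (h : ∀ x ∈ X, |x| ≤ M) (i : ℕ) :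
    |X.getD i 0| ≤ M := by
  by_cases hi : i < X.length
  · rw [List.getD_eq_getElem _ _ hi]
    exact h _ (List.getElem_mem hi)
  · rw [List.getD_eq_default _ _ (by omega)]
    simpa using hM

theorem wellTyped_initial {X Y : List ℤ} {p q : ℕ} {M : ℤ} (hM : 0 ≤ M) (hX : (X.length : ℤ) ≤ M)
    (hp : (p : ℤ) ≤ M) (hq : (q : ℤ) ≤ M) (hXM : ∀ x ∈ X, |x| ≤ M) (hYM : ∀ y ∈ Y, |y| ≤ M) :
    WellTyped varSize arrSize M (initial X Y p q) where
  var x := by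
    have h0 : (0 : ℤ) ≤ M ^ varSize x := by positivity
    simp only [initial, lcisInput]
    split_ifs with h1 h2 h3
    · subst h1; simpa [varSize] using hX
    · subst h2; simpa [varSize] using hp
    · subst h3; simpa [varSize] using hq
    · simpa using h0
  arr b i := by
    have h0 : (0 : ℤ) ≤ M ^ arrSize b := by positivity
    simp only [initial]
    split_ifs with h1 h2
    · subst h1
      simp only [arrSize, List.getD_cons_zero, pow_one]
      refine abs_getD_le hM (fun x hx => ?_) _
      rcases List.mem_append.1 hx with hx | hx
      · exact hXM x hx
      · exact hYM x hx
    · simpa using h0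
    · simpa using h0

/-- The algorithm on the word RAM. -/
theorem exists_haltsAfter {n b p q : ℕ} {X Y : List ℤ} (hX : X.length = n) (hY : Y.length = n)
    (hn : 0 < n) (hp : 0 < p) (hq : 0 < q) (hnb : n < 2 ^ b) (hpb : p < 2 ^ b) (hqb : q < 2 ^ b)
    (hXb : ∀ x ∈ X, |x| < 2 ^ b) (hYb : ∀ y ∈ Y, |y| < 2 ^ b) :
    ∃ (t H r : ℕ) (s : Config) (Z : List ℤ),
      HaltsAfter (41 * b) approxLCIS.program (lcisInput X Y p q) t s ∧ IsOutput s Z ∧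
      IsCommonIncSubseq Z X Y ∧
      (lcis X Y ≤ Z.length ∨ r ≤ Z.length ∧ ∃ h, lcis X Y ≤ Z.length + h ∧ h * r ≤ n) ∧
      2 ^ H ≤ 2 * (n + 1) ∧ 0 < r ∧ n * q ≤ r * r * p ∧ (r - 1) * (r - 1) * p < n * q ∧
      t ≤ 1183 * ((H + 2) * (H + 2) * ((r + 1) * (n + 1))) := by
  have hb : b ≠ 0 := by
    rintro rfl
    simp at hnb; omega
  have hM : (2 : ℤ) ≤ 2 ^ b := le_self_pow₀ (by norm_num) hb
  have hnM : (n : ℤ) < 2 ^ b := by exact_mod_cast hnb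
  have hpM : (p : ℤ) < 2 ^ b := by exact_mod_cast hpb
  have hqM : (q : ℤ) < 2 ^ b := by exact_mod_cast hqb
  have h0 : (initial X Y p q).v 0 = n := by simp [initial, lcisInput, hX]
  have hmem : ∀ i : ℕ, (initial X Y p q).a 0 i = (X ++ Y).getD i 0 := fun i => by
    simp [initial]
  obtain ⟨s', hexec, H, r, Z, hZ, hap, hs0, hsZ, hH, hr0, hr1, hr2, ht⟩ :=
    wp_approxLCIS (M := 2 ^ b) (B := (2 * n : ℕ)) (s := initial X Y p q)
      (Q := fun s' => ∃ (H r : ℕ) (Z : List ℤ), IsCommonIncSubseq Z X Y ∧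
        (lcis X Y ≤ Z.length ∨ r ≤ Z.length ∧ ∃ h, lcis X Y ≤ Z.length + h ∧ h * r ≤ n) ∧
        s'.v 0 = Z.length ∧ (∀ k : ℕ, k < Z.length → s'.a 0 k = Z.getD k 0) ∧
        2 ^ H ≤ 2 * (n + 1) ∧ 0 < r ∧ n * q ≤ r * r * p ∧ (r - 1) * (r - 1) * p < n * q ∧
        s'.time ≤ (initial X Y p q).time + 1180 * ((H + 2) * (H + 2) * ((r + 1) * (n + 1))))
      hM hX hY hp hq hn hnM hqM (by push_cast; rfl) h0 (by simp [initial, lcisInput])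
      (by simp [initial, lcisInput])
      (fun i hi => by rw [hmem, List.getD_append _ _ _ _ (by omega)])
      (fun j hj => by
        have := hmem (n + j)
        rw [List.getD_append_right _ _ _ _ (by omega), hX, Nat.add_sub_cancel_left] at this
        rw [← this]; push_cast; rfl)
      (fun b hb => by funext i; simp [initial, show b ≠ 0 by omega])
      (fun s' H r Z h1 h2 h3 h4 h5 h6 h7 h8 h9 => ⟨H, r, Z, h1, h2, h3, h4, h5, h6, h7, h8, h9⟩)
  -- All values are at most `M ^ 40 = 2 ^ (40 * b)`, which is strictly below `2 ^ (41 * b)` because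
  -- `b ≠ 0`.
  obtain ⟨c', hc', hrep⟩ := Cmd.program_haltsAfter (w := 41 * b) (m := 40) hM
    (by push_cast; nlinarith) (by norm_num)
    (fun z hz => hz.trans_lt (by
      rw [← pow_mul]; exact pow_lt_pow_right₀ (by norm_num) (by omega)))
    hexec (wellTyped_initial (by positivity) (by rw [hX]; exact hnM.le) hpM.le hqM.le
      (fun x hx => (hXb x hx).le) fun y hy => (hYb y hy).le)
    wf_approxLCIS rfl (c := lcisInput X Y p q) rfl (fun _ _ => rfl) (by simp [lcisInput])
    (by simp [lcisInput, hX]; ring) (fun a i _ hi => by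
      unfold addr
      by_cases ha : a = 0
      · subst ha; rw [if_pos rfl, hmem]; rfl
      · rw [if_neg ha]
        simp only [initial, if_neg ha, lcisInput]
        exact List.getD_eq_default _ _ (by rw [List.length_append]; omega))
  refine ⟨_, H, r, c', Z, hc', ⟨?_, fun i hi => ?_⟩, hZ, hap, hH, hr0, hr1, hr2, ?_⟩
  · rw [hrep.var 0 (by norm_num), hs0]
  · have hi' : i < 2 * n := by
      have := hZ.2.1.length_le
      omega
    have := hrep.mem 0 i (by norm_num) fun _ => hi'
    rw [addr, if_pos rfl] at this
    rw [this, hsZ i hi, List.getD_eq_getElem]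
  · have e : 1 ≤ (H + 2) * (H + 2) * ((r + 1) * (n + 1)) := Nat.mul_pos (by positivity) (by positivity)
    have : (initial X Y p q).time = 0 := rfl
    omega

end WordRAM

/-! ### Real estimates: approximation factor and running time -/

/-- Few frequent values do not spoil the approximation. -/
theorem lcis_le_of_mul_le {n p q r : ℕ} {ε : ℝ} {L m : ℕ} (hp : 0 < p) (hq : 0 < q)
    (hpq : (p : ℝ) / q ≤ ε) (hr0 : 0 < r) (hr : n * q ≤ r * r * p)
    (h : L ≤ m ∨ r ≤ m ∧ ∃ h, L ≤ m + h ∧ h * r ≤ n) : (L : ℝ) ≤ (1 + ε) * m := by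
  have hp' : (0 : ℝ) < p := by exact_mod_cast hp
  have hq' : (0 : ℝ) < q := by exact_mod_cast hq
  have hε : 0 < ε := lt_of_lt_of_le (by positivity) hpq
  have hm0 : (0 : ℝ) ≤ m := by positivity
  rcases h with h | ⟨hm, h, h1, h2⟩
  · have : (L : ℝ) ≤ m := by exact_mod_cast h
    nlinarith
  · have hr' : (0 : ℝ) < r := by exact_mod_cast hr0
    have hm' : (r : ℝ) ≤ m := by exact_mod_cast hm
    have h1' : (L : ℝ) ≤ m + h := by exact_mod_cast h1
    have h2' : (h : ℝ) * r ≤ n := by exact_mod_cast h2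
    have h3 : (n : ℝ) * q ≤ r * r * p := by exact_mod_cast hr
    have h4 : (n : ℝ) ≤ r * r * (p / q) := by
      rw [← mul_div_assoc, le_div_iff₀ hq']; exact h3
    -- Both sides carry a factor `r`; cancelling it leaves `h ≤ r * ε ≤ m * ε`, which is the allowed
    -- loss.
    have h5 : (h : ℝ) * r ≤ r * ε * r := by
      calc (h : ℝ) * r ≤ r * r * (p / q) := h2'.trans h4
        _ ≤ r * r * ε := by gcongr
        _ = r * ε * r := by ring
    have h6 := le_of_mul_le_mul_right h5 hr'
    have h7 : (r : ℝ) * ε ≤ m * ε := by gcongr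
    linarith

/-- Taking logarithms bounds `H` by a multiple of `log (n + 2)` plus a constant, and the constants
are absorbed since `n + 2 ≥ 3 > e`. -/
theorem height_le_log {n H : ℕ} (hn : 0 < n) (hH : 2 ^ H ≤ 2 * (n + 1)) :
    ((H : ℝ) + 2) ≤ 5 * Real.log (n + 2) := by
  have h2 := Real.log_two_gt_d9
  have hl : 1 ≤ Real.log ((n : ℝ) + 2) := by
    rw [Real.le_log_iff_exp_le (by positivity)]
    have := Real.exp_one_lt_d9
    have : (1 : ℝ) ≤ n := by exact_mod_cast hn
    linarith
  have h1 : (2 : ℝ) ^ H ≤ 2 * ((n : ℝ) + 2) := by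
    have : ((2 : ℝ)) ^ H ≤ 2 * ((n : ℝ) + 1) := by exact_mod_cast hH
    linarith
  have h3 := Real.log_le_log (by positivity) h1
  rw [Real.log_pow, Real.log_mul (by norm_num) (by positivity)] at h3
  nlinarith

theorem rpow_mul_rpow_eq {n ε : ℝ} (hn : 0 < n) (hε : 0 < ε) :
    n ^ (3 / 2 : ℝ) * ε ^ (-(1 / 2) : ℝ) = n * Real.sqrt (n / ε) := by
  rw [Real.sqrt_eq_rpow, Real.div_rpow hn.le hε.le, Real.rpow_neg hε.le,
    show (3 / 2 : ℝ) = 1 + 1 / 2 by norm_num, Real.rpow_add hn, Real.rpow_one]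
  ring

/-- Minimality of `r` and `ε ≤ 2 * p / q` give `(r - 1) ^ 2 ≤ 4 * n / ε`. The remaining `2` is
absorbed because `ε ≤ n` makes the square root at least `1`. -/
theorem threshold_le_sqrt {n p q r : ℕ} {ε : ℝ} (hp : 0 < p) (hq : 0 < q) (hr0 : 0 < r)
    (hε : 0 < ε) (hpq : ε ≤ 2 * ((p : ℝ) / q)) (hεn : ε ≤ n)
    (hr : (r - 1) * (r - 1) * p < n * q) : (r : ℝ) + 1 ≤ 4 * Real.sqrt (n / ε) := by
  have hp' : (0 : ℝ) < p := by exact_mod_cast hp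
  have hq' : (0 : ℝ) < q := by exact_mod_cast hq
  have hu : 1 ≤ Real.sqrt (n / ε) := by
    rw [Real.one_le_sqrt, le_div_iff₀ hε]; linarith
  obtain ⟨r, rfl⟩ : ∃ r', r = r' + 1 := ⟨r - 1, by omega⟩
  rw [Nat.add_sub_cancel] at hr
  have h1 : (r : ℝ) * r * p < n * q := by exact_mod_cast hr
  have h2 : (r : ℝ) ≤ Real.sqrt (2 ^ 2 * (n / ε)) := by
    refine Real.le_sqrt_of_sq_le ?_
    rw [← mul_div_assoc, le_div_iff₀ hε]
    have h3 : ε * q ≤ 2 * p := by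
      rwa [← mul_div_assoc, le_div_iff₀ hq'] at hpq
    have h4 : (r : ℝ) * r * (ε * q) ≤ r * r * (2 * p) := by gcongr
    have h5 : (r : ℝ) ^ 2 * ε * q ≤ 2 ^ 2 * n * q := by nlinarith
    exact le_of_mul_le_mul_right h5 hq'
  rw [Real.sqrt_mul (by norm_num), Real.sqrt_sq (by norm_num)] at h2
  push_cast
  linarith

/-- There is one word RAM program for all inputs. The parameter `ε` is any real number with
`0 < ε ≤ n`, passed to the program as a fraction `p / q` that is at most `ε` and correct up to
a factor of two (`p / q = ε` is allowed). If all input numbers have at most `b` bits, words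
of `c * b` bits suffice. -/
theorem mainTheorem9 :
    ∃ (P : WordRAM.Program) (c k : ℕ) (C : ℝ),
      ∀ (n b p q : ℕ) (ε : ℝ) (X Y : List ℤ),
        X.length = n → Y.length = n →
        0 < p → 0 < q → (p : ℝ) / (q : ℝ) ≤ ε → ε ≤ 2 * ((p : ℝ) / (q : ℝ)) →
        ε ≤ (n : ℝ) →
        n < 2 ^ b → p < 2 ^ b → q < 2 ^ b →
        (∀ x ∈ X, |x| < 2 ^ b) → (∀ y ∈ Y, |y| < 2 ^ b) →
        ∃ (t : ℕ) (s : WordRAM.Config) (Z : List ℤ),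
          WordRAM.HaltsAfter (c * b) P (lcisInput X Y p q) t s ∧
          IsOutput s Z ∧
          IsApproxLCIS ε X Y Z ∧
          (t : ℝ) ≤ C * (n : ℝ) ^ (3 / 2 : ℝ) * ε ^ (-(1 / 2) : ℝ) * Real.log ((n : ℝ) + 2) ^ k := by
  -- The exponent `2` comes from the two-dimensional queries. The constant is `1180` plus `3` for
  -- the start-up instructions, times `200 = 5 * 5 * 4 * 2` for replacing the two heights, `r + 1`
  -- and `n + 1` by their bounds.
  refine ⟨WordRAM.approxLCIS.program, 41, 2, 1183 * 200, ?_⟩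
  intro n b p q ε X Y hX hY hp hq hpq hpq' hεn hnb hpb hqb hXb hYb
  have hp' : (0 : ℝ) < p := by exact_mod_cast hp
  have hq' : (0 : ℝ) < q := by exact_mod_cast hq
  have hε : 0 < ε := lt_of_lt_of_le (by positivity) hpq
  have hn : 0 < n := by exact_mod_cast hε.trans_le hεn
  have hn' : (1 : ℝ) ≤ n := by exact_mod_cast hn
  obtain ⟨t, H, r, s, Z, hhalt, hout, hZ, hap, hH, hr0, hr1, hr2, ht⟩ :=
    WordRAM.exists_haltsAfter hX hY hn hp hq hnb hpb hqb hXb hYb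
  refine ⟨t, s, Z, hhalt, hout, ⟨hZ, lcis_le_of_mul_le hp hq hpq hr0 hr1 hap⟩, ?_⟩
  have h1 := height_le_log hn hH
  have h2 := threshold_le_sqrt hp hq hr0 hε hpq' hεn hr2
  have ht' : (t : ℝ) ≤ 1183 * (((H : ℝ) + 2) * (H + 2) * ((r + 1) * (n + 1))) := by
    exact_mod_cast ht
  rw [mul_assoc (1183 * 200 : ℝ), rpow_mul_rpow_eq (by linarith) hε]
  set l := Real.log ((n : ℝ) + 2)
  set u := Real.sqrt ((n : ℝ) / ε)
  calc (t : ℝ) ≤ 1183 * (((H : ℝ) + 2) * (H + 2) * ((r + 1) * (n + 1))) := ht'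
    _ ≤ 1183 * ((5 * l) * (5 * l) * ((4 * u) * (2 * n))) := by
      have hl : 0 ≤ 5 * l := le_trans (by positivity) h1
      gcongr
      linarith
    _ = 1183 * 200 * (n * u) * l ^ 2 := by ring
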